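/- **Setting.** Let $\mathbb T=\mathbb R/2\pi\mathbb Z$, $\langle x\rangle=(1+|x|^2)^{1/2}$, $\int F(\xi)\,(d\xi)_{\mathbb T}=\frac1{2\pi}\sum_{\xi\in\mathbb Z}F(\xi)$, let $\hat u(\xi,\tau)=\int_{\mathbb R}\int_{\mathbb T}e^{-i(x\xi+t\tau)}u(x,t)\,dx\,dt$ denote the space-time Fourier transform of a distribution on $\mathbb T\times\mathbb R$ (tempered in $t$), and $\hat a(\xi)=\int_{\mathbb T}e^{-ix\xi}a(x)\,dx$ the Fourier coefficients of a distribution on $\mathbb T$. For $s,b\in\mathbb R$ put $$\|u\|_{X_{s,b}}=\Big(\iint\langle\xi\rangle^{2s}\langle\tau-\xi^3\rangle^{2b}|\hat u(\xi,\tau)|^2\,(d\xi)_{\mathbb T}\,d\tau\Big)^{1/2},\qquad \|u\|_{Z^s}=\|u\|_{X_{s,-1/2}}+\Big\|\frac{\langle\xi\rangle^s}{\langle\tau-\xi^3\rangle}\hat u(\xi,\tau)\Big\|_{L^2((d\xi)_{\mathbb T})L^1(d\tau)},$$ $$\|a\|_{H^s}=\Big(\int\langle\xi\rangle^{2s}|\hat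 a(\xi)|^2\,(d\xi)_{\mathbb T}\Big)^{1/2},\qquad \|u\|_{X^\delta_{s,b}}=\inf\{\|U\|_{X_{s,b}}: U=u\text{ on }\mathbb T\times[-\delta,\delta]\},$$ where $U\in X_{s,b}$ and $U=u$ on $\mathbb T\times[-\delta,\delta]$ means that $U$ is an extension of $u$ (equality is in the sense of distributions on the interior). The product of $U$ with a time-independent $a$ is given by $\widehat{Ua}(\xi)=\int\hat U(\xi_1)\hat a(\xi-\xi_1)\,(d\xi_1)_{\mathbb T}$, where the hats denote Fourier coefficients in $x$ and the series is taken in the space of tempered distributions in $t$. **Lemma 2.7.** Let $s>-\frac14$, let $\psi:\mathbb R\to\mathbb R$ be an even, smooth, compactly supported function, and let $\varepsilon>0$. There is a constant $C=C(s,\psi,\varepsilon)$ such that the following holds for all $0<\delta\le1$, all $u\in X^\delta_{s,1/2}$ with zero $x$-mean at the times in $[-\delta,\delta]$, all $a\in H^s(\mathbb T)$ with zero mean, and every extension $U\in X_{s,1/2}$ of $u$. 1. The series defining the product $Ua$ converge. 2. If $U$ has zero $x$-mean, then $$\|\psi(t/\delta)\,\partial_x(Ua)\|_{Z^s}\le C\,\delta^{\frac13-\varepsilon}\,\|U\|_{X_{s,1/2}}\,\|a\|_{H^s};$$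 here $\|U\|_{X_{s,1/2}}$ is $\|u\|_{X^\delta_{s,1/2}}$ if $U$ is an extension of least norm. 3. If $\operatorname{supp}\psi\subset[-1,1]$, so that $\psi(t/\delta)\,\partial_x(Ua)=\psi(t/\delta)\,\partial_x(ua)$ depends only on $u$, then $$\|\psi(t/\delta)\,\partial_x(ua)\|_{Z^s}\le C\,\delta^{\frac13-\varepsilon}\,\|u\|_{X^\delta_{s,1/2}}\,\|a\|_{H^s}.$$ -/

import Mathlib

open MeasureTheory Set
open scoped SchwartzMap FourierTransform ENNReal NNReal ContDiff

namespace PeriodicKdV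

noncomputable section

/-- A distribution on `𝕋 × ℝ` (with `𝕋 = ℝ / 2πℤ`), tempered in time, given by its Fourier
coefficients in the space variable: `u ξ` is the tempered distribution in `t` that is formally
`∫_𝕋 exp (-i x ξ) u (x, t) dx`. -/
abbrev SpaceTimeDist : Type := ℤ → 𝓢'(ℝ, ℂ)

/-- A distribution on `𝕋`, given by its Fourier coefficients `a ξ = ∫_𝕋 exp (-i x ξ) a(x) dx`. -/
abbrev SpaceDist : Type := ℤ → ℂ

/-- The bracket `⟨x⟩ = (1 + |x|²)^{1/2}`. -/
def bracket (x : ℝ) : ℝ := √(1 + x ^ 2)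

/-- The function `g (ξ, τ)` is the space-time Fourier transform of `u`, with the convention
`û (ξ, τ) = ∫∫ exp (-i (x ξ + t τ)) u (x, t) dx dt`.  Mathlib's `𝓕` in time uses the kernel
`exp (-2πi t ν)`, so that `𝓕 (u ξ)` is the distribution given by the function `ν ↦ g (ξ, 2πν)`. -/
def IsSpaceTimeFourier (u : SpaceTimeDist) (g : ℤ → ℝ → ℂ) : Prop :=
  ∀ (ξ : ℤ) (φ : 𝓢(ℝ, ℂ)),
    Integrable (fun ν : ℝ => φ ν * g ξ (2 * Real.pi * ν)) ∧
      (𝓕 (u ξ)) φ = ∫ ν : ℝ, φ ν * g ξ (2 * Real.pi * ν)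

/-- `∫ F(ξ) (dξ)_𝕋`, the integral for the normalized counting measure `(2π)⁻¹ ∑_ξ`. -/
def sumT (F : ℤ → ℝ≥0∞) : ℝ≥0∞ := ENNReal.ofReal (2 * Real.pi)⁻¹ * ∑' ξ : ℤ, F ξ

/-- The `X_{s,b}` norm in terms of the space-time Fourier transform `g`:
`(∫∫ ⟨ξ⟩^{2s} ⟨τ - ξ³⟩^{2b} |g (ξ, τ)|² (dξ)_𝕋 dτ)^{1/2}`. -/
def xNormHat (s b : ℝ) (g : ℤ → ℝ → ℂ) : ℝ≥0∞ :=
  (sumT fun ξ => ∫⁻ τ : ℝ, ENNReal.ofReal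
    (bracket ξ ^ (2 * s) * bracket (τ - (ξ : ℝ) ^ 3) ^ (2 * b) * ‖g ξ τ‖ ^ 2)) ^ (1 / 2 : ℝ)

/-- The norm `‖⟨ξ⟩^s ⟨τ - ξ³⟩⁻¹ g‖` in `L²((dξ)_𝕋) L¹(dτ)`. -/
def l2l1NormHat (s : ℝ) (g : ℤ → ℝ → ℂ) : ℝ≥0∞ :=
  (sumT fun ξ => (∫⁻ τ : ℝ, ENNReal.ofReal
    (bracket ξ ^ s / bracket (τ - (ξ : ℝ) ^ 3) * ‖g ξ τ‖)) ^ (2 : ℝ)) ^ (1 / 2 : ℝ)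

/-- The norm of the Bourgain space `X_{s,b}`.  The space-time Fourier transform of `u`, if it is a
function, is unique up to null sets, so the infimum just inserts it; the norm is `∞` if the
Fourier transform of `u` is not a function. -/
def xNorm (s b : ℝ) (u : SpaceTimeDist) : ℝ≥0∞ :=
  ⨅ (g : ℤ → ℝ → ℂ) (_ : IsSpaceTimeFourier u g), xNormHat s b g

/-- The norm of `Z^s`, `‖u‖_{X_{s,-1/2}} + ‖⟨ξ⟩^s ⟨τ - ξ³⟩⁻¹ û‖_{L²((dξ)_𝕋) L¹(dτ)}`. -/
def zNorm (s : ℝ) (u : SpaceTimeDist) : ℝ≥0∞ :=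
  ⨅ (g : ℤ → ℝ → ℂ) (_ : IsSpaceTimeFourier u g), (xNormHat s (-1 / 2) g + l2l1NormHat s g)

/-- `u = v` on `𝕋 × Ω`, as distributions on the interior. -/
def AgreeOn (Ω : Set ℝ) (u v : SpaceTimeDist) : Prop :=
  ∀ (ξ : ℤ) (φ : 𝓢(ℝ, ℂ)), tsupport φ ⊆ interior Ω → u ξ φ = v ξ φ

/-- The norm of the restriction space `X_{s,b}^Ω`; it depends only on `u` on `𝕋 × Ω`, and it is
finite if and only if `u` coincides on `𝕋 × Ω` with an element of `X_{s,b}`. -/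
def xNormOn (Ω : Set ℝ) (s b : ℝ) (u : SpaceTimeDist) : ℝ≥0∞ :=
  ⨅ (U : SpaceTimeDist) (_ : AgreeOn Ω u U), xNorm s b U

/-- `u` has zero `x`-mean at the times in `Ω`. -/
def MeanZeroOn (Ω : Set ℝ) (u : SpaceTimeDist) : Prop :=
  ∀ φ : 𝓢(ℝ, ℂ), tsupport φ ⊆ interior Ω → u 0 φ = 0

/-- The norm of `H^s(𝕋)`. -/
def hNorm (s : ℝ) (a : SpaceDist) : ℝ≥0∞ :=
  (sumT fun ξ => ENNReal.ofReal (bracket ξ ^ (2 * s) * ‖a ξ‖ ^ 2)) ^ (1 / 2 : ℝ)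

/-- The terms `û (ξ₁) â (ξ - ξ₁)` of the `ξ`-th Fourier coefficient of the product `u a` with a
time-independent factor `a`. -/
def prodTerm (u : SpaceTimeDist) (a : SpaceDist) (ξ ξ₁ : ℤ) : 𝓢'(ℝ, ℂ) := a (ξ - ξ₁) • u ξ₁

/-- The product `u a` exists: the convolution series of the Fourier coefficients converge
(unconditionally) as tempered distributions in time. -/
def HasProd (u : SpaceTimeDist) (a : SpaceDist) : Prop :=
  ∀ ξ : ℤ, Summable (prodTerm u a ξ)

/-- The product `u a`, with `ξ`-th Fourier coefficient `∫ û (ξ₁) â (ξ - ξ₁) (dξ₁)_𝕋`. -/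
def prod (u : SpaceTimeDist) (a : SpaceDist) : SpaceTimeDist :=
  fun ξ => (((2 * Real.pi)⁻¹ : ℝ) : ℂ) • ∑' ξ₁ : ℤ, prodTerm u a ξ ξ₁

/-- The derivative `∂ₓ u`. -/
def dx (u : SpaceTimeDist) : SpaceTimeDist := fun ξ => (Complex.I * (ξ : ℂ)) • u ξ

/-- The product `ψ(t/δ) u`. -/
def cutoff (ψ : ℝ → ℝ) (δ : ℝ) (u : SpaceTimeDist) : SpaceTimeDist :=
  fun ξ => TemperedDistribution.smulLeftCLM ℂ (fun t : ℝ => ((ψ (t / δ) : ℝ) : ℂ)) (u ξ)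

end

end PeriodicKdV

/-!
The idea is to pass to absolute values on the Fourier side and to trade the powers of the
modulations `τ - ξ³` that the algebra does not need for powers of `δ`.

The Fourier transform of `ψ(t/δ) ∂ₓ(U a)` is `i ξ` times a convolution in `ξ` of the Fourier
transforms of `U` and `a`, convolved in `τ` with the Fourier transform of `ψ(t/δ)`.  The latter is
at most a constant times the kernel `kern δ` of mass `O(1)` and width `δ⁻¹`
(`exists_enorm_fourierInv_cutoff_le`).  As `kern δ` is dominated by its convolution with itself
(`kern_le_smear`), one may smear in `τ` twice, once in the factor `U` and once in the product, which
corresponds to cutting off both.  Hence it suffices to bound the norms of the nonnegative function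
`majorant` (`exists_majorant_le`), and this uses three ingredients.

* Smearing.  A cutoff at scale `δ` gains `δ^{(1 - b)/2}`, up to an `ε`, when it maps `X_{s,1/2}` to
  `X_{s,b/2}`, or `X_{s,-b/2}` to `X_{s,-1/2}` or to the `L²L¹` part of `Z^s`.  All of this follows
  from the Cauchy–Schwarz inequality and one estimate for `kern δ` against a weight `⟨τ - p⟩⁻¹`
  (`exists_lintegral_kern_mul_le`).
* Resonance.  A time-independent factor does not change `τ`, so that the difference of the
  modulations of the output frequency `ξ` and the input frequency `η` is `ξ³ - η³`, of size
  `|ξ - η| max(|ξ|, |η|)²` (`resonance_lower_bound`).  For nonzero `ξ`, `η`, `ξ - η`, which is where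
  zero means enter, the square root of the larger modulation therefore pays for the derivative and
  for the weights, if `s > -1/4` (`exists_resonance_le`).
* Counting.  The modulations `τ - ξ³` are spread out like cubes, so that `⟨τ - ξ³⟩^{-b}` is summable
  in `ξ` uniformly in `τ` if `b > 1/3` (`exists_tsum_modulation_le`).  Thus the smaller modulation
  needs the exponent `b/2` only, with `b` slightly larger than `1/3`, instead of `1/2`, and the
  cutoff turns the remaining `(1 - b)/2` into `δ^{1/3 - ε}`.

In the `L²L¹` part there is no factor in `L²` to spend when the output modulation dominates.  There,
the power `5/8` of the output modulation is spent on the resonance, which leaves decay in `ξ - η`,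
and the remaining power `3/8` is passed on to the input modulation, where it makes the function
integrable in `τ` (`exists_lsq_dprod_output_le`).

The product exists because the convolution series converges absolutely when it is tested against
Schwartz functions: the Fourier coefficients of elements of `X_{s,1/2}` gain half a power of the
frequency in the process, because the modulation of a bounded `τ` is large, and this compensates for
the two Sobolev weights if `s > -1/4` (`hasProd_of_lt_top`).

If `ψ` is supported in `[-1, 1]`, then the left-hand side depends only on the restriction of `U` to
the open interval: as the Fourier coefficients of `U` are square integrable in time, `ψ(t/δ)` is the
limit of cutoffs with support in the interior (`cutoff_dx_prod_eq`).  So `U` may be replaced by any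
other extension, whose mean may be removed as well, and the bound for the restriction norm follows
by taking the infimum.
-/

namespace PeriodicKdV

/-! ### Cauchy–Schwarz in `[0, ∞]` -/

theorem sq_lintegral_le {α : Type*} [MeasurableSpace α] {μ : Measure α} {h A B : α → ℝ≥0∞}
    (hA : AEMeasurable A μ) (hB : AEMeasurable B μ) (hAB : ∀ x, h x ^ 2 ≤ A x * B x) :
    (∫⁻ x, h x ∂μ) ^ 2 ≤ (∫⁻ x, A x ∂μ) * ∫⁻ x, B x ∂μ := by
  have key : ∀ x, h x ≤ A x ^ (1 / 2 : ℝ) * B x ^ (1 / 2 : ℝ) := fun x => by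
    rw [← ENNReal.mul_rpow_of_nonneg _ _ (by norm_num)]
    calc h x = (h x ^ 2) ^ (1 / 2 : ℝ) := by
          rw [← ENNReal.rpow_natCast, ← ENNReal.rpow_mul]; norm_num
      _ ≤ _ := ENNReal.rpow_le_rpow (hAB x) (by norm_num)
  have hs : ∀ x : ℝ≥0∞, (x ^ (1 / 2 : ℝ)) ^ (2 : ℝ) = x := fun x => by
    rw [← ENNReal.rpow_mul]; norm_num
  have hs' : ∀ x : ℝ≥0∞, (x ^ (1 / 2 : ℝ)) ^ 2 = x := fun x => by
    rw [← ENNReal.rpow_natCast]; exact_mod_cast hs x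
  have h1 := ENNReal.lintegral_mul_le_Lp_mul_Lq μ Real.HolderConjugate.two_two
    (hA.pow_const (1 / 2 : ℝ)) (hB.pow_const (1 / 2 : ℝ))
  simp only [hs, Pi.mul_apply] at h1
  calc (∫⁻ x, h x ∂μ) ^ 2
      ≤ ((∫⁻ x, A x ∂μ) ^ (1 / 2 : ℝ) * (∫⁻ x, B x ∂μ) ^ (1 / 2 : ℝ)) ^ 2 := by
        gcongr
        exact (lintegral_mono key).trans h1
    _ = _ := by rw [mul_pow, hs', hs']

theorem sq_tsum_le {ι : Type*} {h A B : ι → ℝ≥0∞} (hAB : ∀ i, h i ^ 2 ≤ A i * B i) :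
    (∑' i, h i) ^ 2 ≤ (∑' i, A i) * ∑' i, B i := by
  let _ : MeasurableSpace ι := ⊤
  have : MeasurableSingletonClass ι := ⟨fun _ => trivial⟩
  have h1 := sq_lintegral_le (μ := Measure.count) (h := h) (A := A) (B := B)
    (Measurable.aemeasurable fun _ _ => trivial) (Measurable.aemeasurable fun _ _ => trivial) hAB
  simpa only [lintegral_count] using h1

theorem add_sq_le_two_mul (a b : ℝ≥0∞) : (a + b) ^ 2 ≤ 2 * a ^ 2 + 2 * b ^ 2 := by
  have h := ENNReal.rpow_add_le_mul_rpow_add_rpow a b (p := 2) (by norm_num)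
  norm_num at h
  rwa [mul_add] at h

/-! ### The bracket with values in `[0, ∞]` -/

theorem one_le_bracket (x : ℝ) : 1 ≤ bracket x := by
  rw [bracket, Real.one_le_sqrt]; nlinarith [sq_nonneg x]

theorem bracket_pos (x : ℝ) : 0 < bracket x := one_pos.trans_le (one_le_bracket x)

theorem sq_bracket (x : ℝ) : bracket x ^ 2 = 1 + x ^ 2 := Real.sq_sqrt (by positivity)

theorem continuous_bracket : Continuous bracket := by unfold bracket; fun_prop

theorem bracket_le_bracket {x y : ℝ} (h : |x| ≤ |y|) : bracket x ≤ bracket y :=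
  Real.sqrt_le_sqrt (by have := sq_le_sq.2 h; linarith)

theorem abs_le_bracket (x : ℝ) : |x| ≤ bracket x := by
  rw [bracket]; exact Real.abs_le_sqrt (by linarith)

theorem bracket_neg (x : ℝ) : bracket (-x) = bracket x := by rw [bracket, bracket, neg_sq]

/-- Peetre's inequality. -/
theorem bracket_add_le (x y : ℝ) : bracket (x + y) ≤ 2 * bracket x * bracket y := by
  refine abs_le_of_sq_le_sq' ?_ (by have := bracket_pos x; have := bracket_pos y; positivity) |>.2
  rw [mul_pow, mul_pow, sq_bracket, sq_bracket, sq_bracket]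
  nlinarith [sq_nonneg (x - y), sq_nonneg (x * y), sq_nonneg x, sq_nonneg y]

/-- The bracket as an extended nonnegative number. -/
noncomputable def ebracket (x : ℝ) : ℝ≥0∞ := ENNReal.ofReal (bracket x)

theorem one_le_ebracket (x : ℝ) : 1 ≤ ebracket x := by
  rw [ebracket, ENNReal.one_le_ofReal]; exact one_le_bracket x

theorem ebracket_ne_zero (x : ℝ) : ebracket x ≠ 0 := (one_pos.trans_le (one_le_ebracket x)).ne'

theorem ebracket_ne_top (x : ℝ) : ebracket x ≠ ⊤ := ENNReal.ofReal_ne_top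

theorem ebracket_rpow (x p : ℝ) : ebracket x ^ p = ENNReal.ofReal (bracket x ^ p) :=
  ENNReal.ofReal_rpow_of_pos (bracket_pos x)

theorem ebracket_rpow_ne_top (x p : ℝ) : ebracket x ^ p ≠ ⊤ := by
  rw [ebracket_rpow]; exact ENNReal.ofReal_ne_top

theorem ebracket_rpow_mul (x p q : ℝ) : ebracket x ^ p * ebracket x ^ q = ebracket x ^ (p + q) :=
  (ENNReal.rpow_add _ _ (ebracket_ne_zero x) (ebracket_ne_top x)).symm

theorem ebracket_rpow_mul_neg (x p : ℝ) : ebracket x ^ p * ebracket x ^ (-p) = 1 := by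
  rw [ebracket_rpow_mul, add_neg_cancel, ENNReal.rpow_zero]

theorem ebracket_rpow_sq (x p : ℝ) : (ebracket x ^ p) ^ 2 = ebracket x ^ (2 * p) := by
  rw [sq, ebracket_rpow_mul]; congr 1; ring

@[fun_prop]
theorem measurable_ebracket : Measurable ebracket :=
  continuous_bracket.measurable.ennreal_ofReal

theorem ebracket_rpow_le {x y : ℝ} (h : |x| ≤ |y|) {p : ℝ} (hp : 0 ≤ p) :
    ebracket x ^ p ≤ ebracket y ^ p :=
  ENNReal.rpow_le_rpow (ENNReal.ofReal_le_ofReal (bracket_le_bracket h)) hp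

theorem ebracket_rpow_neg_le {x y : ℝ} (h : |x| ≤ |y|) {p : ℝ} (hp : 0 ≤ p) :
    ebracket y ^ (-p) ≤ ebracket x ^ (-p) := by
  rw [ENNReal.rpow_neg, ENNReal.rpow_neg]
  exact ENNReal.inv_le_inv.2 (ebracket_rpow_le h hp)

theorem lintegral_ebracket_rpow_lt_top {p : ℝ} (hp : 1 < p) :
    ∫⁻ x, ebracket x ^ (-p) < ⊤ := by
  have h := integrable_rpow_neg_one_add_norm_sq (E := ℝ) (μ := volume) (r := p) (by simpa using hp)
  have := h.lintegral_lt_top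
  refine lt_of_eq_of_lt (lintegral_congr fun x => ?_) this
  rw [ebracket_rpow, bracket, Real.sqrt_eq_rpow, ← Real.rpow_mul (by positivity)]
  simp only [Real.norm_eq_abs, sq_abs]
  congr 2; ring

/-! ### Smearing in the time frequency -/

/-- The kernel `δ (1 + (δ τ)²)⁻²`, whose integral does not depend on `δ`.  Up to a constant it
dominates the Fourier transform of `ψ(t/δ)` for every test function `ψ`. -/
noncomputable def kern (δ τ : ℝ) : ℝ≥0∞ := ENNReal.ofReal (δ / (1 + (δ * τ) ^ 2) ^ 2)

/-- Convolution with the kernel `kern δ`, for functions with values in `[0, ∞]`. -/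
noncomputable def smear (δ : ℝ) (f : ℝ → ℝ≥0∞) (τ : ℝ) : ℝ≥0∞ := ∫⁻ τ', kern δ (τ - τ') * f τ'

@[fun_prop]
theorem measurable_kern (δ : ℝ) : Measurable (kern δ) := by unfold kern; fun_prop

theorem kern_sub_comm (δ x y : ℝ) : kern δ (x - y) = kern δ (y - x) := by
  unfold kern; congr 3; ring

theorem measurable_smear (δ : ℝ) {f : ℝ → ℝ≥0∞} (hf : Measurable f) : Measurable (smear δ f) := by
  unfold smear
  refine Measurable.lintegral_prod_right' (f := fun p : ℝ × ℝ => kern δ (p.1 - p.2) * f p.2) ?_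
  fun_prop

theorem lintegral_inv_one_add_sq {δ : ℝ} (hδ : 0 < δ) (y : ℝ) :
    ∫⁻ x, ENNReal.ofReal (δ / (1 + (δ * (x - y)) ^ 2)) = ENNReal.ofReal Real.pi := by
  rw [lintegral_sub_right_eq_self (fun x => ENNReal.ofReal (δ / (1 + (δ * x) ^ 2))) y]
  have hi : Integrable fun x : ℝ => δ / (1 + (δ * x) ^ 2) := by
    have := (integrable_inv_one_add_sq.comp_mul_left' hδ.ne').const_mul δ
    simpa [div_eq_mul_inv] using this
  rw [← ofReal_integral_eq_lintegral_ofReal hi (ae_of_all _ fun x => by positivity)]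
  congr 1
  have := Measure.integral_comp_mul_left (fun x : ℝ => (1 + x ^ 2)⁻¹) δ
  simp only [div_eq_mul_inv, integral_const_mul, this, integral_univ_inv_one_add_sq, smul_eq_mul,
    abs_of_pos (inv_pos.2 hδ)]
  field_simp

theorem lintegral_kern_le {δ : ℝ} (hδ : 0 < δ) (y : ℝ) :
    ∫⁻ x, kern δ (x - y) ≤ ENNReal.ofReal Real.pi := by
  rw [← lintegral_inv_one_add_sq hδ y]
  refine lintegral_mono fun x => ENNReal.ofReal_le_ofReal ?_
  gcongr
  nlinarith [sq_nonneg (δ * (x - y))]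

/-- In a weighted integral of a smeared function, the smearing may be moved to the weight. -/
theorem lintegral_mul_smear (δ : ℝ) {w f : ℝ → ℝ≥0∞} (hw : Measurable w) (hf : Measurable f) :
    ∫⁻ τ, w τ * smear δ f τ = ∫⁻ τ', (∫⁻ τ, kern δ (τ - τ') * w τ) * f τ' := by
  have h1 : ∀ τ, w τ * smear δ f τ = ∫⁻ τ', w τ * (kern δ (τ - τ') * f τ') := fun τ => by
    rw [smear, lintegral_const_mul _ (by fun_prop)]
  simp only [h1]
  rw [lintegral_lintegral_swap (by fun_prop)]
  refine lintegral_congr fun τ' => ?_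
  rw [← lintegral_mul_const _ (by fun_prop)]
  exact lintegral_congr fun τ => by ring

/-- Smearing at the scale `δ⁻¹` turns the weight `⟨τ - p⟩⁻¹`, up to an `ε`-loss, into
`δ ⟨δ (τ - p)⟩⁻¹`. -/
theorem exists_lintegral_kern_mul_le {γ : ℝ} (hγ : γ < 1) :
    ∃ C : ℝ≥0∞, C ≠ ⊤ ∧ ∀ δ : ℝ, 0 < δ → δ ≤ 1 → ∀ p τ' : ℝ,
      ∫⁻ τ, kern δ (τ - τ') * ebracket (τ - p) ^ (-1 : ℝ) ≤
        C * ENNReal.ofReal δ ^ γ * ebracket (δ * (τ' - p)) ^ (-1 : ℝ) := by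
  refine ⟨2 * (2 * ENNReal.ofReal Real.pi + ∫⁻ x, ebracket x ^ (-(2 - γ))), ?_, ?_⟩
  · have := lintegral_ebracket_rpow_lt_top (p := 2 - γ) (by linarith)
    finiteness
  intro δ hδ hδ1 p τ'
  have key : ∀ τ, kern δ (τ - τ') * ebracket (τ - p) ^ (-1 : ℝ) ≤
      2 * ebracket (δ * (τ' - p)) ^ (-1 : ℝ) *
        (2 * ENNReal.ofReal δ * ENNReal.ofReal (δ / (1 + (δ * (τ - τ')) ^ 2)) +
          ENNReal.ofReal δ ^ γ * ebracket (τ - p) ^ (-(2 - γ))) := by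
    intro τ
    have e2 : (2 : ℝ≥0∞) = ENNReal.ofReal 2 := by simp
    rw [ebracket_rpow, ebracket_rpow, ebracket_rpow, kern, ENNReal.ofReal_rpow_of_pos hδ, e2]
    have hb1 := bracket_pos (τ - p)
    have hb2 := bracket_pos (δ * (τ' - p))
    rw [← ENNReal.ofReal_mul (by positivity), ← ENNReal.ofReal_mul (by positivity),
      ← ENNReal.ofReal_mul (by positivity), ← ENNReal.ofReal_mul (by positivity),
      ← ENNReal.ofReal_mul (by positivity),
      ← ENNReal.ofReal_add (by positivity) (by positivity), ← ENNReal.ofReal_mul (by positivity)]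
    apply ENNReal.ofReal_le_ofReal
    set x := τ - p
    set σ := τ - τ'
    have hx : τ' - p = x - σ := by simp only [x, σ]; ring
    rw [hx] at hb2 ⊢
    rw [Real.rpow_neg_one, Real.rpow_neg_one]
    set q := 1 + (δ * σ) ^ 2 with hq
    have hq1 : 1 ≤ q := by simp only [hq]; nlinarith [sq_nonneg (δ * σ)]
    -- Peetre: `⟨δ(x-σ)⟩ ≤ 2 ⟨δx⟩ ⟨δσ⟩`, with `⟨δσ⟩ ≤ q`
    have h1 : bracket (δ * (x - σ)) ≤ 2 * bracket (δ * x) * q := by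
      have h := bracket_add_le (δ * x) (-(δ * σ))
      have h' : bracket (-(δ * σ)) ≤ q := by
        refine abs_le_of_sq_le_sq' ?_ (by positivity) |>.2
        rw [sq_bracket, hq]; nlinarith [sq_nonneg (δ * σ)]
      have := bracket_pos (δ * x)
      calc _ = bracket (δ * x + -(δ * σ)) := by congr 1; ring
        _ ≤ _ := h
        _ ≤ _ := by gcongr
    have h2 : bracket (δ * x) ≤ 1 + δ * bracket x := by
      refine abs_le_of_sq_le_sq' ?_ (by positivity) |>.2
      have := sq_bracket x
      rw [sq_bracket]; nlinarith [mul_pos hδ hb1, sq_nonneg δ]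
    have h3 : (bracket x)⁻¹ ≤ δ + δ ^ (γ - 1) * bracket x ^ (-(2 - γ)) := by
      rcases le_total 1 (δ * bracket x) with h | h
      · have : (bracket x)⁻¹ ≤ δ := by
          rw [inv_le_iff_one_le_mul₀ hb1]; exact h
        have : 0 ≤ δ ^ (γ - 1) * bracket x ^ (-(2 - γ)) := by positivity
        linarith
      · have : (bracket x)⁻¹ ≤ δ ^ (γ - 1) * bracket x ^ (-(2 - γ)) := by
          have e : δ ^ (γ - 1) * bracket x ^ (-(2 - γ)) =
              (δ * bracket x) ^ (γ - 1) * (bracket x)⁻¹ := by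
            rw [Real.mul_rpow hδ.le hb1.le, ← Real.rpow_neg_one (bracket x), mul_assoc,
              ← Real.rpow_add hb1]
            congr 2; ring
          rw [e]
          have : 1 ≤ (δ * bracket x) ^ (γ - 1) :=
            Real.one_le_rpow_of_pos_of_le_one_of_nonpos (by positivity) h (by linarith)
          have := inv_pos.2 hb1
          nlinarith
        linarith
    have h4 : bracket (δ * x) * (bracket x)⁻¹ ≤
        2 * δ + δ ^ (γ - 1) * bracket x ^ (-(2 - γ)) := by
      calc _ ≤ (1 + δ * bracket x) * (bracket x)⁻¹ := by gcongr
        _ = (bracket x)⁻¹ + δ := by field_simp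
        _ ≤ _ := by linarith
    have h5 : δ ^ γ = δ * δ ^ (γ - 1) := by
      nth_rw 2 [← Real.rpow_one δ]
      rw [← Real.rpow_add hδ]; congr 1; ring
    have hr : 0 ≤ bracket x ^ (-(2 - γ)) := by positivity
    have hd : 0 ≤ δ ^ (γ - 1) := by positivity
    calc δ / q ^ 2 * (bracket x)⁻¹
        = (bracket (δ * (x - σ)))⁻¹ *
          (bracket (δ * (x - σ)) * (bracket x)⁻¹ * (δ / q ^ 2)) := by field_simp
      _ ≤ (bracket (δ * (x - σ)))⁻¹ *
          (2 * bracket (δ * x) * q * (bracket x)⁻¹ * (δ / q ^ 2)) := by gcongr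
      _ = 2 * (bracket (δ * (x - σ)))⁻¹ * (bracket (δ * x) * (bracket x)⁻¹ * (δ / q)) := by
          field_simp
      _ ≤ 2 * (bracket (δ * (x - σ)))⁻¹ *
          ((2 * δ + δ ^ (γ - 1) * bracket x ^ (-(2 - γ))) * (δ / q)) := by gcongr
      _ = 2 * (bracket (δ * (x - σ)))⁻¹ *
          (2 * δ * (δ / q) + δ ^ (γ - 1) * bracket x ^ (-(2 - γ)) * (δ / q)) := by ring
      _ ≤ 2 * (bracket (δ * (x - σ)))⁻¹ *
          (2 * δ * (δ / q) + δ ^ (γ - 1) * bracket x ^ (-(2 - γ)) * δ) := by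
          gcongr; exact div_le_self hδ.le hq1
      _ = _ := by rw [h5]; ring
  calc _ ≤ _ := lintegral_mono key
    _ = 2 * ebracket (δ * (τ' - p)) ^ (-1 : ℝ) * (2 * ENNReal.ofReal δ * ENNReal.ofReal Real.pi +
          ENNReal.ofReal δ ^ γ * ∫⁻ x, ebracket x ^ (-(2 - γ))) := by
        have hm : Measurable fun τ : ℝ => ebracket (τ - p) ^ (-(2 - γ)) :=
          (measurable_ebracket.comp (measurable_id.sub_const p)).pow_const _
        rw [lintegral_const_mul _ (by fun_prop), lintegral_add_left (by fun_prop),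
          lintegral_const_mul _ (by fun_prop), lintegral_const_mul _ hm,
          lintegral_inv_one_add_sq hδ,
          lintegral_sub_right_eq_self (fun x => ebracket x ^ (-(2 - γ))) p]
    _ ≤ 2 * ebracket (δ * (τ' - p)) ^ (-1 : ℝ) *
          (2 * ENNReal.ofReal δ ^ γ * ENNReal.ofReal Real.pi +
          ENNReal.ofReal δ ^ γ * ∫⁻ x, ebracket x ^ (-(2 - γ))) := by
        gcongr
        calc ENNReal.ofReal δ = ENNReal.ofReal δ ^ (1 : ℝ) := (ENNReal.rpow_one _).symm
          _ ≤ _ := ENNReal.rpow_le_rpow_of_exponent_ge (by simpa using hδ1) hγ.le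
    _ = _ := by ring

/-- `⟨x⟩ ≤ δ⁻¹ ⟨δ x⟩` for `δ ≤ 1`, raised to a power. -/
theorem ebracket_rpow_le_scaled {δ : ℝ} (hδ : 0 < δ) (hδ1 : δ ≤ 1) {b : ℝ} (hb : 0 ≤ b) (x : ℝ) :
    ebracket x ^ b ≤ ENNReal.ofReal δ ^ (-b) * ebracket (δ * x) ^ b := by
  have h : bracket x ≤ δ⁻¹ * bracket (δ * x) := by
    have := bracket_pos (δ * x)
    refine abs_le_of_sq_le_sq' ?_ (by positivity) |>.2
    rw [mul_pow, sq_bracket, sq_bracket]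
    have : (δ⁻¹) ^ 2 * (1 + (δ * x) ^ 2) = (δ⁻¹) ^ 2 + x ^ 2 := by field_simp
    rw [this]
    have : 1 ≤ δ⁻¹ := (one_le_inv₀ hδ).2 hδ1
    nlinarith
  have hb1 := bracket_pos x
  have hb2 := bracket_pos (δ * x)
  rw [ebracket_rpow, ebracket_rpow, ENNReal.ofReal_rpow_of_pos hδ,
    ← ENNReal.ofReal_mul (by positivity)]
  apply ENNReal.ofReal_le_ofReal
  calc _ ≤ (δ⁻¹ * bracket (δ * x)) ^ b := Real.rpow_le_rpow hb1.le h hb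
    _ = _ := by rw [Real.mul_rpow (by positivity) hb2.le, Real.inv_rpow hδ.le, Real.rpow_neg hδ.le]

theorem ebracket_rpow_mul_scaled_le {δ : ℝ} (hδ : 0 < δ) (hδ1 : δ ≤ 1) {b : ℝ} (hb : 0 ≤ b)
    (hb1 : b ≤ 1) (x : ℝ) :
    ebracket x ^ b * ebracket (δ * x) ^ (-1 : ℝ) ≤ ENNReal.ofReal δ ^ (-b) := by
  calc _ ≤ ENNReal.ofReal δ ^ (-b) * ebracket (δ * x) ^ b * ebracket (δ * x) ^ (-1 : ℝ) := by
        gcongr; exact ebracket_rpow_le_scaled hδ hδ1 hb x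
    _ = ENNReal.ofReal δ ^ (-b) * ebracket (δ * x) ^ (b + -1) := by
        rw [mul_assoc, ebracket_rpow_mul]
    _ ≤ ENNReal.ofReal δ ^ (-b) * 1 := by
        gcongr
        calc _ ≤ ebracket (δ * x) ^ (0 : ℝ) := by
              gcongr
              · exact one_le_ebracket _
              · linarith
          _ = 1 := ENNReal.rpow_zero
    _ = _ := mul_one _

theorem scaled_rpow_neg_one_le {δ : ℝ} (hδ : 0 < δ) (hδ1 : δ ≤ 1) {b : ℝ} (hb : 0 ≤ b)
    (hb1 : b ≤ 1) (x : ℝ) :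
    ebracket (δ * x) ^ (-1 : ℝ) ≤ ENNReal.ofReal δ ^ (-b) * ebracket x ^ (-b) := by
  calc ebracket (δ * x) ^ (-1 : ℝ)
      = (ebracket x ^ b * ebracket x ^ (-b)) * ebracket (δ * x) ^ (-1 : ℝ) := by
        rw [ebracket_rpow_mul_neg, one_mul]
    _ = (ebracket x ^ b * ebracket (δ * x) ^ (-1 : ℝ)) * ebracket x ^ (-b) := by ring
    _ ≤ _ := by gcongr; exact ebracket_rpow_mul_scaled_le hδ hδ1 hb hb1 x

theorem ofReal_rpow_mul_rpow {δ : ℝ} (hδ : 0 < δ) (x y : ℝ) :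
    ENNReal.ofReal δ ^ x * ENNReal.ofReal δ ^ y = ENNReal.ofReal δ ^ (x + y) :=
  (ENNReal.rpow_add _ _ (by simpa using hδ) ENNReal.ofReal_ne_top).symm

/-- Multiplication by a cutoff at scale `δ` is bounded from `X_{s,1/2}` to `X_{s,b/2}`, and gains
the difference of the exponents up to an `ε`. -/
theorem exists_lintegral_sq_smear_le {γ : ℝ} (hγ : γ < 1) :
    ∃ C : ℝ≥0∞, C ≠ ⊤ ∧ ∀ δ : ℝ, 0 < δ → δ ≤ 1 → ∀ b : ℝ, 0 ≤ b → b ≤ 1 → ∀ p : ℝ,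
      ∀ f : ℝ → ℝ≥0∞, Measurable f →
      ∫⁻ τ, ebracket (τ - p) ^ b * smear δ f τ ^ 2 ≤
        C * ENNReal.ofReal δ ^ (γ - b) * ∫⁻ τ, ebracket (τ - p) ^ (1 : ℝ) * f τ ^ 2 := by
  obtain ⟨C, hC, h⟩ := exists_lintegral_kern_mul_le hγ
  refine ⟨C * ENNReal.ofReal Real.pi, by finiteness, ?_⟩
  intro δ hδ hδ1 b hb hb1 p f hf
  set d := ENNReal.ofReal δ
  have hcs : ∀ τ, smear δ f τ ^ 2 ≤ (C * d ^ γ * ebracket (δ * (τ - p)) ^ (-1 : ℝ)) *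
      smear δ (fun τ' => ebracket (τ' - p) ^ (1 : ℝ) * f τ' ^ 2) τ := fun τ => by
    have h1 : smear δ f τ ^ 2 ≤ (∫⁻ τ', kern δ (τ' - τ) * ebracket (τ' - p) ^ (-1 : ℝ)) *
        smear δ (fun τ' => ebracket (τ' - p) ^ (1 : ℝ) * f τ' ^ 2) τ := by
      refine sq_lintegral_le (by fun_prop) (by fun_prop) fun τ' => le_of_eq ?_
      rw [kern_sub_comm δ τ' τ]
      calc _ = kern δ (τ - τ') ^ 2 * f τ' ^ 2 *
            (ebracket (τ' - p) ^ (1 : ℝ) * ebracket (τ' - p) ^ (-1 : ℝ)) := by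
              rw [ebracket_rpow_mul_neg]; ring
        _ = _ := by ring
    exact h1.trans (by gcongr; exact h δ hδ hδ1 p τ)
  calc _ ≤ ∫⁻ τ, C * d ^ (γ - b) *
        (1 * smear δ (fun τ' => ebracket (τ' - p) ^ (1 : ℝ) * f τ' ^ 2) τ) := by
        refine lintegral_mono fun τ => ?_
        calc _ ≤ ebracket (τ - p) ^ b * ((C * d ^ γ * ebracket (δ * (τ - p)) ^ (-1 : ℝ)) *
              smear δ (fun τ' => ebracket (τ' - p) ^ (1 : ℝ) * f τ' ^ 2) τ) := by
                gcongr; exact hcs τ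
          _ = C * d ^ γ * (ebracket (τ - p) ^ b * ebracket (δ * (τ - p)) ^ (-1 : ℝ)) *
              smear δ (fun τ' => ebracket (τ' - p) ^ (1 : ℝ) * f τ' ^ 2) τ := by ring
          _ ≤ C * d ^ γ * d ^ (-b) *
              smear δ (fun τ' => ebracket (τ' - p) ^ (1 : ℝ) * f τ' ^ 2) τ := by
                gcongr; exact ebracket_rpow_mul_scaled_le hδ hδ1 hb hb1 _
          _ = _ := by rw [mul_assoc C, ofReal_rpow_mul_rpow hδ, one_mul]; rfl
    _ = C * d ^ (γ - b) * ∫⁻ τ', (∫⁻ τ, kern δ (τ - τ') * 1) *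
          (ebracket (τ' - p) ^ (1 : ℝ) * f τ' ^ 2) := by
        have hm : Measurable (smear δ (fun τ' => ebracket (τ' - p) ^ (1 : ℝ) * f τ' ^ 2)) :=
          measurable_smear δ (by fun_prop)
        rw [lintegral_const_mul _ (by fun_prop),
          lintegral_mul_smear δ measurable_const (by fun_prop)]
    _ ≤ C * d ^ (γ - b) * ∫⁻ τ', ENNReal.ofReal Real.pi *
          (ebracket (τ' - p) ^ (1 : ℝ) * f τ' ^ 2) := by
        gcongr with τ'
        simpa using lintegral_kern_le hδ τ'
    _ = _ := by rw [lintegral_const_mul _ (by fun_prop)]; ring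

/-- Multiplication by a cutoff at scale `δ` is bounded from `X_{s,-b/2}` to `X_{s,-1/2}`, and gains
the difference of the exponents up to an `ε`. -/
theorem exists_lintegral_neg_sq_smear_le {γ : ℝ} (hγ : γ < 1) :
    ∃ C : ℝ≥0∞, C ≠ ⊤ ∧ ∀ δ : ℝ, 0 < δ → δ ≤ 1 → ∀ b : ℝ, 0 ≤ b → b ≤ 1 → ∀ p : ℝ,
      ∀ f : ℝ → ℝ≥0∞, Measurable f →
      ∫⁻ τ, ebracket (τ - p) ^ (-1 : ℝ) * smear δ f τ ^ 2 ≤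
        C * ENNReal.ofReal δ ^ (γ - b) * ∫⁻ τ, ebracket (τ - p) ^ (-b) * f τ ^ 2 := by
  obtain ⟨C, hC, h⟩ := exists_lintegral_kern_mul_le hγ
  refine ⟨C * ENNReal.ofReal Real.pi, by finiteness, ?_⟩
  intro δ hδ hδ1 b hb hb1 p f hf
  set d := ENNReal.ofReal δ
  have hcs : ∀ τ, smear δ f τ ^ 2 ≤ ENNReal.ofReal Real.pi * smear δ (fun τ' => f τ' ^ 2) τ :=
    fun τ => by
      refine (sq_lintegral_le (A := fun τ' => kern δ (τ' - τ)) (by fun_prop) (by fun_prop)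
        fun τ' => le_of_eq ?_).trans (mul_le_mul_left (lintegral_kern_le hδ τ) _)
      rw [kern_sub_comm δ τ' τ]; ring
  calc _ ≤ ∫⁻ τ, ENNReal.ofReal Real.pi *
        (ebracket (τ - p) ^ (-1 : ℝ) * smear δ (fun τ' => f τ' ^ 2) τ) := by
        refine lintegral_mono fun τ => ?_
        calc _ ≤ ebracket (τ - p) ^ (-1 : ℝ) *
              (ENNReal.ofReal Real.pi * smear δ (fun τ' => f τ' ^ 2) τ) := by gcongr; exact hcs τ
          _ = _ := by ring
    _ = ENNReal.ofReal Real.pi * ∫⁻ τ', (∫⁻ τ, kern δ (τ - τ') * ebracket (τ - p) ^ (-1 : ℝ)) *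
          f τ' ^ 2 := by
        have hm : Measurable (smear δ (fun τ' => f τ' ^ 2)) := measurable_smear δ (by fun_prop)
        rw [lintegral_const_mul _ (by fun_prop), lintegral_mul_smear δ (by fun_prop) (by fun_prop)]
    _ ≤ ENNReal.ofReal Real.pi * ∫⁻ τ', (C * d ^ (γ - b)) *
          (ebracket (τ' - p) ^ (-b) * f τ' ^ 2) := by
        refine mul_le_mul' le_rfl (lintegral_mono fun τ' => ?_)
        calc _ ≤ C * d ^ γ * ebracket (δ * (τ' - p)) ^ (-1 : ℝ) * f τ' ^ 2 := by
              gcongr; exact h δ hδ hδ1 p τ'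
          _ ≤ C * d ^ γ * (d ^ (-b) * ebracket (τ' - p) ^ (-b)) * f τ' ^ 2 := by
              gcongr; exact scaled_rpow_neg_one_le hδ hδ1 hb hb1 _
          _ = C * (d ^ γ * d ^ (-b)) * (ebracket (τ' - p) ^ (-b) * f τ' ^ 2) := by ring
          _ = _ := by rw [ofReal_rpow_mul_rpow hδ]; rfl
    _ = _ := by rw [lintegral_const_mul _ (by fun_prop)]; ring

/-- Multiplication by a cutoff at scale `δ` is bounded on the space with norm
`‖⟨τ - p⟩⁻¹ f‖_{L¹}`, up to an `ε`-loss. -/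
theorem exists_lintegral_smear_le {γ : ℝ} (hγ : γ < 1) :
    ∃ C : ℝ≥0∞, C ≠ ⊤ ∧ ∀ δ : ℝ, 0 < δ → δ ≤ 1 → ∀ p : ℝ, ∀ f : ℝ → ℝ≥0∞, Measurable f →
      ∫⁻ τ, ebracket (τ - p) ^ (-1 : ℝ) * smear δ f τ ≤
        C * ENNReal.ofReal δ ^ (γ - 1) * ∫⁻ τ, ebracket (τ - p) ^ (-1 : ℝ) * f τ := by
  obtain ⟨C, hC, h⟩ := exists_lintegral_kern_mul_le hγ
  refine ⟨C, hC, fun δ hδ hδ1 p f hf => ?_⟩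
  rw [lintegral_mul_smear δ (by fun_prop) hf, ← lintegral_const_mul _ (by fun_prop)]
  refine lintegral_mono fun τ' => ?_
  calc _ ≤ C * ENNReal.ofReal δ ^ γ * ebracket (δ * (τ' - p)) ^ (-1 : ℝ) * f τ' := by
        gcongr; exact h δ hδ hδ1 p τ'
    _ ≤ C * ENNReal.ofReal δ ^ γ * (ENNReal.ofReal δ ^ (-1 : ℝ) *
          ebracket (τ' - p) ^ (-1 : ℝ)) * f τ' := by
        gcongr; exact scaled_rpow_neg_one_le hδ hδ1 zero_le_one le_rfl _
    _ = C * (ENNReal.ofReal δ ^ γ * ENNReal.ofReal δ ^ (-1 : ℝ)) *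
          (ebracket (τ' - p) ^ (-1 : ℝ) * f τ') := by ring
    _ = _ := by rw [ofReal_rpow_mul_rpow hδ]; rfl

/-- Multiplication by a cutoff at scale `δ` maps `X_{s,-b/2}` to the space with norm
`‖⟨τ - p⟩⁻¹ f‖_{L¹}`, and gains `δ^{(1-b)/2}` up to an `ε`. -/
theorem exists_sq_lintegral_smear_le {γ : ℝ} (hγ : γ < 1) :
    ∃ C : ℝ≥0∞, C ≠ ⊤ ∧ ∀ δ : ℝ, 0 < δ → δ ≤ 1 → ∀ b : ℝ, 0 ≤ b → b ≤ 1 / 2 → ∀ p : ℝ,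
      ∀ f : ℝ → ℝ≥0∞, Measurable f →
      (∫⁻ τ, ebracket (τ - p) ^ (-1 : ℝ) * smear δ f τ) ^ 2 ≤
        C * ENNReal.ofReal δ ^ (2 * γ - 1 - b) * ∫⁻ τ, ebracket (τ - p) ^ (-b) * f τ ^ 2 := by
  obtain ⟨C, hC, h⟩ := exists_lintegral_kern_mul_le hγ
  have hI := lintegral_ebracket_rpow_lt_top (p := 3 / 2) (by norm_num)
  refine ⟨C ^ 2 * ∫⁻ x, ebracket x ^ (-(3 / 2 : ℝ)), by finiteness, ?_⟩
  intro δ hδ hδ1 b hb hb1 p f hf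
  set d := ENNReal.ofReal δ
  have h1 : ∫⁻ τ, ebracket (τ - p) ^ (-1 : ℝ) * smear δ f τ ≤
      C * d ^ γ * ∫⁻ τ, ebracket (δ * (τ - p)) ^ (-1 : ℝ) * f τ := by
    rw [lintegral_mul_smear δ (by fun_prop) hf, ← lintegral_const_mul _ (by fun_prop)]
    refine lintegral_mono fun τ' => ?_
    rw [← mul_assoc]
    gcongr
    exact h δ hδ hδ1 p τ'
  have h2 : (∫⁻ τ, ebracket (δ * (τ - p)) ^ (-1 : ℝ) * f τ) ^ 2 ≤
      (∫⁻ τ, ebracket (τ - p) ^ b * ebracket (δ * (τ - p)) ^ (-2 : ℝ)) *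
        ∫⁻ τ, ebracket (τ - p) ^ (-b) * f τ ^ 2 := by
    refine sq_lintegral_le (by fun_prop) (by fun_prop) fun τ => le_of_eq ?_
    calc _ = (ebracket (δ * (τ - p)) ^ (-1 : ℝ)) ^ 2 * f τ ^ 2 *
          (ebracket (τ - p) ^ b * ebracket (τ - p) ^ (-b)) := by
            rw [ebracket_rpow_mul_neg]; ring
      _ = _ := by rw [ebracket_rpow_sq]; norm_num; ring
  have h3 : ∫⁻ τ, ebracket (τ - p) ^ b * ebracket (δ * (τ - p)) ^ (-2 : ℝ) ≤
      d ^ (-b) * (d ^ (-1 : ℝ) * ∫⁻ x, ebracket x ^ (-(3 / 2 : ℝ))) := by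
    rw [lintegral_sub_right_eq_self (fun x => ebracket x ^ b * ebracket (δ * x) ^ (-2 : ℝ)) p]
    have hs : ∫⁻ x, ebracket (δ * x) ^ (-(3 / 2 : ℝ)) =
        d ^ (-1 : ℝ) * ∫⁻ x, ebracket x ^ (-(3 / 2 : ℝ)) := by
      have hmap := Real.map_volume_mul_left hδ.ne'
      have hm : Measurable fun x => ebracket x ^ (-(3 / 2 : ℝ)) :=
        measurable_ebracket.pow_const _
      rw [← lintegral_map (f := fun x => ebracket x ^ (-(3 / 2 : ℝ))) hm
        (measurable_const_mul δ), hmap, lintegral_smul_measure, abs_of_pos (inv_pos.2 hδ),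
        ENNReal.ofReal_inv_of_pos hδ, ENNReal.rpow_neg_one]
      rfl
    rw [← hs, ← lintegral_const_mul _ (by fun_prop)]
    refine lintegral_mono fun x => ?_
    calc _ ≤ d ^ (-b) * ebracket (δ * x) ^ b * ebracket (δ * x) ^ (-2 : ℝ) := by
          gcongr; exact ebracket_rpow_le_scaled hδ hδ1 hb x
      _ = d ^ (-b) * ebracket (δ * x) ^ (b + -2) := by rw [mul_assoc, ebracket_rpow_mul]
      _ ≤ _ := by
          gcongr
          · exact one_le_ebracket _
          · linarith
  calc _ ≤ (C * d ^ γ) ^ 2 * (d ^ (-b) * (d ^ (-1 : ℝ) * ∫⁻ x, ebracket x ^ (-(3 / 2 : ℝ))) *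
        ∫⁻ τ, ebracket (τ - p) ^ (-b) * f τ ^ 2) := by
        refine (pow_le_pow_left' h1 2).trans ?_
        rw [mul_pow]
        gcongr
        exact h2.trans (by gcongr)
    _ = C ^ 2 * (∫⁻ x, ebracket x ^ (-(3 / 2 : ℝ))) * (d ^ γ * d ^ γ * d ^ (-1 : ℝ) * d ^ (-b)) *
        ∫⁻ τ, ebracket (τ - p) ^ (-b) * f τ ^ 2 := by ring
    _ = _ := by
        rw [ofReal_rpow_mul_rpow hδ, ofReal_rpow_mul_rpow hδ, ofReal_rpow_mul_rpow hδ]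
        congr 3; ring

/-! ### The resonance function and counting of modulations -/

/-- The resonance identity `|x³ - y³| = |x - y| (x² + x y + y²)` bounds the resonance function from
below. -/
theorem resonance_lower_bound (x y : ℝ) :
    3 / 4 * |x - y| * max |x| |y| ^ 2 ≤ |x ^ 3 - y ^ 3| := by
  have h1 : |x ^ 3 - y ^ 3| = |x - y| * (x ^ 2 + x * y + y ^ 2) := by
    rw [show x ^ 3 - y ^ 3 = (x - y) * (x ^ 2 + x * y + y ^ 2) by ring, abs_mul]
    congr 1
    exact abs_of_nonneg (by nlinarith [sq_nonneg (x + y), sq_nonneg x, sq_nonneg y])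
  rw [h1, mul_comm (3 / 4 : ℝ), mul_assoc]
  gcongr
  rcases max_choice |x| |y| with h | h <;> rw [h, sq_abs]
  · nlinarith [sq_nonneg (x + 2 * y)]
  · nlinarith [sq_nonneg (2 * x + y)]

/-- For nonzero frequencies, the derivative and the Sobolev weights cost at most
`max |x| |y| |x - y|^{1/4}`; the last factor is where `s > -1/4` is used. -/
theorem exists_mul_bracket_rpow_le {s : ℝ} (hs : -1 / 4 < s) :
    ∃ C : ℝ, 0 < C ∧ ∀ x y : ℝ, 1 ≤ |x| → 1 ≤ |y| → 1 ≤ |x - y| →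
      |x| * bracket x ^ s ≤
        C * (max |x| |y| * |x - y| ^ (1 / 4 : ℝ)) * (bracket y ^ s * bracket (x - y) ^ s) := by
  have hle : ∀ t : ℝ, 1 ≤ |t| → bracket t ≤ 2 * |t| := fun t ht => by
    refine abs_le_of_sq_le_sq' ?_ (by positivity) |>.2
    rw [sq_bracket, mul_pow, sq_abs]
    nlinarith [sq_abs t]
  rcases le_total 0 s with h0 | h0
  · refine ⟨2 ^ s, by positivity, fun x y hx hy hz => ?_⟩
    have hb := bracket_pos x
    have hb1 := bracket_pos y
    have hb2 := bracket_pos (x - y)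
    have h1 : bracket x ^ s ≤ 2 ^ s * (bracket y ^ s * bracket (x - y) ^ s) := by
      have h := bracket_add_le y (x - y)
      rw [add_sub_cancel, mul_assoc] at h
      calc _ ≤ (2 * (bracket y * bracket (x - y))) ^ s :=
            Real.rpow_le_rpow (bracket_pos x).le h h0
        _ = _ := by rw [Real.mul_rpow (by norm_num) (by positivity),
            Real.mul_rpow hb1.le hb2.le]
    have h2 : 1 ≤ |x - y| ^ (1 / 4 : ℝ) := Real.one_le_rpow hz (by norm_num)
    have h3 : |x| ≤ max |x| |y| * |x - y| ^ (1 / 4 : ℝ) :=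
      (le_max_left _ _).trans (le_mul_of_one_le_right (by positivity) h2)
    calc _ ≤ max |x| |y| * |x - y| ^ (1 / 4 : ℝ) *
          (2 ^ s * (bracket y ^ s * bracket (x - y) ^ s)) := by gcongr
      _ = _ := by ring
  · refine ⟨2 ^ (-s) * 2 ^ (-s), by positivity, fun x y hx hy hz => ?_⟩
    have hb := bracket_pos x
    have hb1 := bracket_pos y
    have hb2 := bracket_pos (x - y)
    set M := max |x| |y|
    have hxM : |x| ≤ M := le_max_left _ _
    have hyM : |y| ≤ M := le_max_right _ _
    have hM : 0 < M := by linarith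
    have hy' : bracket y ^ (-s) ≤ 2 ^ (-s) * M ^ (-s) := by
      rw [← Real.mul_rpow (by norm_num) hM.le]
      exact Real.rpow_le_rpow hb1.le ((hle y hy).trans (by gcongr)) (by linarith)
    have hz' : bracket (x - y) ^ (-s) ≤ 2 ^ (-s) * |x - y| ^ (1 / 4 : ℝ) := by
      calc _ ≤ (2 * |x - y|) ^ (-s) := Real.rpow_le_rpow hb2.le (hle _ hz) (by linarith)
        _ = 2 ^ (-s) * |x - y| ^ (-s) := Real.mul_rpow (by norm_num) (by positivity)
        _ ≤ _ := by gcongr; linarith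
    have hx' : |x| * bracket x ^ s ≤ M * M ^ s := by
      have h1 : |x| * bracket x ^ s ≤ |x| * |x| ^ s := by
        gcongr 1
        exact Real.rpow_le_rpow_of_nonpos (by linarith) (abs_le_bracket x) h0
      have h2 : ∀ t : ℝ, 0 < t → t * t ^ s = t ^ (1 + s) := fun t ht => by
        rw [Real.rpow_add ht, Real.rpow_one]
      refine h1.trans ?_
      rw [h2 _ (by linarith), h2 _ hM]
      exact Real.rpow_le_rpow (abs_nonneg x) hxM (by linarith)
    have hinv : ∀ t : ℝ, 0 < t → t ^ (-s) * t ^ s = 1 := fun t ht => by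
      rw [← Real.rpow_add ht]; simp
    calc |x| * bracket x ^ s
        = |x| * bracket x ^ s * (bracket y ^ (-s) * bracket (x - y) ^ (-s)) *
          (bracket y ^ s * bracket (x - y) ^ s) := by
          have e1 := hinv _ hb1
          have e2 := hinv _ hb2
          linear_combination (-(|x| * bracket x ^ s)) * e1 *
            (bracket (x - y) ^ (-s) * bracket (x - y) ^ s) - (|x| * bracket x ^ s) * e2
      _ ≤ M * M ^ s * ((2 ^ (-s) * M ^ (-s)) * (2 ^ (-s) * |x - y| ^ (1 / 4 : ℝ))) *
          (bracket y ^ s * bracket (x - y) ^ s) := by gcongr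
      _ = _ := by
          have e3 := hinv _ hM
          linear_combination (2 ^ (-s) * 2 ^ (-s) * M * |x - y| ^ (1 / 4 : ℝ) *
            (bracket y ^ s * bracket (x - y) ^ s)) * e3

/-- The weights of the bilinear estimate are absorbed by the power `1/2` of a modulation `t` that
dominates the resonance function; with the power `5/8` there is decay in `x - y` to spare. -/
theorem exists_resonance_le {s : ℝ} (hs : -1 / 4 < s) :
    ∃ C : ℝ, 0 < C ∧ ∀ x y t : ℝ, 1 ≤ |x| → 1 ≤ |y| → 1 ≤ |x - y| → |x ^ 3 - y ^ 3| ≤ 2 * |t| →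
      |x| * bracket x ^ s ≤ C * bracket t ^ (1 / 2 : ℝ) * (bracket y ^ s * bracket (x - y) ^ s) ∧
      |x| * bracket x ^ s ≤ C * (bracket t ^ (5 / 8 : ℝ) * bracket (x - y) ^ (-(5 / 8) : ℝ)) *
        (bracket y ^ s * bracket (x - y) ^ s) := by
  obtain ⟨C, hC, h⟩ := exists_mul_bracket_rpow_le hs
  refine ⟨C * 16, by positivity, fun x y t hx hy hz ht => ?_⟩
  have hR := resonance_lower_bound x y
  have h := h x y hx hy hz
  set M := max |x| |y|
  set z := |x - y| with hzdef
  have hM : 1 ≤ M := hx.trans (le_max_left _ _)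
  have hzM : z ≤ 2 * M := by
    have := abs_sub x y
    have h1 : |x| ≤ M := le_max_left _ _
    have h2 : |y| ≤ M := le_max_right _ _
    linarith
  have hL : z * M ^ 2 ≤ 3 * bracket t := by
    have := abs_le_bracket t
    nlinarith
  have hb := bracket_pos t
  have hby := bracket_pos y
  have hbz := bracket_pos (x - y)
  have hbz2 : bracket (x - y) ≤ 2 * z := by
    refine abs_le_of_sq_le_sq' ?_ (by positivity) |>.2
    rw [sq_bracket, mul_pow, hzdef, sq_abs]
    nlinarith [sq_abs (x - y)]
  have hz0 : 0 < z := by linarith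
  have hM0 : 0 < M := by linarith
  -- `M z^{1/2} = (z M²)^{1/2}`, and `z M²` is the size of the resonance function
  have hhalf : M * z ^ (1 / 4 : ℝ) ≤ 16 * bracket t ^ (1 / 2 : ℝ) := by
    have e : (z * M ^ 2) ^ (1 / 2 : ℝ) = M * z ^ (1 / 2 : ℝ) := by
      rw [Real.mul_rpow hz0.le (by positivity), ← Real.rpow_natCast, ← Real.rpow_mul hM0.le]
      norm_num; ring
    have h3 : (3 : ℝ) ^ (1 / 2 : ℝ) ≤ 16 := by
      calc (3 : ℝ) ^ (1 / 2 : ℝ) ≤ 3 ^ (1 : ℝ) := by gcongr <;> norm_num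
        _ ≤ 16 := by norm_num
    calc M * z ^ (1 / 4 : ℝ) ≤ M * z ^ (1 / 2 : ℝ) := by gcongr; norm_num
      _ = (z * M ^ 2) ^ (1 / 2 : ℝ) := e.symm
      _ ≤ (3 * bracket t) ^ (1 / 2 : ℝ) := by gcongr
      _ = 3 ^ (1 / 2 : ℝ) * bracket t ^ (1 / 2 : ℝ) := Real.mul_rpow (by norm_num) hb.le
      _ ≤ _ := by gcongr
  -- the power `5/8` of `z M²` is `M z^{5/8} M^{1/4}`; as `M ≳ z`, this exceeds `M z^{1/4}` by
  -- a factor `z^{5/8}`, up to a constant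
  have h58 : M * z ^ (1 / 4 : ℝ) ≤
      16 * (bracket t ^ (5 / 8 : ℝ) * bracket (x - y) ^ (-(5 / 8) : ℝ)) := by
    have e : (z * M ^ 2) ^ (5 / 8 : ℝ) = M * M ^ (1 / 4 : ℝ) * z ^ (5 / 8 : ℝ) := by
      rw [Real.mul_rpow hz0.le (by positivity), ← Real.rpow_natCast, ← Real.rpow_mul hM0.le,
        mul_comm, ← Real.rpow_one_add' hM0.le (by norm_num)]
      norm_num
    have h1 : M * z ^ (1 / 4 : ℝ) * bracket (x - y) ^ (5 / 8 : ℝ) ≤ 16 * bracket t ^ (5 / 8 : ℝ) :=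
      calc M * z ^ (1 / 4 : ℝ) * bracket (x - y) ^ (5 / 8 : ℝ)
          ≤ M * (2 * M) ^ (1 / 4 : ℝ) * (2 * z) ^ (5 / 8 : ℝ) := by gcongr
        _ = 2 ^ (1 / 4 : ℝ) * 2 ^ (5 / 8 : ℝ) * (z * M ^ 2) ^ (5 / 8 : ℝ) := by
            rw [e, Real.mul_rpow (by norm_num) hM0.le, Real.mul_rpow (by norm_num) hz0.le]; ring
        _ ≤ 2 ^ (1 / 4 : ℝ) * 2 ^ (5 / 8 : ℝ) * (3 * bracket t) ^ (5 / 8 : ℝ) := by gcongr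
        _ = 2 ^ (1 / 4 : ℝ) * 2 ^ (5 / 8 : ℝ) * 3 ^ (5 / 8 : ℝ) * bracket t ^ (5 / 8 : ℝ) := by
            rw [Real.mul_rpow (by norm_num) hb.le]; ring
        _ ≤ 2 ^ (1 : ℝ) * 2 ^ (1 : ℝ) * 3 ^ (1 : ℝ) * bracket t ^ (5 / 8 : ℝ) := by
            gcongr <;> norm_num
        _ ≤ _ := by
            have := Real.rpow_nonneg hb.le (5 / 8)
            norm_num; linarith
    rw [Real.rpow_neg hbz.le, ← div_eq_mul_inv, ← mul_div_assoc, le_div_iff₀ (by positivity)]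
    exact h1
  have hY : 0 < bracket y ^ s * bracket (x - y) ^ s := by positivity
  constructor
  · calc _ ≤ _ := h
      _ ≤ C * (16 * bracket t ^ (1 / 2 : ℝ)) * (bracket y ^ s * bracket (x - y) ^ s) := by gcongr
      _ = _ := by ring
  · calc _ ≤ _ := h
      _ ≤ C * (16 * (bracket t ^ (5 / 8 : ℝ) * bracket (x - y) ^ (-(5 / 8) : ℝ))) *
          (bracket y ^ s * bracket (x - y) ^ s) := by gcongr
      _ = _ := by ring

/-- `exists_resonance_le` for integer frequencies, in `[0, ∞]`. -/
theorem exists_resonance_le_ennreal {s : ℝ} (hs : -1 / 4 < s) :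
    ∃ C : ℝ≥0∞, C ≠ ⊤ ∧ ∀ (ξ η : ℤ) (t : ℝ), ξ ≠ 0 → η ≠ 0 → ξ - η ≠ 0 →
      |(ξ : ℝ) ^ 3 - (η : ℝ) ^ 3| ≤ 2 * |t| →
      ENNReal.ofReal |(ξ : ℝ)| * ebracket ξ ^ s ≤
        C * ebracket t ^ (1 / 2 : ℝ) * (ebracket η ^ s * ebracket (ξ - η : ℤ) ^ s) ∧
      ENNReal.ofReal |(ξ : ℝ)| * ebracket ξ ^ s ≤
        C * (ebracket t ^ (5 / 8 : ℝ) * ebracket (ξ - η : ℤ) ^ (-(5 / 8) : ℝ)) *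
          (ebracket η ^ s * ebracket (ξ - η : ℤ) ^ s) := by
  obtain ⟨C, hC, h⟩ := exists_resonance_le hs
  refine ⟨ENNReal.ofReal C, ENNReal.ofReal_ne_top, fun ξ η t h1 h2 h3 ht => ?_⟩
  have hint : ∀ n : ℤ, n ≠ 0 → 1 ≤ |(n : ℝ)| := fun n hn => by
    rw [← Int.cast_abs]; exact_mod_cast Int.one_le_abs hn
  have h := h ξ η t (hint _ h1) (hint _ h2) (by exact_mod_cast hint _ h3) ht
  have b1 := bracket_pos ξ
  have b2 := bracket_pos η
  have b3 := bracket_pos (ξ - η : ℝ)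
  have b4 := bracket_pos t
  push_cast
  simp only [ebracket_rpow]
  constructor
  · repeat rw [← ENNReal.ofReal_mul (by positivity)]
    exact ENNReal.ofReal_le_ofReal h.1
  · repeat rw [← ENNReal.ofReal_mul (by positivity)]
    exact ENNReal.ofReal_le_ofReal h.2

theorem tsum_ebracket_rpow_lt_top {p : ℝ} (hp : 1 < p) :
    ∑' k : ℤ, ebracket k ^ (-p) < ⊤ := by
  have h : ∀ k : ℤ, ebracket k ^ (-p) ≤
      ENNReal.ofReal (|(k : ℝ)| ^ (-p)) + if k = 0 then 1 else 0 := fun k => by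
    split_ifs with hk
    · refine le_add_left ?_
      rw [ENNReal.rpow_neg]
      exact ENNReal.inv_le_one.2 (ENNReal.one_le_rpow (one_le_ebracket _) (by linarith))
    · rw [add_zero, ebracket_rpow]
      apply ENNReal.ofReal_le_ofReal
      exact Real.rpow_le_rpow_of_nonpos (abs_pos.2 (by exact_mod_cast hk)) (abs_le_bracket _)
        (by linarith)
  refine (ENNReal.tsum_le_tsum h).trans_lt ?_
  rw [ENNReal.tsum_add, tsum_ite_eq, ← ENNReal.ofReal_tsum_of_nonneg (fun k => by positivity)
    (Real.summable_abs_int_rpow hp)]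
  finiteness

theorem exists_cube_eq (τ : ℝ) : ∃ r : ℝ, r ^ 3 = τ := by
  have h : ∀ t : ℝ, 0 ≤ t → (t ^ (1 / 3 : ℝ)) ^ 3 = t := fun t ht => by
    rw [← Real.rpow_natCast, ← Real.rpow_mul ht]; norm_num
  rcases le_total 0 τ with h0 | h0
  · exact ⟨_, h τ h0⟩
  · exact ⟨-((-τ) ^ (1 / 3 : ℝ)), by rw [neg_pow, h _ (by linarith)]; ring⟩

/-- The modulations `τ - ξ³` of the integers `ξ` spread out like cubes, uniformly in `τ`. -/
theorem exists_tsum_modulation_le {b : ℝ} (hb : 1 / 3 < b) :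
    ∃ C : ℝ≥0∞, C ≠ ⊤ ∧ ∀ τ : ℝ, ∑' ξ : ℤ, ebracket (τ - (ξ : ℝ) ^ 3) ^ (-b) ≤ C := by
  have hsum := tsum_ebracket_rpow_lt_top (p := 3 * b) (by linarith)
  refine ⟨ENNReal.ofReal (512 ^ b) * ∑' k : ℤ, ebracket k ^ (-(3 * b)), by finiteness, fun τ => ?_⟩
  obtain ⟨r, rfl⟩ := exists_cube_eq τ
  rw [← (Equiv.subRight ⌊r⌋).tsum_eq fun k : ℤ => ebracket k ^ (-(3 * b)), ← ENNReal.tsum_mul_left]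
  refine ENNReal.tsum_le_tsum fun ξ => ?_
  simp only [Equiv.subRight_apply]
  set t := r ^ 3 - (ξ : ℝ) ^ 3 with ht
  set y := r - ξ with hy
  have hyt : y ^ 6 ≤ 16 * t ^ 2 := by
    have h1 : y ^ 2 ≤ 4 * (r ^ 2 + r * ξ + ξ ^ 2) := by
      rw [hy]; nlinarith [sq_nonneg (r + ξ)]
    have h2 : t = y * (r ^ 2 + r * ξ + ξ ^ 2) := by rw [ht, hy]; ring
    rw [h2]
    calc y ^ 6 = y ^ 2 * (y ^ 2) ^ 2 := by ring
      _ ≤ y ^ 2 * (4 * (r ^ 2 + r * ξ + ξ ^ 2)) ^ 2 := by gcongr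
      _ = _ := by ring
  have hbt := bracket_pos t
  have hby := bracket_pos y
  have h3 : bracket y ^ 3 ≤ 8 * bracket t := by
    refine abs_le_of_sq_le_sq' ?_ (by positivity) |>.2
    rw [mul_pow, sq_bracket, ← pow_mul, show 3 * 2 = 2 * 3 by norm_num, pow_mul, sq_bracket]
    nlinarith [sq_nonneg y, sq_nonneg (y ^ 2 - 1), sq_nonneg (y ^ 3)]
  have hk : bracket ((ξ - ⌊r⌋ : ℤ) : ℝ) ≤ 4 * bracket y := by
    have hf : bracket (Int.fract r) ≤ 2 := by
      refine abs_le_of_sq_le_sq' ?_ (by norm_num) |>.2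
      rw [sq_bracket]
      nlinarith [Int.fract_nonneg r, Int.fract_lt_one r]
    have h := bracket_add_le (-y) (Int.fract r)
    have e : -y + Int.fract r = ((ξ - ⌊r⌋ : ℤ) : ℝ) := by
      rw [hy, Int.fract]; push_cast; ring
    have e' : bracket (-y) = bracket y := bracket_neg y
    rw [e, e'] at h
    nlinarith
  have h4 : bracket ((ξ - ⌊r⌋ : ℤ) : ℝ) ^ 3 ≤ 512 * bracket t := by
    calc _ ≤ (4 * bracket y) ^ 3 := by gcongr; exact (bracket_pos _).le
      _ = 64 * bracket y ^ 3 := by ring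
      _ ≤ _ := by linarith
  have hbk := bracket_pos ((ξ - ⌊r⌋ : ℤ) : ℝ)
  rw [ebracket_rpow, ebracket_rpow, ← ENNReal.ofReal_mul (by positivity)]
  apply ENNReal.ofReal_le_ofReal
  have h5 : bracket ((ξ - ⌊r⌋ : ℤ) : ℝ) ^ (3 * b) ≤ 512 ^ b * bracket t ^ b := by
    rw [Real.rpow_mul hbk.le, ← Real.mul_rpow (by norm_num) hbt.le]
    refine Real.rpow_le_rpow (by positivity) ?_ (by linarith)
    exact_mod_cast h4
  rw [Real.rpow_neg hbt.le, Real.rpow_neg hbk.le, ← div_eq_mul_inv, le_div_iff₀ (by positivity),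
    inv_mul_le_iff₀ (by positivity), mul_comm (bracket t ^ b)]
  exact h5

/-! ### Bilinear estimates for nonnegative functions -/

/-- The square of the `X_{s,b/2}` norm of a nonnegative function of the frequencies, without the
normalizing factor `(2π)⁻¹`. -/
noncomputable def wsq (s b : ℝ) (f : ℤ → ℝ → ℝ≥0∞) : ℝ≥0∞ :=
  ∑' ξ : ℤ, ∫⁻ τ, ebracket ξ ^ (2 * s) * (ebracket (τ - (ξ : ℝ) ^ 3) ^ b * f ξ τ ^ 2)

/-- The square of the `L²L¹` norm in `Z^s` of a nonnegative function of the frequencies, without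
the normalizing factor `(2π)⁻¹`. -/
noncomputable def lsq (s : ℝ) (f : ℤ → ℝ → ℝ≥0∞) : ℝ≥0∞ :=
  ∑' ξ : ℤ, (∫⁻ τ, ebracket ξ ^ s * (ebracket (τ - (ξ : ℝ) ^ 3) ^ (-1 : ℝ) * f ξ τ)) ^ 2

/-- The square of the `H^s` norm of a nonnegative sequence, without the factor `(2π)⁻¹`. -/
noncomputable def hsq (s : ℝ) (α : ℤ → ℝ≥0∞) : ℝ≥0∞ := ∑' ξ : ℤ, (ebracket ξ ^ s * α ξ) ^ 2

/-- The absolute value of `∂ₓ` of a product, on the side of the frequencies, where only the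
frequencies in the region `P ξ η τ` are retained: `|ξ| ∑_{η : P ξ η τ} α (ξ - η) w (η, τ)`. -/
noncomputable def dprod (P : ℤ → ℤ → ℝ → Prop) [∀ ξ η τ, Decidable (P ξ η τ)] (α : ℤ → ℝ≥0∞)
    (w : ℤ → ℝ → ℝ≥0∞) (ξ : ℤ) (τ : ℝ) : ℝ≥0∞ :=
  ∑' η : ℤ, if P ξ η τ then ENNReal.ofReal |(ξ : ℝ)| * (α (ξ - η) * w η τ) else 0

/-- The region in which the input modulation dominates the output modulation. -/
def InputDominates (ξ η : ℤ) (τ : ℝ) : Prop := |τ - (ξ : ℝ) ^ 3| ≤ |τ - (η : ℝ) ^ 3|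

noncomputable instance (ξ η : ℤ) (τ : ℝ) : Decidable (InputDominates ξ η τ) :=
  inferInstanceAs (Decidable (_ ≤ _))

theorem measurableSet_inputDominates (ξ η : ℤ) : MeasurableSet {τ | InputDominates ξ η τ} :=
  measurableSet_le (by fun_prop) (by fun_prop)

theorem measurable_dprod {P : ℤ → ℤ → ℝ → Prop} [∀ ξ η τ, Decidable (P ξ η τ)]
    (hP : ∀ ξ η, MeasurableSet {τ | P ξ η τ}) (α : ℤ → ℝ≥0∞) {w : ℤ → ℝ → ℝ≥0∞}
    (hw : ∀ η, Measurable (w η)) (ξ : ℤ) : Measurable (dprod P α w ξ) := by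
  unfold dprod
  refine Measurable.tsum fun η => ?_
  have := hw η
  exact Measurable.ite (hP ξ η) (by fun_prop) measurable_const

theorem tsum_sub_left {M : Type*} [AddCommMonoid M] [TopologicalSpace M] (f : ℤ → M) (ξ : ℤ) :
    ∑' η : ℤ, f (ξ - η) = ∑' η, f η :=
  (Equiv.subLeft ξ).tsum_eq f

theorem tsum_sub_right {M : Type*} [AddCommMonoid M] [TopologicalSpace M] (f : ℤ → M) (η : ℤ) :
    ∑' ξ : ℤ, f (ξ - η) = ∑' ξ, f ξ :=
  (Equiv.subRight η).tsum_eq f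

/-- `dprod` is bounded termwise, once its terms are bounded in the region of the frequencies that
occur for factors of zero mean. -/
theorem ebracket_mul_dprod_le {P : ℤ → ℤ → ℝ → Prop} [∀ ξ η τ, Decidable (P ξ η τ)]
    {α : ℤ → ℝ≥0∞} {w : ℤ → ℝ → ℝ≥0∞} (hα : α 0 = 0) (hw : w 0 = 0) {s : ℝ} {ξ : ℤ} {τ : ℝ}
    {K : ℤ → ℝ≥0∞}
    (hK : ∀ η, P ξ η τ → ξ ≠ 0 → η ≠ 0 → ξ - η ≠ 0 →
      ENNReal.ofReal |(ξ : ℝ)| * ebracket ξ ^ s ≤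
        K η * (ebracket η ^ s * ebracket (ξ - η : ℤ) ^ s)) :
    ebracket ξ ^ s * dprod P α w ξ τ ≤
      ∑' η, K η * ((ebracket (ξ - η : ℤ) ^ s * α (ξ - η)) * (ebracket η ^ s * w η τ)) := by
  rw [dprod, ← ENNReal.tsum_mul_left]
  refine ENNReal.tsum_le_tsum fun η => ?_
  split_ifs with hP
  · by_cases h1 : ξ = 0
    · simp [h1]
    by_cases h2 : η = 0
    · simp [h2, hw]
    by_cases h3 : ξ - η = 0
    · simp [h3, hα]
    calc _ = ENNReal.ofReal |(ξ : ℝ)| * ebracket ξ ^ s * (α (ξ - η) * w η τ) := by ring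
      _ ≤ K η * (ebracket η ^ s * ebracket (ξ - η : ℤ) ^ s) * (α (ξ - η) * w η τ) := by
          exact mul_le_mul_left (hK η hP h1 h2 h3) _
      _ = _ := by ring
  · simp

theorem InputDominates.resonance_le {ξ η : ℤ} {τ : ℝ} (h : InputDominates ξ η τ) :
    |(ξ : ℝ) ^ 3 - (η : ℝ) ^ 3| ≤ 2 * |τ - (η : ℝ) ^ 3| := by
  have h' : |τ - (ξ : ℝ) ^ 3| ≤ |τ - (η : ℝ) ^ 3| := h
  have := abs_sub (τ - (η : ℝ) ^ 3) (τ - (ξ : ℝ) ^ 3)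
  rw [show τ - (η : ℝ) ^ 3 - (τ - (ξ : ℝ) ^ 3) = (ξ : ℝ) ^ 3 - (η : ℝ) ^ 3 by ring] at this
  linarith

theorem resonance_le_of_not_inputDominates {ξ η : ℤ} {τ : ℝ} (h : ¬ InputDominates ξ η τ) :
    |(ξ : ℝ) ^ 3 - (η : ℝ) ^ 3| ≤ 2 * |τ - (ξ : ℝ) ^ 3| := by
  have h' : |τ - (η : ℝ) ^ 3| < |τ - (ξ : ℝ) ^ 3| := not_le.1 h
  have := abs_sub (τ - (η : ℝ) ^ 3) (τ - (ξ : ℝ) ^ 3)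
  rw [show τ - (η : ℝ) ^ 3 - (τ - (ξ : ℝ) ^ 3) = (ξ : ℝ) ^ 3 - (η : ℝ) ^ 3 by ring] at this
  linarith

theorem ebracket_mul_sq (x s : ℝ) (y : ℝ≥0∞) :
    ebracket x ^ (2 * s) * y ^ 2 = (ebracket x ^ s * y) ^ 2 := by
  rw [mul_pow, ebracket_rpow_sq]

theorem wsq_eq_lintegral {s b : ℝ} {f : ℤ → ℝ → ℝ≥0∞} (hf : ∀ ξ, Measurable (f ξ)) :
    wsq s b f = ∫⁻ τ, ∑' ξ : ℤ, ebracket (τ - (ξ : ℝ) ^ 3) ^ b * (ebracket ξ ^ s * f ξ τ) ^ 2 := by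
  rw [wsq, lintegral_tsum fun ξ => by have := hf ξ; fun_prop]
  congr 1; ext ξ
  refine lintegral_congr fun τ => ?_
  rw [← ebracket_mul_sq]; ring

/-- Where the input modulation dominates, it pays for the derivative, and the output modulation is
only needed to sum over the output frequency. -/
theorem exists_wsq_dprod_input_le {s : ℝ} (hs : -1 / 4 < s) {b : ℝ} (hb : 1 / 3 < b) :
    ∃ C : ℝ≥0∞, C ≠ ⊤ ∧ ∀ (α : ℤ → ℝ≥0∞) (w : ℤ → ℝ → ℝ≥0∞), α 0 = 0 → w 0 = 0 →
      (∀ η, Measurable (w η)) →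
      wsq s (-b) (dprod InputDominates α w) ≤ C * hsq s α * wsq s 1 w := by
  obtain ⟨C, hC, hres⟩ := exists_resonance_le_ennreal hs
  obtain ⟨S, hS, hsum⟩ := exists_tsum_modulation_le hb
  refine ⟨C ^ 2 * S, by finiteness, fun α w hα hw0 hw => ?_⟩
  have hpt : ∀ (ξ : ℤ) (τ : ℝ), (ebracket ξ ^ s * dprod InputDominates α w ξ τ) ^ 2 ≤
      C ^ 2 * hsq s α *
        ∑' η : ℤ, ebracket (τ - (η : ℝ) ^ 3) ^ (1 : ℝ) * (ebracket η ^ s * w η τ) ^ 2 := by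
    intro ξ τ
    have h1 := ebracket_mul_dprod_le (P := InputDominates) (τ := τ) (s := s) (ξ := ξ) hα hw0
      (K := fun η => C * ebracket (τ - (η : ℝ) ^ 3) ^ (1 / 2 : ℝ))
      fun η hP h1 h2 h3 => (hres ξ η _ h1 h2 h3 hP.resonance_le).1
    refine (pow_le_pow_left' h1 2).trans ?_
    have h2 := sq_tsum_le (ι := ℤ)
      (h := fun η => C * ebracket (τ - (η : ℝ) ^ 3) ^ (1 / 2 : ℝ) *
        ((ebracket (ξ - η : ℤ) ^ s * α (ξ - η)) * (ebracket η ^ s * w η τ)))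
      (A := fun η => C ^ 2 * (ebracket (ξ - η : ℤ) ^ s * α (ξ - η)) ^ 2)
      (B := fun η => ebracket (τ - (η : ℝ) ^ 3) ^ (1 : ℝ) * (ebracket η ^ s * w η τ) ^ 2)
      fun η => le_of_eq (by
        have e := ebracket_rpow_sq (τ - (η : ℝ) ^ 3) (1 / 2)
        rw [show (2 : ℝ) * (1 / 2) = 1 by norm_num] at e
        rw [← e]; ring)
    refine h2.trans (le_of_eq ?_)
    rw [ENNReal.tsum_mul_left, tsum_sub_left (fun η : ℤ => (ebracket η ^ s * α η) ^ 2), hsq]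
  have hm := measurable_dprod measurableSet_inputDominates α hw
  have hT : Measurable fun τ => ∑' η : ℤ,
      ebracket (τ - (η : ℝ) ^ 3) ^ (1 : ℝ) * (ebracket η ^ s * w η τ) ^ 2 :=
    Measurable.tsum fun η => by have := hw η; fun_prop
  rw [wsq_eq_lintegral hm, wsq_eq_lintegral hw, ← lintegral_const_mul _ hT]
  · refine lintegral_mono fun τ => ?_
    calc _ ≤ ∑' ξ : ℤ, ebracket (τ - (ξ : ℝ) ^ 3) ^ (-b) * (C ^ 2 * hsq s α *
            ∑' η : ℤ, ebracket (τ - (η : ℝ) ^ 3) ^ (1 : ℝ) * (ebracket η ^ s * w η τ) ^ 2) :=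
          ENNReal.tsum_le_tsum fun ξ => by gcongr; exact hpt ξ τ
      _ = (∑' ξ : ℤ, ebracket (τ - (ξ : ℝ) ^ 3) ^ (-b)) * (C ^ 2 * hsq s α *
            ∑' η : ℤ, ebracket (τ - (η : ℝ) ^ 3) ^ (1 : ℝ) * (ebracket η ^ s * w η τ) ^ 2) :=
          ENNReal.tsum_mul_right
      _ ≤ S * (C ^ 2 * hsq s α *
            ∑' η : ℤ, ebracket (τ - (η : ℝ) ^ 3) ^ (1 : ℝ) * (ebracket η ^ s * w η τ) ^ 2) := by
          gcongr; exact hsum τ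
      _ = _ := by ring

theorem measurableSet_not_inputDominates (ξ η : ℤ) : MeasurableSet {τ | ¬ InputDominates ξ η τ} :=
  (measurableSet_inputDominates ξ η).compl

/-- Where the output modulation dominates, it pays for the derivative, and the input modulation is
only needed to sum over the input frequency. -/
theorem exists_wsq_dprod_output_le {s : ℝ} (hs : -1 / 4 < s) {b : ℝ} (hb : 1 / 3 < b) :
    ∃ C : ℝ≥0∞, C ≠ ⊤ ∧ ∀ (α : ℤ → ℝ≥0∞) (w : ℤ → ℝ → ℝ≥0∞), α 0 = 0 → w 0 = 0 →
      (∀ η, Measurable (w η)) →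
      wsq s (-1) (dprod (fun ξ η τ => ¬ InputDominates ξ η τ) α w) ≤ C * hsq s α * wsq s b w := by
  obtain ⟨C, hC, hres⟩ := exists_resonance_le_ennreal hs
  obtain ⟨S, hS, hsum⟩ := exists_tsum_modulation_le hb
  refine ⟨C ^ 2 * S, by finiteness, fun α w hα hw0 hw => ?_⟩
  have hpt : ∀ (ξ : ℤ) (τ : ℝ), ebracket (τ - (ξ : ℝ) ^ 3) ^ (-1 : ℝ) *
      (ebracket ξ ^ s * dprod (fun ξ η τ => ¬ InputDominates ξ η τ) α w ξ τ) ^ 2 ≤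
      C ^ 2 * S * ∑' η : ℤ, (ebracket (ξ - η : ℤ) ^ s * α (ξ - η)) ^ 2 *
        (ebracket (τ - (η : ℝ) ^ 3) ^ b * (ebracket η ^ s * w η τ) ^ 2) := by
    intro ξ τ
    have h1 := ebracket_mul_dprod_le (P := fun ξ η τ => ¬ InputDominates ξ η τ) (τ := τ) (s := s)
      (ξ := ξ) hα hw0 (K := fun η => C * ebracket (τ - (ξ : ℝ) ^ 3) ^ (1 / 2 : ℝ))
      fun η hP h1 h2 h3 => (hres ξ η _ h1 h2 h3 (resonance_le_of_not_inputDominates hP)).1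
    rw [ENNReal.tsum_mul_left] at h1
    have h2 := sq_tsum_le (ι := ℤ)
      (h := fun η => (ebracket (ξ - η : ℤ) ^ s * α (ξ - η)) * (ebracket η ^ s * w η τ))
      (A := fun η => ebracket (τ - (η : ℝ) ^ 3) ^ (-b))
      (B := fun η => (ebracket (ξ - η : ℤ) ^ s * α (ξ - η)) ^ 2 *
        (ebracket (τ - (η : ℝ) ^ 3) ^ b * (ebracket η ^ s * w η τ) ^ 2))
      fun η => le_of_eq (by
        have e := ebracket_rpow_mul_neg (τ - (η : ℝ) ^ 3) b
        calc _ = (ebracket (ξ - η : ℤ) ^ s * α (ξ - η)) ^ 2 * (ebracket η ^ s * w η τ) ^ 2 * 1 := by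
              ring
          _ = _ := by rw [← e]; ring)
    have e := ebracket_rpow_sq (τ - (ξ : ℝ) ^ 3) (1 / 2)
    rw [show (2 : ℝ) * (1 / 2) = 1 by norm_num] at e
    calc _ ≤ ebracket (τ - (ξ : ℝ) ^ 3) ^ (-1 : ℝ) *
          (C * ebracket (τ - (ξ : ℝ) ^ 3) ^ (1 / 2 : ℝ) *
          ∑' η, (ebracket (ξ - η : ℤ) ^ s * α (ξ - η)) * (ebracket η ^ s * w η τ)) ^ 2 := by gcongr
      _ = (ebracket (τ - (ξ : ℝ) ^ 3) ^ (1 : ℝ) * ebracket (τ - (ξ : ℝ) ^ 3) ^ (-1 : ℝ)) * C ^ 2 *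
          (∑' η, (ebracket (ξ - η : ℤ) ^ s * α (ξ - η)) * (ebracket η ^ s * w η τ)) ^ 2 := by
          rw [← e]; ring
      _ = C ^ 2 *
          (∑' η, (ebracket (ξ - η : ℤ) ^ s * α (ξ - η)) * (ebracket η ^ s * w η τ)) ^ 2 := by
          rw [ebracket_rpow_mul_neg, one_mul]
      _ ≤ C ^ 2 * (S * ∑' η : ℤ, (ebracket (ξ - η : ℤ) ^ s * α (ξ - η)) ^ 2 *
          (ebracket (τ - (η : ℝ) ^ 3) ^ b * (ebracket η ^ s * w η τ) ^ 2)) := by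
          gcongr; exact h2.trans (by gcongr; exact hsum τ)
      _ = _ := by ring
  have hm := measurable_dprod measurableSet_not_inputDominates α hw
  have hT : Measurable fun τ => ∑' η : ℤ,
      ebracket (τ - (η : ℝ) ^ 3) ^ b * (ebracket η ^ s * w η τ) ^ 2 :=
    Measurable.tsum fun η => by have := hw η; fun_prop
  rw [wsq_eq_lintegral hm, wsq_eq_lintegral hw, ← lintegral_const_mul _ hT]
  refine lintegral_mono fun τ => ?_
  calc _ ≤ ∑' ξ : ℤ, C ^ 2 * S * ∑' η : ℤ, (ebracket (ξ - η : ℤ) ^ s * α (ξ - η)) ^ 2 *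
        (ebracket (τ - (η : ℝ) ^ 3) ^ b * (ebracket η ^ s * w η τ) ^ 2) :=
        ENNReal.tsum_le_tsum fun ξ => hpt ξ τ
    _ = C ^ 2 * S * ∑' η : ℤ, hsq s α *
        (ebracket (τ - (η : ℝ) ^ 3) ^ b * (ebracket η ^ s * w η τ) ^ 2) := by
        rw [ENNReal.tsum_mul_left, ENNReal.tsum_comm]
        congr 2; ext η
        rw [ENNReal.tsum_mul_right, tsum_sub_right (fun ξ : ℤ => (ebracket ξ ^ s * α ξ) ^ 2), hsq]
    _ = _ := by rw [ENNReal.tsum_mul_left]; ring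

/-- The `L²L¹` counterpart of `exists_wsq_dprod_output_le`.  The part `3/8` of the output modulation
that the derivative leaves over exceeds the same power of the input modulation, which makes the
latter integrable in `τ`. -/
theorem exists_lsq_dprod_output_le {s : ℝ} (hs : -1 / 4 < s) {b : ℝ} (hb : 1 / 3 < b) :
    ∃ C : ℝ≥0∞, C ≠ ⊤ ∧ ∀ (α : ℤ → ℝ≥0∞) (w : ℤ → ℝ → ℝ≥0∞), α 0 = 0 → w 0 = 0 →
      (∀ η, Measurable (w η)) →
      lsq s (dprod (fun ξ η τ => ¬ InputDominates ξ η τ) α w) ≤ C * hsq s α * wsq s b w := by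
  obtain ⟨C, hC, hres⟩ := exists_resonance_le_ennreal hs
  have hI := lintegral_ebracket_rpow_lt_top (p := 3 / 4 + b) (by linarith)
  have hS := tsum_ebracket_rpow_lt_top (p := 5 / 4) (by norm_num)
  set I := ∫⁻ x, ebracket x ^ (-(3 / 4 + b))
  set S := ∑' k : ℤ, ebracket k ^ (-(5 / 4 : ℝ))
  refine ⟨C ^ 2 * S * I, by finiteness, fun α w hα hw0 hw => ?_⟩
  set J : ℤ → ℝ≥0∞ := fun η =>
    ∫⁻ τ, ebracket (τ - (η : ℝ) ^ 3) ^ (-(3 / 8) : ℝ) * (ebracket η ^ s * w η τ) with hJ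
  set D : ℤ → ℝ≥0∞ := fun η =>
    ∫⁻ τ, ebracket (τ - (η : ℝ) ^ 3) ^ b * (ebracket η ^ s * w η τ) ^ 2 with hD
  have hJD : ∀ η, J η ^ 2 ≤ I * D η := fun η => by
    have := hw η
    have h := sq_lintegral_le (μ := volume)
      (h := fun τ => ebracket (τ - (η : ℝ) ^ 3) ^ (-(3 / 8) : ℝ) * (ebracket η ^ s * w η τ))
      (A := fun τ => ebracket (τ - (η : ℝ) ^ 3) ^ (-(3 / 4 + b)))
      (B := fun τ => ebracket (τ - (η : ℝ) ^ 3) ^ b * (ebracket η ^ s * w η τ) ^ 2)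
      (by fun_prop) (by fun_prop) fun τ => le_of_eq (by
        rw [mul_pow, ebracket_rpow_sq, ← mul_assoc, ebracket_rpow_mul]
        congr 2; ring)
    rwa [lintegral_sub_right_eq_self (fun x => ebracket x ^ (-(3 / 4 + b)))] at h
  have hpt : ∀ (ξ : ℤ) (τ : ℝ), ebracket ξ ^ s * (ebracket (τ - (ξ : ℝ) ^ 3) ^ (-1 : ℝ) *
      dprod (fun ξ η τ => ¬ InputDominates ξ η τ) α w ξ τ) ≤
      ∑' η : ℤ, C * (ebracket (ξ - η : ℤ) ^ (-(5 / 8) : ℝ) *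
        (ebracket (ξ - η : ℤ) ^ s * α (ξ - η))) *
        (ebracket (τ - (η : ℝ) ^ 3) ^ (-(3 / 8) : ℝ) * (ebracket η ^ s * w η τ)) := by
    intro ξ τ
    rw [mul_left_comm, dprod, ← ENNReal.tsum_mul_left, ← ENNReal.tsum_mul_left]
    refine ENNReal.tsum_le_tsum fun η => ?_
    split_ifs with hP
    · simp
    by_cases h1 : ξ = 0
    · simp [h1]
    by_cases h2 : η = 0
    · simp [h2, hw0]
    by_cases h3 : ξ - η = 0
    · simp [h3, hα]
    have h := (hres ξ η _ h1 h2 h3 (resonance_le_of_not_inputDominates hP)).2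
    have hmod : ebracket (τ - (ξ : ℝ) ^ 3) ^ (-(3 / 8) : ℝ) ≤
        ebracket (τ - (η : ℝ) ^ 3) ^ (-(3 / 8) : ℝ) :=
      ebracket_rpow_neg_le (not_le.1 hP).le (by norm_num)
    calc _ = ebracket (τ - (ξ : ℝ) ^ 3) ^ (-1 : ℝ) *
          (ENNReal.ofReal |(ξ : ℝ)| * ebracket ξ ^ s) * (α (ξ - η) * w η τ) := by ring
      _ ≤ ebracket (τ - (ξ : ℝ) ^ 3) ^ (-1 : ℝ) *
          (C * (ebracket (τ - (ξ : ℝ) ^ 3) ^ (5 / 8 : ℝ) *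
            ebracket (ξ - η : ℤ) ^ (-(5 / 8) : ℝ)) *
          (ebracket η ^ s * ebracket (ξ - η : ℤ) ^ s)) * (α (ξ - η) * w η τ) := by gcongr
      _ = C * (ebracket (ξ - η : ℤ) ^ (-(5 / 8) : ℝ) * (ebracket (ξ - η : ℤ) ^ s * α (ξ - η))) *
          ((ebracket (τ - (ξ : ℝ) ^ 3) ^ (-1 : ℝ) * ebracket (τ - (ξ : ℝ) ^ 3) ^ (5 / 8 : ℝ)) *
          (ebracket η ^ s * w η τ)) := by ring
      _ = C * (ebracket (ξ - η : ℤ) ^ (-(5 / 8) : ℝ) * (ebracket (ξ - η : ℤ) ^ s * α (ξ - η))) *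
          (ebracket (τ - (ξ : ℝ) ^ 3) ^ (-(3 / 8) : ℝ) * (ebracket η ^ s * w η τ)) := by
          rw [ebracket_rpow_mul]; norm_num
      _ ≤ _ := by gcongr
  have hint : ∀ ξ : ℤ, (∫⁻ τ, ebracket ξ ^ s * (ebracket (τ - (ξ : ℝ) ^ 3) ^ (-1 : ℝ) *
      dprod (fun ξ η τ => ¬ InputDominates ξ η τ) α w ξ τ)) ^ 2 ≤
      C ^ 2 * S * I * ∑' η : ℤ, (ebracket (ξ - η : ℤ) ^ s * α (ξ - η)) ^ 2 * D η := by
    intro ξ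
    have h1 : ∫⁻ τ, ebracket ξ ^ s * (ebracket (τ - (ξ : ℝ) ^ 3) ^ (-1 : ℝ) *
        dprod (fun ξ η τ => ¬ InputDominates ξ η τ) α w ξ τ) ≤
        ∑' η : ℤ, C * (ebracket (ξ - η : ℤ) ^ (-(5 / 8) : ℝ) *
          (ebracket (ξ - η : ℤ) ^ s * α (ξ - η))) * J η := by
      refine (lintegral_mono (hpt ξ)).trans (le_of_eq ?_)
      rw [lintegral_tsum fun η => by have := hw η; fun_prop]
      congr 1; ext η
      have := hw η
      rw [lintegral_const_mul _ (by fun_prop)]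
    have h2 := sq_tsum_le (ι := ℤ)
      (h := fun η => C * (ebracket (ξ - η : ℤ) ^ (-(5 / 8) : ℝ) *
          (ebracket (ξ - η : ℤ) ^ s * α (ξ - η))) * J η)
      (A := fun η => ebracket (ξ - η : ℤ) ^ (-(5 / 4) : ℝ))
      (B := fun η => C ^ 2 * ((ebracket (ξ - η : ℤ) ^ s * α (ξ - η)) ^ 2 * J η ^ 2))
      fun η => le_of_eq (by
        have e := ebracket_rpow_sq (ξ - η : ℤ) (-(5 / 8))
        rw [show (2 : ℝ) * (-(5 / 8)) = -(5 / 4) by norm_num] at e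
        rw [← e]; ring)
    rw [tsum_sub_left (fun η : ℤ => ebracket η ^ (-(5 / 4) : ℝ)), ENNReal.tsum_mul_left] at h2
    calc _ ≤ _ := pow_le_pow_left' h1 2
      _ ≤ _ := h2
      _ ≤ S * (C ^ 2 * ∑' η : ℤ, (ebracket (ξ - η : ℤ) ^ s * α (ξ - η)) ^ 2 * (I * D η)) := by
          gcongr with η
          exact hJD η
      _ = _ := by
          simp only [mul_left_comm _ I]
          rw [ENNReal.tsum_mul_left]; ring
  calc _ ≤ ∑' ξ : ℤ, C ^ 2 * S * I *
        ∑' η : ℤ, (ebracket (ξ - η : ℤ) ^ s * α (ξ - η)) ^ 2 * D η := ENNReal.tsum_le_tsum hint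
    _ = C ^ 2 * S * I * (hsq s α * ∑' η, D η) := by
        rw [ENNReal.tsum_mul_left, ENNReal.tsum_comm, ← ENNReal.tsum_mul_left (a := hsq s α)]
        congr 2; ext η
        rw [ENNReal.tsum_mul_right, tsum_sub_right (fun ξ : ℤ => (ebracket ξ ^ s * α ξ) ^ 2), hsq]
    _ = _ := by
        rw [wsq_eq_lintegral hw, lintegral_tsum fun η => by have := hw η; fun_prop]; ring

/-! ### The bilinear estimate with time localization -/

theorem wsq_eq_mul (s b : ℝ) {f : ℤ → ℝ → ℝ≥0∞} (hf : ∀ ξ, Measurable (f ξ)) :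
    wsq s b f = ∑' ξ : ℤ, ebracket ξ ^ (2 * s) *
      ∫⁻ τ, ebracket (τ - (ξ : ℝ) ^ 3) ^ b * f ξ τ ^ 2 := by
  unfold wsq
  congr 1; ext ξ
  have := hf ξ
  rw [lintegral_const_mul _ (by fun_prop)]

theorem lsq_eq_mul (s : ℝ) {f : ℤ → ℝ → ℝ≥0∞} (hf : ∀ ξ, Measurable (f ξ)) :
    lsq s f = ∑' ξ : ℤ, ebracket ξ ^ (2 * s) *
      (∫⁻ τ, ebracket (τ - (ξ : ℝ) ^ 3) ^ (-1 : ℝ) * f ξ τ) ^ 2 := by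
  unfold lsq
  congr 1; ext ξ
  have := hf ξ
  rw [lintegral_const_mul _ (by fun_prop), ebracket_mul_sq]

theorem tsum_weight_mul_le {s : ℝ} {K : ℝ≥0∞} {A B : ℤ → ℝ≥0∞} (h : ∀ ξ, A ξ ≤ K * B ξ) :
    ∑' ξ : ℤ, ebracket ξ ^ (2 * s) * A ξ ≤ K * ∑' ξ : ℤ, ebracket ξ ^ (2 * s) * B ξ := by
  rw [← ENNReal.tsum_mul_left]
  refine ENNReal.tsum_le_tsum fun ξ => ?_
  rw [mul_left_comm]
  exact mul_le_mul_right (h ξ) _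

theorem wsq_add_le {s b : ℝ} {f g : ℤ → ℝ → ℝ≥0∞} (hf : ∀ ξ, Measurable (f ξ)) :
    wsq s b (fun ξ τ => f ξ τ + g ξ τ) ≤ 2 * wsq s b f + 2 * wsq s b g := by
  unfold wsq
  rw [← ENNReal.tsum_mul_left, ← ENNReal.tsum_mul_left, ← ENNReal.tsum_add]
  refine ENNReal.tsum_le_tsum fun ξ => ?_
  have := hf ξ
  rw [← lintegral_const_mul' 2 _ (by simp), ← lintegral_const_mul' 2 _ (by simp),
    ← lintegral_add_left (by fun_prop)]
  refine lintegral_mono fun τ => ?_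
  calc _ ≤ ebracket ξ ^ (2 * s) * (ebracket (τ - (ξ : ℝ) ^ 3) ^ b *
        (2 * f ξ τ ^ 2 + 2 * g ξ τ ^ 2)) := by
        gcongr; exact add_sq_le_two_mul _ _
    _ = _ := by ring

theorem lsq_add_le {s : ℝ} {f g : ℤ → ℝ → ℝ≥0∞} (hf : ∀ ξ, Measurable (f ξ)) :
    lsq s (fun ξ τ => f ξ τ + g ξ τ) ≤ 2 * lsq s f + 2 * lsq s g := by
  unfold lsq
  rw [← ENNReal.tsum_mul_left, ← ENNReal.tsum_mul_left, ← ENNReal.tsum_add]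
  refine ENNReal.tsum_le_tsum fun ξ => ?_
  have := hf ξ
  simp only [mul_add]
  rw [lintegral_add_left (by fun_prop)]
  exact add_sq_le_two_mul _ _

theorem smear_add (δ : ℝ) {f g : ℝ → ℝ≥0∞} (hf : Measurable f) (τ : ℝ) :
    smear δ (fun τ => f τ + g τ) τ = smear δ f τ + smear δ g τ := by
  simp only [smear, mul_add]
  rw [lintegral_add_left (by fun_prop)]

/-- The absolute value of `∂ₓ` of a product, on the side of the frequencies. -/
noncomputable def fullProd (α : ℤ → ℝ≥0∞) (w : ℤ → ℝ → ℝ≥0∞) (ξ : ℤ) (τ : ℝ) : ℝ≥0∞ :=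
  ENNReal.ofReal |(ξ : ℝ)| * ∑' η : ℤ, α (ξ - η) * w η τ

theorem fullProd_eq_add (α : ℤ → ℝ≥0∞) (w : ℤ → ℝ → ℝ≥0∞) (ξ : ℤ) (τ : ℝ) :
    fullProd α w ξ τ = dprod InputDominates α w ξ τ +
      dprod (fun ξ η τ => ¬ InputDominates ξ η τ) α w ξ τ := by
  rw [fullProd, dprod, dprod, ← ENNReal.tsum_add, ← ENNReal.tsum_mul_left]
  congr 1; ext η
  by_cases h : InputDominates ξ η τ <;> simp [h]

/-- The majorant of the Fourier transform of `ψ(t/δ) ∂ₓ (u a)`, where `α` and `G` are the absolute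
values of the Fourier transforms of `a` and `u`.  It is smeared twice, once for the input and once
for the output of the product. -/
noncomputable def majorant (δ : ℝ) (α : ℤ → ℝ≥0∞) (G : ℤ → ℝ → ℝ≥0∞) (ξ : ℤ) : ℝ → ℝ≥0∞ :=
  smear δ (fullProd α (fun η => smear δ (G η)) ξ)

/-- The bilinear estimate in `Z^s`, for the absolute values of the Fourier transforms. -/
theorem exists_majorant_le {s : ℝ} (hs : -1 / 4 < s) {θ : ℝ} (hθ : 0 < θ) (hθ' : θ ≤ 1 / 12) :
    ∃ C : ℝ≥0∞, C ≠ ⊤ ∧ ∀ δ : ℝ, 0 < δ → δ ≤ 1 → ∀ (α : ℤ → ℝ≥0∞) (G : ℤ → ℝ → ℝ≥0∞),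
      α 0 = 0 → G 0 = 0 → (∀ η, Measurable (G η)) →
      wsq s (-1) (majorant δ α G) ≤
          C * ENNReal.ofReal δ ^ (2 * (1 / 3 - 4 * θ)) * (hsq s α * wsq s 1 G) ∧
        lsq s (majorant δ α G) ≤
          C * ENNReal.ofReal δ ^ (2 * (1 / 3 - 4 * θ)) * (hsq s α * wsq s 1 G) := by
  -- `γ` is the order of the time weights, just below the critical one, and `b / 2` is the power of
  -- the smaller modulation that is spent on the summation in the frequencies.
  set γ := 1 - 2 * θ with hγ
  set b := 1 / 3 + 2 * θ with hb
  have hγ1 : γ < 1 := by linarith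
  have hb13 : 1 / 3 < b := by linarith
  obtain ⟨C1, hC1, h1⟩ := exists_lintegral_sq_smear_le hγ1
  obtain ⟨C2, hC2, h2⟩ := exists_lintegral_neg_sq_smear_le hγ1
  obtain ⟨C3, hC3, h3⟩ := exists_lintegral_smear_le hγ1
  obtain ⟨C4, hC4, h4⟩ := exists_sq_lintegral_smear_le hγ1
  obtain ⟨B1, hB1, b1⟩ := exists_wsq_dprod_input_le hs hb13
  obtain ⟨B2, hB2, b2⟩ := exists_wsq_dprod_output_le hs hb13
  obtain ⟨B3, hB3, b3⟩ := exists_lsq_dprod_output_le hs hb13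
  refine ⟨2 * (C2 * B1 * C1) + 2 * (C2 * B2 * C1) +
    (2 * (C4 * B1 * C1) + 2 * (C3 ^ 2 * B3 * C1)), by finiteness, ?_⟩
  intro δ hδ hδ1 α G hα hG0 hG
  set d := ENNReal.ofReal δ
  have hd1 : d ≤ 1 := by simpa [d] using hδ1
  set w : ℤ → ℝ → ℝ≥0∞ := fun η => smear δ (G η) with hw
  have hwm : ∀ η, Measurable (w η) := fun η => measurable_smear δ (hG η)
  have hw0 : w 0 = 0 := by ext τ; simp [hw, hG0, smear]
  set v1 := dprod InputDominates α w
  set v2 := dprod (fun ξ η τ => ¬ InputDominates ξ η τ) α w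
  have hv1 : ∀ ξ, Measurable (v1 ξ) := measurable_dprod measurableSet_inputDominates α hwm
  have hv2 : ∀ ξ, Measurable (v2 ξ) := measurable_dprod measurableSet_not_inputDominates α hwm
  have hmaj : majorant δ α G = fun ξ τ => smear δ (v1 ξ) τ + smear δ (v2 ξ) τ := by
    ext ξ τ
    rw [majorant, ← smear_add δ (hv1 ξ)]
    congr 1; ext τ'
    exact fullProd_eq_add α w ξ τ'
  have hm1 : ∀ ξ, Measurable (smear δ (v1 ξ)) := fun ξ => measurable_smear δ (hv1 ξ)
  have hm2 : ∀ ξ, Measurable (smear δ (v2 ξ)) := fun ξ => measurable_smear δ (hv2 ξ)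
  have hd : ∀ x y : ℝ, d ^ x * d ^ y = d ^ (x + y) := ofReal_rpow_mul_rpow hδ
  have hmono : ∀ x : ℝ, 2 * (1 / 3 - 4 * θ) ≤ x → d ^ x ≤ d ^ (2 * (1 / 3 - 4 * θ)) :=
    fun x hx => ENNReal.rpow_le_rpow_of_exponent_ge hd1 hx
  have hX : ∀ c, 0 ≤ c → c ≤ 1 → wsq s c w ≤ C1 * d ^ (γ - c) * wsq s 1 G := fun c hc hc1 => by
    rw [wsq_eq_mul s c hwm, wsq_eq_mul s 1 hG]
    exact tsum_weight_mul_le fun ξ => h1 δ hδ hδ1 c hc hc1 _ _ (hG ξ)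
  have hN : ∀ (c : ℝ) (v : ℤ → ℝ → ℝ≥0∞), 0 ≤ c → c ≤ 1 → (∀ ξ, Measurable (v ξ)) →
      wsq s (-1) (fun ξ => smear δ (v ξ)) ≤ C2 * d ^ (γ - c) * wsq s (-c) v :=
    fun c v hc hc1 hv => by
      rw [wsq_eq_mul s _ fun ξ => measurable_smear δ (hv ξ), wsq_eq_mul s _ hv]
      exact tsum_weight_mul_le fun ξ => h2 δ hδ hδ1 c hc hc1 _ _ (hv ξ)
  set Y := hsq s α * wsq s 1 G with hY
  have hW1 : wsq s (-1) (fun ξ => smear δ (v1 ξ)) ≤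
      C2 * B1 * C1 * d ^ (2 * (1 / 3 - 4 * θ)) * Y := by
    calc _ ≤ C2 * d ^ (γ - b) * wsq s (-b) v1 := hN b v1 (by linarith) (by linarith) hv1
      _ ≤ C2 * d ^ (γ - b) * (B1 * hsq s α * (C1 * d ^ (γ - 1) * wsq s 1 G)) := by
          gcongr
          exact (b1 α w hα hw0 hwm).trans (by gcongr; exact hX 1 zero_le_one le_rfl)
      _ = C2 * B1 * C1 * (d ^ (γ - b) * d ^ (γ - 1)) * Y := by rw [hY]; ring
      _ ≤ _ := by
          rw [hd]
          exact mul_le_mul_left (mul_le_mul_right (hmono _ (by rw [hγ, hb]; linarith)) _) _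
  have hW2 : wsq s (-1) (fun ξ => smear δ (v2 ξ)) ≤
      C2 * B2 * C1 * d ^ (2 * (1 / 3 - 4 * θ)) * Y := by
    calc _ ≤ C2 * d ^ (γ - 1) * wsq s (-1) v2 := hN 1 v2 zero_le_one le_rfl hv2
      _ ≤ C2 * d ^ (γ - 1) * (B2 * hsq s α * (C1 * d ^ (γ - b) * wsq s 1 G)) := by
          gcongr
          exact (b2 α w hα hw0 hwm).trans
            (by gcongr; exact hX b (by linarith) (by linarith))
      _ = C2 * B2 * C1 * (d ^ (γ - 1) * d ^ (γ - b)) * Y := by rw [hY]; ring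
      _ ≤ _ := by
          rw [hd]
          exact mul_le_mul_left (mul_le_mul_right (hmono _ (by rw [hγ, hb]; linarith)) _) _
  have hL1 : lsq s (fun ξ => smear δ (v1 ξ)) ≤
      C4 * B1 * C1 * d ^ (2 * (1 / 3 - 4 * θ)) * Y := by
    calc _ ≤ C4 * d ^ (2 * γ - 1 - b) * wsq s (-b) v1 := by
          rw [lsq_eq_mul s hm1, wsq_eq_mul s _ hv1]
          exact tsum_weight_mul_le fun ξ => h4 δ hδ hδ1 b (by linarith) (by linarith) _ _ (hv1 ξ)
      _ ≤ C4 * d ^ (2 * γ - 1 - b) * (B1 * hsq s α * (C1 * d ^ (γ - 1) * wsq s 1 G)) := by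
          gcongr
          exact (b1 α w hα hw0 hwm).trans (by gcongr; exact hX 1 zero_le_one le_rfl)
      _ = C4 * B1 * C1 * (d ^ (2 * γ - 1 - b) * d ^ (γ - 1)) * Y := by rw [hY]; ring
      _ ≤ _ := by
          rw [hd]
          exact mul_le_mul_left (mul_le_mul_right (hmono _ (by rw [hγ, hb]; linarith)) _) _
  have hL2 : lsq s (fun ξ => smear δ (v2 ξ)) ≤
      C3 ^ 2 * B3 * C1 * d ^ (2 * (1 / 3 - 4 * θ)) * Y := by
    calc _ ≤ (C3 * d ^ (γ - 1)) ^ 2 * lsq s v2 := by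
          rw [lsq_eq_mul s hm2, lsq_eq_mul s hv2]
          refine tsum_weight_mul_le fun ξ => ?_
          rw [← mul_pow]
          exact pow_le_pow_left' (h3 δ hδ hδ1 _ _ (hv2 ξ)) 2
      _ ≤ (C3 * d ^ (γ - 1)) ^ 2 * (B3 * hsq s α * (C1 * d ^ (γ - b) * wsq s 1 G)) := by
          gcongr
          exact (b3 α w hα hw0 hwm).trans
            (by gcongr; exact hX b (by linarith) (by linarith))
      _ = C3 ^ 2 * B3 * C1 * (d ^ (γ - 1) * d ^ (γ - 1) * d ^ (γ - b)) * Y := by rw [hY]; ring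
      _ ≤ _ := by
          rw [hd, hd]
          exact mul_le_mul_left (mul_le_mul_right (hmono _ (by rw [hγ, hb]; linarith)) _) _
  set e := d ^ (2 * (1 / 3 - 4 * θ))
  rw [hmaj]
  constructor
  · calc _ ≤ _ := wsq_add_le hm1
      _ ≤ 2 * (C2 * B1 * C1 * e * Y) + 2 * (C2 * B2 * C1 * e * Y) := by gcongr
      _ = (2 * (C2 * B1 * C1) + 2 * (C2 * B2 * C1)) * e * Y := by ring
      _ ≤ _ := by exact mul_le_mul_left (mul_le_mul_left le_self_add _) _
  · calc _ ≤ _ := lsq_add_le hm1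
      _ ≤ 2 * (C4 * B1 * C1 * e * Y) + 2 * (C3 ^ 2 * B3 * C1 * e * Y) := by gcongr
      _ = (2 * (C4 * B1 * C1) + 2 * (C3 ^ 2 * B3 * C1)) * e * Y := by ring
      _ ≤ _ := by exact mul_le_mul_left (mul_le_mul_left le_add_self _) _

/-! ### Fourier transforms of distributions given by functions -/

theorem one_le_two_pi : 1 ≤ 2 * Real.pi := by linarith [Real.pi_gt_three]

/-- The Schwartz seminorm that controls the decay of order `k`. -/
noncomputable def decaySeminorm (k : ℕ) : Seminorm ℂ 𝓢(ℝ, ℂ) :=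
  (Finset.Iic (k, 0)).sup (schwartzSeminormFamily ℂ ℝ ℂ)

theorem schwartz_decay (φ : 𝓢(ℝ, ℂ)) (k : ℕ) (ν : ℝ) :
    bracket (2 * Real.pi * ν) ^ k * ‖φ ν‖ ≤ (4 * Real.pi) ^ k * decaySeminorm k φ := by
  have h := SchwartzMap.one_add_le_sup_seminorm_apply (𝕜 := ℂ) (m := (k, 0)) (k := k) (n := 0)
    le_rfl le_rfl φ ν
  rw [norm_iteratedFDeriv_zero] at h
  have hb : bracket (2 * Real.pi * ν) ≤ 2 * Real.pi * (1 + ‖ν‖) := by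
    have hpi := one_le_two_pi
    refine abs_le_of_sq_le_sq' ?_ (by positivity) |>.2
    rw [sq_bracket, Real.norm_eq_abs]
    have h1 : (2 * Real.pi * (1 + |ν|)) ^ 2 =
        (2 * Real.pi) ^ 2 * (1 + 2 * |ν|) + (2 * Real.pi * ν) ^ 2 := by
      linear_combination (2 * Real.pi) ^ 2 * sq_abs ν
    have : 1 ≤ (2 * Real.pi) ^ 2 := by nlinarith
    have := abs_nonneg ν
    rw [h1]; nlinarith
  calc _ ≤ (2 * Real.pi * (1 + ‖ν‖)) ^ k * ‖φ ν‖ := by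
        gcongr; exact (bracket_pos _).le
    _ = (2 * Real.pi) ^ k * ((1 + ‖ν‖) ^ k * ‖φ ν‖) := by rw [mul_pow]; ring
    _ ≤ (2 * Real.pi) ^ k * (2 ^ k * decaySeminorm k φ) :=
        mul_le_mul_of_nonneg_left h (by positivity)
    _ = _ := by rw [← mul_assoc, ← mul_pow]; congr 2; ring

theorem enorm_schwartz_le (φ : 𝓢(ℝ, ℂ)) (k : ℕ) (ν : ℝ) :
    ‖φ ν‖ₑ ≤ ENNReal.ofReal ((4 * Real.pi) ^ k * decaySeminorm k φ) *
      ebracket (2 * Real.pi * ν) ^ (-(k : ℝ)) := by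
  have hb := bracket_pos (2 * Real.pi * ν)
  have := apply_nonneg (decaySeminorm k) φ
  rw [ebracket_rpow, ← ENNReal.ofReal_mul (by positivity), ← ofReal_norm]
  apply ENNReal.ofReal_le_ofReal
  rw [Real.rpow_neg hb.le, ← div_eq_mul_inv, le_div_iff₀ (by positivity), Real.rpow_natCast,
    mul_comm]
  exact schwartz_decay φ k ν

theorem lintegral_comp_two_pi (f : ℝ → ℝ≥0∞) :
    ∫⁻ ν, f (2 * Real.pi * ν) = ENNReal.ofReal (2 * Real.pi)⁻¹ * ∫⁻ τ, f τ := by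
  have hpi := Real.two_pi_pos
  have he : MeasurableEmbedding fun ν : ℝ => 2 * Real.pi * ν :=
    (Homeomorph.mulLeft₀ _ hpi.ne').measurableEmbedding
  rw [← he.lintegral_map, Real.map_volume_mul_left hpi.ne', lintegral_smul_measure,
    abs_of_pos (inv_pos.2 hpi)]
  rfl

theorem quasiMeasurePreserving_mul_left {c : ℝ} (hc : c ≠ 0) :
    Measure.QuasiMeasurePreserving (fun ν : ℝ => c * ν) volume volume :=
  ⟨measurable_const_mul c, by
    rw [Real.map_volume_mul_left hc]; exact Measure.smul_absolutelyContinuous⟩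

theorem lintegral_schwartz_mul_le (φ : 𝓢(ℝ, ℂ)) (k : ℕ) (f : ℝ → ℝ≥0∞) :
    ∫⁻ ν, ‖φ ν‖ₑ * f (2 * Real.pi * ν) ≤
      ENNReal.ofReal ((4 * Real.pi) ^ k * decaySeminorm k φ) *
        ∫⁻ τ, ebracket τ ^ (-(k : ℝ)) * f τ := by
  calc _ ≤ ∫⁻ ν, ENNReal.ofReal ((4 * Real.pi) ^ k * decaySeminorm k φ) *
        (ebracket (2 * Real.pi * ν) ^ (-(k : ℝ)) * f (2 * Real.pi * ν)) := by
        refine lintegral_mono fun ν => ?_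
        rw [← mul_assoc]
        exact mul_le_mul_left (enorm_schwartz_le φ k ν) _
    _ = ENNReal.ofReal ((4 * Real.pi) ^ k * decaySeminorm k φ) *
        (ENNReal.ofReal (2 * Real.pi)⁻¹ * ∫⁻ τ, ebracket τ ^ (-(k : ℝ)) * f τ) := by
        rw [lintegral_const_mul' _ _ ENNReal.ofReal_ne_top,
          lintegral_comp_two_pi fun τ => ebracket τ ^ (-(k : ℝ)) * f τ]
    _ ≤ ENNReal.ofReal ((4 * Real.pi) ^ k * decaySeminorm k φ) *
        (1 * ∫⁻ τ, ebracket τ ^ (-(k : ℝ)) * f τ) := by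
        gcongr
        rw [ENNReal.ofReal_le_one]
        exact inv_le_one_of_one_le₀ one_le_two_pi
    _ = _ := by rw [one_mul]

/-- Functions that pair with all Schwartz functions are measurable up to null sets. -/
theorem aestronglyMeasurable_of_forall_integrable {h : ℝ → ℂ}
    (hh : ∀ φ : 𝓢(ℝ, ℂ), Integrable fun ν => φ ν * h ν) : AEStronglyMeasurable h := by
  have hb : ∀ n : ℕ, ∃ φ : 𝓢(ℝ, ℂ), ∀ ν : ℝ, |ν| ≤ n → φ ν = 1 := fun n => by
    let f : ContDiffBump (0 : ℝ) := ⟨n + 1, n + 2, by positivity, by linarith⟩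
    have hc : HasCompactSupport fun x => ((f x : ℝ) : ℂ) :=
      f.hasCompactSupport.comp_left (g := fun x : ℝ => (x : ℂ)) Complex.ofReal_zero
    have hs : ContDiff ℝ ∞ fun x => ((f x : ℝ) : ℂ) := Complex.ofRealCLM.contDiff.comp f.contDiff
    refine ⟨hc.toSchwartzMap hs, fun ν hν => ?_⟩
    have : f ν = 1 := f.one_of_mem_closedBall (by
      simp only [Metric.mem_closedBall, dist_zero_right, Real.norm_eq_abs]
      show |ν| ≤ (n : ℝ) + 1
      linarith)
    simp [this]
  choose φ hφ using hb
  refine aestronglyMeasurable_of_tendsto_ae Filter.atTop (fun n => (hh (φ n)).1)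
    (ae_of_all _ fun ν => ?_)
  refine tendsto_const_nhds.congr' ?_
  filter_upwards [Filter.eventually_ge_atTop ⌈|ν|⌉₊] with n hn
  rw [hφ n ν (Nat.ceil_le.1 hn), one_mul]

theorem IsSpaceTimeFourier.aestronglyMeasurable {u : SpaceTimeDist} {g : ℤ → ℝ → ℂ}
    (h : IsSpaceTimeFourier u g) (ξ : ℤ) : AEStronglyMeasurable (g ξ) := by
  have h1 := aestronglyMeasurable_of_forall_integrable fun φ => (h ξ φ).1
  have h2 := h1.comp_quasiMeasurePreserving
    (quasiMeasurePreserving_mul_left (inv_ne_zero Real.two_pi_pos.ne'))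
  refine h2.congr (ae_of_all _ fun τ => ?_)
  simp only [Function.comp_apply]
  rw [mul_inv_cancel_left₀ Real.two_pi_pos.ne']

theorem IsSpaceTimeFourier.congr {u : SpaceTimeDist} {g g' : ℤ → ℝ → ℂ}
    (h : IsSpaceTimeFourier u g) (hg : ∀ ξ, g ξ =ᵐ[volume] g' ξ) : IsSpaceTimeFourier u g' := by
  intro ξ φ
  have e : (fun ν => φ ν * g ξ (2 * Real.pi * ν)) =ᵐ[volume]
      fun ν => φ ν * g' ξ (2 * Real.pi * ν) := by
    filter_upwards [(quasiMeasurePreserving_mul_left Real.two_pi_pos.ne').ae_eq_comp (hg ξ)]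
      with ν hν
    simp only [Function.comp_apply] at hν
    rw [hν]
  exact ⟨(h ξ φ).1.congr e, by rw [(h ξ φ).2, integral_congr_ae e]⟩

/-- The factor `(2π)⁻¹` of the measure `(dξ)_𝕋`. -/
noncomputable def normConst : ℝ≥0∞ := ENNReal.ofReal (2 * Real.pi)⁻¹

theorem normConst_ne_zero : normConst ≠ 0 := by
  simp [normConst, Real.pi_pos]

theorem normConst_ne_top : normConst ≠ ⊤ := ENNReal.ofReal_ne_top

theorem xNormHat_eq (s b : ℝ) (g : ℤ → ℝ → ℂ) :
    xNormHat s b g = (normConst * wsq s (2 * b) fun ξ τ => ‖g ξ τ‖ₑ) ^ (1 / 2 : ℝ) := by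
  unfold xNormHat sumT wsq normConst
  congr 3; ext ξ
  refine lintegral_congr fun τ => ?_
  have h1 := bracket_pos ξ
  have h2 := bracket_pos (τ - (ξ : ℝ) ^ 3)
  beta_reduce
  rw [ebracket_rpow, ebracket_rpow, ← ofReal_norm, ← ENNReal.ofReal_pow (norm_nonneg _),
    ← ENNReal.ofReal_mul (by positivity), ← ENNReal.ofReal_mul (by positivity), mul_assoc]

theorem l2l1NormHat_eq (s : ℝ) (g : ℤ → ℝ → ℂ) :
    l2l1NormHat s g = (normConst * lsq s fun ξ τ => ‖g ξ τ‖ₑ) ^ (1 / 2 : ℝ) := by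
  unfold l2l1NormHat sumT lsq normConst
  congr 3; ext ξ
  beta_reduce
  rw [← ENNReal.rpow_natCast]
  congr 1
  refine lintegral_congr fun τ => ?_
  have h1 := bracket_pos ξ
  have h2 := bracket_pos (τ - (ξ : ℝ) ^ 3)
  rw [ebracket_rpow, ebracket_rpow, ← ofReal_norm, Real.rpow_neg_one,
    ← ENNReal.ofReal_mul (by positivity), ← ENNReal.ofReal_mul (by positivity), div_eq_mul_inv,
    mul_assoc]

theorem hNorm_eq (s : ℝ) (a : SpaceDist) :
    hNorm s a = (normConst * hsq s fun ξ => ‖a ξ‖ₑ) ^ (1 / 2 : ℝ) := by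
  unfold hNorm sumT hsq normConst
  congr 3; ext ξ
  have h1 := bracket_pos ξ
  beta_reduce
  rw [← ebracket_mul_sq, ebracket_rpow, ← ofReal_norm, ← ENNReal.ofReal_pow (norm_nonneg _),
    ← ENNReal.ofReal_mul (by positivity)]

/-- The Fourier transform of a distribution may be chosen Borel measurable, and to vanish where the
distribution does, without increasing the norm. -/
theorem IsSpaceTimeFourier.exists_measurable {u : SpaceTimeDist} {g : ℤ → ℝ → ℂ}
    (h : IsSpaceTimeFourier u g) (s b : ℝ) :
    ∃ g' : ℤ → ℝ → ℂ, IsSpaceTimeFourier u g' ∧ (∀ ξ, Measurable (g' ξ)) ∧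
      (u 0 = 0 → g' 0 = 0) ∧ xNormHat s b g' ≤ xNormHat s b g := by
  classical
  set g1 : ℤ → ℝ → ℂ := fun ξ => (h.aestronglyMeasurable ξ).mk (g ξ)
  have hae : ∀ ξ, g ξ =ᵐ[volume] g1 ξ := fun ξ => (h.aestronglyMeasurable ξ).ae_eq_mk
  have h1 := h.congr hae
  set g2 : ℤ → ℝ → ℂ := fun ξ => if u ξ = 0 then 0 else g1 ξ with hg2
  refine ⟨g2, fun ξ φ => ?_, fun ξ => ?_, fun h0 => by simp [hg2, h0], ?_⟩
  · by_cases hu : u ξ = 0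
    · simp [hg2, hu]
    · simpa [hg2, hu] using h1 ξ φ
  · by_cases hu : u ξ = 0
    · simp only [hg2, hu, if_true]; exact measurable_zero
    · simpa [hg2, hu] using (h.aestronglyMeasurable ξ).stronglyMeasurable_mk.measurable
  · rw [xNormHat_eq, xNormHat_eq]
    refine ENNReal.rpow_le_rpow ?_ (by norm_num)
    gcongr
    unfold wsq
    refine ENNReal.tsum_le_tsum fun ξ => lintegral_mono_ae ?_
    filter_upwards [hae ξ] with τ hτ
    gcongr
    by_cases hu : u ξ = 0
    · simp [hg2, hu]
    · simp [hg2, hu, hτ]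

/-- Elements of `X_{s,1/2}` have Fourier coefficients whose Fourier transforms grow moderately. -/
theorem exists_lintegral_weight_le :
    ∃ C : ℝ≥0∞, C ≠ ⊤ ∧ ∀ (η : ℤ) (f : ℝ → ℝ≥0∞), Measurable f →
      (∫⁻ τ, ebracket τ ^ (-(2 : ℕ) : ℝ) * f τ) ^ 2 ≤
        C * ebracket η ^ (-1 : ℝ) * ∫⁻ τ, ebracket (τ - (η : ℝ) ^ 3) ^ (1 : ℝ) * f τ ^ 2 := by
  have hI := lintegral_ebracket_rpow_lt_top (p := 3) (by norm_num)
  refine ⟨2 * ∫⁻ x, ebracket x ^ (-3 : ℝ), by finiteness, fun η f hf => ?_⟩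
  have hpt : ∀ τ, ebracket τ ^ (-4 : ℝ) * ebracket (τ - (η : ℝ) ^ 3) ^ (-1 : ℝ) ≤
      2 * ebracket η ^ (-1 : ℝ) * ebracket τ ^ (-3 : ℝ) := fun τ => by
    have hη : bracket η ≤ bracket ((η : ℝ) ^ 3) := by
      refine bracket_le_bracket ?_
      rw [abs_pow]
      rcases eq_or_ne η 0 with h0 | h0
      · simp [h0]
      · have : (1 : ℝ) ≤ |(η : ℝ)| := by
          rw [← Int.cast_abs]; exact_mod_cast Int.one_le_abs h0
        exact le_self_pow₀ this (by norm_num)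
    have hp := bracket_add_le τ (-(τ - (η : ℝ) ^ 3))
    have e1 : bracket (-(τ - (η : ℝ) ^ 3)) = bracket (τ - (η : ℝ) ^ 3) := bracket_neg _
    rw [e1, show τ + -(τ - (η : ℝ) ^ 3) = (η : ℝ) ^ 3 by ring] at hp
    have b1 := bracket_pos τ
    have b2 := bracket_pos η
    have b3 := bracket_pos (τ - (η : ℝ) ^ 3)
    rw [show (2 : ℝ≥0∞) = ENNReal.ofReal 2 by simp]
    simp only [ebracket_rpow]
    rw [← ENNReal.ofReal_mul (by positivity), ← ENNReal.ofReal_mul (by positivity),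
      ← ENNReal.ofReal_mul (by positivity)]
    apply ENNReal.ofReal_le_ofReal
    have e4 : bracket τ ^ (-4 : ℝ) = bracket τ ^ (-3 : ℝ) * (bracket τ)⁻¹ := by
      rw [← Real.rpow_neg_one, ← Real.rpow_add b1]; norm_num
    rw [e4, Real.rpow_neg_one, Real.rpow_neg_one]
    have h3 : 0 < bracket τ ^ (-3 : ℝ) := by positivity
    have key : (bracket τ)⁻¹ * (bracket (τ - (η : ℝ) ^ 3))⁻¹ ≤ 2 * (bracket η)⁻¹ := by
      rw [← mul_inv, inv_le_iff_one_le_mul₀ (by positivity)]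
      have : 1 = bracket η * (bracket η)⁻¹ := by field_simp
      rw [this, mul_comm (2 : ℝ), mul_assoc, mul_comm (bracket η)]
      gcongr
      linarith
    calc _ = bracket τ ^ (-3 : ℝ) * ((bracket τ)⁻¹ * (bracket (τ - (η : ℝ) ^ 3))⁻¹) := by ring
      _ ≤ bracket τ ^ (-3 : ℝ) * (2 * (bracket η)⁻¹) := by gcongr
      _ = _ := by ring
  have hcs := sq_lintegral_le (μ := volume)
    (h := fun τ => ebracket τ ^ (-(2 : ℕ) : ℝ) * f τ)
    (A := fun τ => ebracket τ ^ (-4 : ℝ) * ebracket (τ - (η : ℝ) ^ 3) ^ (-1 : ℝ))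
    (B := fun τ => ebracket (τ - (η : ℝ) ^ 3) ^ (1 : ℝ) * f τ ^ 2)
    (by fun_prop) (by fun_prop) fun τ => le_of_eq (by
      have e := ebracket_rpow_mul_neg (τ - (η : ℝ) ^ 3) 1
      calc _ = ebracket τ ^ (-4 : ℝ) * f τ ^ 2 * 1 := by
            rw [mul_pow, ebracket_rpow_sq]; norm_num
        _ = _ := by rw [← e]; ring)
  refine hcs.trans ?_
  gcongr
  calc _ ≤ _ := lintegral_mono hpt
    _ = _ := by rw [lintegral_const_mul _ (by fun_prop)]; ring

/-- For `s > -1/4` and a fixed output frequency `ξ`, the Sobolev weights of the two factors lose at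
most half a power of the input frequency. -/
theorem ebracket_rpow_mul_bound {s : ℝ} (hs : -1 / 4 < s) (ξ η : ℤ) :
    1 ≤ (2 * ebracket ξ) ^ (1 / 4 : ℝ) * ebracket η ^ (1 / 2 : ℝ) *
      (ebracket (ξ - η : ℤ) ^ s * ebracket η ^ s) := by
  have h1 := one_le_ebracket ξ
  have h2 := one_le_ebracket η
  have h3 := one_le_ebracket (ξ - η : ℤ)
  have hp : ebracket (ξ - η : ℤ) ≤ 2 * ebracket ξ * ebracket η := by
    have h := bracket_add_le ξ (-η)
    have e : bracket (-(η : ℝ)) = bracket η := bracket_neg _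
    rw [e, ← sub_eq_add_neg] at h
    push_cast
    rw [ebracket, ebracket, ebracket, show (2 : ℝ≥0∞) = ENNReal.ofReal 2 by simp,
      ← ENNReal.ofReal_mul (by norm_num),
      ← ENNReal.ofReal_mul (by have := bracket_pos ξ; positivity)]
    exact ENNReal.ofReal_le_ofReal h
  have hs4 : ∀ x : ℝ, ebracket x ^ (-(1 / 4) : ℝ) ≤ ebracket x ^ s := fun x =>
    ENNReal.rpow_le_rpow_of_exponent_le (one_le_ebracket x) (by linarith)
  calc (1 : ℝ≥0∞) = (ebracket (ξ - η : ℤ) ^ (1 / 4 : ℝ) * ebracket (ξ - η : ℤ) ^ (-(1 / 4) : ℝ)) *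
        (ebracket η ^ (1 / 4 : ℝ) * ebracket η ^ (-(1 / 4) : ℝ)) := by
        rw [ebracket_rpow_mul_neg, ebracket_rpow_mul_neg, one_mul]
    _ ≤ ((2 * ebracket ξ * ebracket η) ^ (1 / 4 : ℝ) * ebracket (ξ - η : ℤ) ^ s) *
        (ebracket η ^ (1 / 4 : ℝ) * ebracket η ^ s) := by
        refine mul_le_mul' (mul_le_mul' ?_ (hs4 _)) (mul_le_mul' le_rfl (hs4 _))
        gcongr
    _ = (2 * ebracket ξ) ^ (1 / 4 : ℝ) * (ebracket η ^ (1 / 4 : ℝ) * ebracket η ^ (1 / 4 : ℝ)) *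
        (ebracket (ξ - η : ℤ) ^ s * ebracket η ^ s) := by
        rw [ENNReal.mul_rpow_of_nonneg _ _ (by norm_num)]; ring
    _ = _ := by rw [ebracket_rpow_mul]; norm_num

/-- The convolution sum of the Fourier coefficients of a product converges absolutely when it is
tested against a rapidly decreasing weight. -/
theorem tsum_mul_lintegral_weight_lt_top {s : ℝ} (hs : -1 / 4 < s) {α : ℤ → ℝ≥0∞}
    {f : ℤ → ℝ → ℝ≥0∞} (hf : ∀ η, Measurable (f η)) (hα : hsq s α < ⊤) (hX : wsq s 1 f < ⊤)
    (ξ : ℤ) : ∑' η : ℤ, α (ξ - η) * ∫⁻ τ, ebracket τ ^ (-(2 : ℕ) : ℝ) * f η τ < ⊤ := by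
  obtain ⟨C, hC, h⟩ := exists_lintegral_weight_le
  set I : ℤ → ℝ≥0∞ := fun η => ∫⁻ τ, ebracket τ ^ (-(2 : ℕ) : ℝ) * f η τ
  set D : ℤ → ℝ≥0∞ := fun η => ∫⁻ τ, ebracket (τ - (η : ℝ) ^ 3) ^ (1 : ℝ) * f η τ ^ 2
  set K := (2 * ebracket ξ) ^ (1 / 4 : ℝ)
  have hK : K ≠ ⊤ := ENNReal.rpow_ne_top_of_nonneg (by norm_num)
    (ENNReal.mul_ne_top (by simp) (ebracket_ne_top _))
  have hcs := sq_tsum_le (ι := ℤ) (h := fun η => α (ξ - η) * I η)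
    (A := fun η => (ebracket (ξ - η : ℤ) ^ s * α (ξ - η)) ^ 2)
    (B := fun η => K ^ 2 * C * (ebracket η ^ (2 * s) * D η)) fun η => by
      calc (α (ξ - η) * I η) ^ 2
          = (1 * (α (ξ - η) * I η)) ^ 2 := by rw [one_mul]
        _ ≤ (K * ebracket η ^ (1 / 2 : ℝ) * (ebracket (ξ - η : ℤ) ^ s * ebracket η ^ s) *
            (α (ξ - η) * I η)) ^ 2 := by
            gcongr; exact ebracket_rpow_mul_bound hs ξ η
        _ = (ebracket (ξ - η : ℤ) ^ s * α (ξ - η)) ^ 2 *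
            (K ^ 2 * (ebracket η ^ (2 * s) * ((ebracket η ^ (1 / 2 : ℝ)) ^ 2 * I η ^ 2))) := by
            rw [← ebracket_rpow_sq (η : ℝ) s]; ring
        _ ≤ (ebracket (ξ - η : ℤ) ^ s * α (ξ - η)) ^ 2 *
            (K ^ 2 * (ebracket η ^ (2 * s) * ((ebracket η ^ (1 / 2 : ℝ)) ^ 2 *
              (C * ebracket η ^ (-1 : ℝ) * D η)))) := by
            gcongr; exact h η _ (hf η)
        _ = (ebracket (ξ - η : ℤ) ^ s * α (ξ - η)) ^ 2 *
            (K ^ 2 * C * (ebracket η ^ (2 * s) * D η)) *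
              (ebracket η ^ (1 : ℝ) * ebracket η ^ (-1 : ℝ)) := by
            rw [ebracket_rpow_sq]; norm_num; ring
        _ = _ := by rw [ebracket_rpow_mul_neg, mul_one]
  rw [tsum_sub_left (fun η : ℤ => (ebracket η ^ s * α η) ^ 2), ENNReal.tsum_mul_left] at hcs
  have hlt : (∑' η : ℤ, α (ξ - η) * I η) ^ 2 < ⊤ := by
    refine hcs.trans_lt (ENNReal.mul_lt_top hα (ENNReal.mul_lt_top (by finiteness) ?_))
    rw [wsq_eq_mul s 1 hf] at hX
    exact hX
  exact (ENNReal.pow_lt_top_iff.1 hlt).resolve_right (by norm_num)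

/-! ### Existence of the product -/

theorem summable_of_tsum_enorm_lt_top {f : ℤ → ℂ} (h : ∑' i, ‖f i‖ₑ < ⊤) : Summable f := by
  refine Summable.of_norm ?_
  have := ENNReal.summable_toReal h.ne
  simpa using this

theorem norm_tsum_le_toReal {f : ℤ → ℂ} {M : ℝ≥0∞} (hM : M ≠ ⊤) (h : ∑' i, ‖f i‖ₑ ≤ M) :
    ‖∑' i, f i‖ ≤ M.toReal := by
  have h1 : Summable fun i => ‖f i‖ := by
    simpa using ENNReal.summable_toReal (h.trans_lt hM.lt_top).ne
  have h2 : ‖∑' i, f i‖ ≤ ∑' i, ‖f i‖ := norm_tsum_le_tsum_norm h1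
  refine h2.trans ?_
  have h3 : ∑' i, ‖f i‖ = (∑' i, ‖f i‖ₑ).toReal := by
    rw [ENNReal.tsum_toReal_eq fun i => by simp]; simp
  rw [h3]
  exact ENNReal.toReal_mono hM h

theorem IsSpaceTimeFourier.enorm_fourier_apply_le {u : SpaceTimeDist} {g : ℤ → ℝ → ℂ}
    (h : IsSpaceTimeFourier u g) (η : ℤ) (φ : 𝓢(ℝ, ℂ)) (k : ℕ) :
    ‖(𝓕 (u η)) φ‖ₑ ≤ ENNReal.ofReal ((4 * Real.pi) ^ k * decaySeminorm k φ) *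
      ∫⁻ τ, ebracket τ ^ (-(k : ℝ)) * ‖g η τ‖ₑ := by
  rw [(h η φ).2]
  refine (enorm_integral_le_lintegral_enorm _).trans ?_
  simp only [enorm_mul]
  exact lintegral_schwartz_mul_le φ k fun τ => ‖g η τ‖ₑ

/-- The product of an element of `X_{s,1/2}` with an element of `H^s` exists. -/
theorem hasProd_of_lt_top {s : ℝ} (hs : -1 / 4 < s) {u : SpaceTimeDist} {g : ℤ → ℝ → ℂ}
    (h : IsSpaceTimeFourier u g) (hg : ∀ ξ, Measurable (g ξ)) {a : SpaceDist}
    (ha : hsq s (fun ξ => ‖a ξ‖ₑ) < ⊤) (hX : wsq s 1 (fun ξ τ => ‖g ξ τ‖ₑ) < ⊤) :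
    HasProd u a := by
  intro ξ
  set N : ℤ → ℝ≥0∞ := fun η => ∫⁻ τ, ebracket τ ^ (-(2 : ℕ) : ℝ) * ‖g η τ‖ₑ
  set M := ∑' η : ℤ, ‖a (ξ - η)‖ₑ * N η with hM
  have hMtop : M < ⊤ := tsum_mul_lintegral_weight_lt_top hs (α := fun ξ => ‖a ξ‖ₑ)
    (f := fun ξ τ => ‖g ξ τ‖ₑ) (fun η => (hg η).enorm) ha hX ξ
  have hbound : ∀ φ : 𝓢(ℝ, ℂ), ∑' η : ℤ, ‖a (ξ - η) * (𝓕 (u η)) φ‖ₑ ≤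
      ENNReal.ofReal ((4 * Real.pi) ^ 2 * decaySeminorm 2 φ) * M := fun φ => by
    rw [hM, ← ENNReal.tsum_mul_left]
    refine ENNReal.tsum_le_tsum fun η => ?_
    rw [enorm_mul, mul_left_comm]
    exact mul_le_mul_right (h.enorm_fourier_apply_le η φ 2) _
  have hfin : ∀ φ : 𝓢(ℝ, ℂ),
      ENNReal.ofReal ((4 * Real.pi) ^ 2 * decaySeminorm 2 φ) * M ≠ ⊤ := fun φ =>
    ENNReal.mul_ne_top ENNReal.ofReal_ne_top hMtop.ne
  have hsum : ∀ φ : 𝓢(ℝ, ℂ), Summable fun η : ℤ => a (ξ - η) * (𝓕 (u η)) φ := fun φ =>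
    summable_of_tsum_enorm_lt_top ((hbound φ).trans_lt (hfin φ).lt_top)
  -- the Fourier transform of the sum, as a functional on Schwartz functions
  let S : 𝓢(ℝ, ℂ) →L[ℂ] ℂ := SchwartzMap.mkCLMtoNormedSpace
    (fun φ => ∑' η : ℤ, a (ξ - η) * (𝓕 (u η)) φ)
    (fun φ χ => by
      rw [← (hsum φ).tsum_add (hsum χ)]
      simp only [map_add, mul_add])
    (fun c φ => by
      simp only [map_smul, smul_eq_mul, RingHom.id_apply]
      rw [← tsum_mul_left]
      congr 1; ext η; ring)
    ⟨Finset.Iic (2, 0), (4 * Real.pi) ^ 2 * M.toReal, by positivity, fun φ => by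
      refine (norm_tsum_le_toReal (hfin φ) (hbound φ)).trans (le_of_eq ?_)
      have := apply_nonneg (decaySeminorm 2) φ
      rw [ENNReal.toReal_mul, ENNReal.toReal_ofReal (by positivity)]
      rw [decaySeminorm]
      ring⟩
  have hS : ∀ φ, S φ = ∑' η : ℤ, a (ξ - η) * (𝓕 (u η)) φ := fun φ => rfl
  let L : 𝓢'(ℝ, ℂ) := 𝓕⁻ (ContinuousLinearMap.toPointwiseConvergenceCLM ℂ _ _ _ S : 𝓢'(ℝ, ℂ))
  refine ⟨L, ?_⟩
  rw [HasSum, PointwiseConvergenceCLM.tendsto_iff_forall_tendsto]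
  intro φ
  have hL : L φ = ∑' η : ℤ, a (ξ - η) * (𝓕 (u η)) (𝓕⁻ φ) := hS (𝓕⁻ φ)
  have h1 := (hsum (𝓕⁻ φ)).hasSum
  rw [← hL] at h1
  refine Filter.Tendsto.congr (fun t => ?_) h1
  have e : ∀ η, a (ξ - η) * (𝓕 (u η)) (𝓕⁻ φ) = prodTerm u a ξ η φ := fun η => by
    have : (𝓕 (u η)) (𝓕⁻ φ) = u η φ := by
      rw [TemperedDistribution.fourier_apply, FourierTransform.fourier_fourierInv_eq]
    rw [this]; rfl
  simp only [e]
  exact (map_sum (PointwiseConvergenceCLM.evalCLM (RingHom.id ℂ) ℂ φ) (prodTerm u a ξ) t).symm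

theorem tsum_prodTerm_apply {u : SpaceTimeDist} {a : SpaceDist} (h : HasProd u a) (ξ : ℤ)
    (φ : 𝓢(ℝ, ℂ)) :
    HasSum (fun η => a (ξ - η) * u η φ) ((∑' η : ℤ, prodTerm u a ξ η) φ) :=
  (h ξ).hasSum.mapL (PointwiseConvergenceCLM.evalCLM (RingHom.id ℂ) ℂ φ)

/-! ### The Fourier transform of a cutoff -/

/-- The function `ψ(t / δ)` as a Schwartz function. -/
noncomputable def cutoffSchwartz (ψ : ℝ → ℝ) (hψ : ContDiff ℝ ∞ ψ) (hc : HasCompactSupport ψ)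
    (δ : ℝ) (hδ : 0 < δ) : 𝓢(ℝ, ℂ) :=
  HasCompactSupport.toSchwartzMap (f := fun t : ℝ => ((ψ (t / δ) : ℝ) : ℂ))
    ((hc.comp_homeomorph (Homeomorph.mulRight₀ δ⁻¹ (inv_ne_zero hδ.ne'))).comp_left
      (g := fun x : ℝ => (x : ℂ)) Complex.ofReal_zero)
    (Complex.ofRealCLM.contDiff.comp (hψ.comp (contDiff_id.div_const δ)))

theorem cutoffSchwartz_apply (ψ : ℝ → ℝ) (hψ : ContDiff ℝ ∞ ψ) (hc : HasCompactSupport ψ)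
    (δ : ℝ) (hδ : 0 < δ) (t : ℝ) : cutoffSchwartz ψ hψ hc δ hδ t = ((ψ (t / δ) : ℝ) : ℂ) := rfl

/-- Dilation in time: `𝓕⁻¹(ψ(·/δ))(ν) = δ 𝓕⁻¹ψ(δ ν)`. -/
theorem fourierInv_cutoffSchwartz (ψ : ℝ → ℝ) (hψ : ContDiff ℝ ∞ ψ) (hc : HasCompactSupport ψ)
    (δ : ℝ) (hδ : 0 < δ) (ν : ℝ) :
    (𝓕⁻ (cutoffSchwartz ψ hψ hc δ hδ)) ν =
      (δ : ℂ) * (𝓕⁻ (cutoffSchwartz ψ hψ hc 1 one_pos)) (δ * ν) := by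
  rw [SchwartzMap.fourierInv_coe, SchwartzMap.fourierInv_coe, Real.fourierInv_eq',
    Real.fourierInv_eq']
  simp only [cutoffSchwartz_apply, div_one]
  have h := Measure.integral_comp_div (fun t : ℝ =>
    Complex.exp (((2 * Real.pi * inner ℝ t (δ * ν) : ℝ) : ℂ) * Complex.I) • ((ψ t : ℝ) : ℂ)) δ
  rw [abs_of_pos hδ, Complex.real_smul] at h
  rw [← h]
  congr 1; ext t
  simp only [RCLike.inner_apply, conj_trivial]
  congr 4
  field_simp

/-- The kernel of the convolution, in the variable `τ`, that corresponds to `ψ(t/δ)`. -/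
theorem exists_enorm_fourierInv_cutoff_le (ψ : ℝ → ℝ) (hψ : ContDiff ℝ ∞ ψ)
    (hc : HasCompactSupport ψ) :
    ∃ C : ℝ≥0∞, C ≠ ⊤ ∧ ∀ (δ : ℝ) (hδ : 0 < δ) (ν : ℝ),
      ‖(𝓕⁻ (cutoffSchwartz ψ hψ hc δ hδ)) ν‖ₑ ≤ C * kern δ (2 * Real.pi * ν) := by
  set κ := 𝓕⁻ (cutoffSchwartz ψ hψ hc 1 one_pos)
  refine ⟨ENNReal.ofReal ((4 * Real.pi) ^ 4 * decaySeminorm 4 κ), ENNReal.ofReal_ne_top,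
    fun δ hδ ν => ?_⟩
  rw [fourierInv_cutoffSchwartz, enorm_mul]
  calc _ ≤ ‖(δ : ℂ)‖ₑ * (ENNReal.ofReal ((4 * Real.pi) ^ 4 * decaySeminorm 4 κ) *
        ebracket (2 * Real.pi * (δ * ν)) ^ (-((4 : ℕ) : ℝ))) := by
        gcongr; exact enorm_schwartz_le κ 4 (δ * ν)
    _ = ENNReal.ofReal ((4 * Real.pi) ^ 4 * decaySeminorm 4 κ) *
        (‖(δ : ℂ)‖ₑ * ebracket (2 * Real.pi * (δ * ν)) ^ (-((4 : ℕ) : ℝ))) := by ring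
    _ = _ := by
        congr 1
        have hb := bracket_pos (2 * Real.pi * (δ * ν))
        rw [ebracket_rpow, ← ofReal_norm, Complex.norm_real, Real.norm_of_nonneg hδ.le,
          ← ENNReal.ofReal_mul hδ.le, kern, Real.rpow_neg hb.le, Real.rpow_natCast,
          show 4 = 2 * 2 by norm_num, pow_mul, sq_bracket, ← div_eq_mul_inv]
        congr 5; ring

/-- The kernel is dominated by its convolution with itself: for `|σ| ≤ δ⁻¹` one has
`kern δ σ ≥ δ / 4` and `1 + (δ (x - σ))² ≤ 3 (1 + (δ x)²)`. -/
theorem kern_le_smear (δ : ℝ) (hδ : 0 < δ) (x : ℝ) :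
    kern δ x ≤ 18 * ∫⁻ σ, kern δ (x - σ) * kern δ σ := by
  have hset : ∀ σ ∈ Icc (-δ⁻¹) δ⁻¹,
      ENNReal.ofReal (δ / 36) * kern δ x ≤ kern δ (x - σ) * kern δ σ := fun σ hσ => by
    unfold kern
    rw [← ENNReal.ofReal_mul (by positivity), ← ENNReal.ofReal_mul (by positivity)]
    apply ENNReal.ofReal_le_ofReal
    have h1 : (δ * σ) ^ 2 ≤ 1 := by
      have := abs_le.2 hσ
      rw [← sq_abs, abs_mul, abs_of_pos hδ]
      have h2 : δ * |σ| ≤ 1 := by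
        calc δ * |σ| ≤ δ * δ⁻¹ := by gcongr
          _ = 1 := by field_simp
      have : 0 ≤ δ * |σ| := by positivity
      nlinarith
    have h2 : 1 + (δ * (x - σ)) ^ 2 ≤ 3 * (1 + (δ * x) ^ 2) := by
      nlinarith [sq_nonneg (δ * x + δ * σ)]
    calc δ / 36 * (δ / (1 + (δ * x) ^ 2) ^ 2)
        = δ / (3 * (1 + (δ * x) ^ 2)) ^ 2 * (δ / 2 ^ 2) := by field_simp; norm_num
      _ ≤ _ := by gcongr; linarith
  have h36 : (1 : ℝ≥0∞) = 18 * (ENNReal.ofReal (δ / 36) * volume (Icc (-δ⁻¹) δ⁻¹)) := by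
    rw [Real.volume_Icc, show (18 : ℝ≥0∞) = ENNReal.ofReal 18 by simp,
      ← ENNReal.ofReal_mul (by positivity), ← ENNReal.ofReal_mul (by positivity)]
    rw [show 18 * (δ / 36 * (δ⁻¹ - -δ⁻¹)) = 1 by field_simp; norm_num, ENNReal.ofReal_one]
  calc kern δ x = 18 * (∫⁻ σ in Icc (-δ⁻¹) δ⁻¹, ENNReal.ofReal (δ / 36) * kern δ x) := by
        rw [setLIntegral_const]
        calc kern δ x = 1 * kern δ x := (one_mul _).symm
          _ = _ := by rw [h36]; ring
    _ ≤ 18 * (∫⁻ σ in Icc (-δ⁻¹) δ⁻¹, kern δ (x - σ) * kern δ σ) := by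
        gcongr 18 * ?_
        exact setLIntegral_mono' measurableSet_Icc hset
    _ ≤ _ := by gcongr; exact Measure.restrict_le_self

theorem smear_le_smear_smear (δ : ℝ) (hδ : 0 < δ) {f : ℝ → ℝ≥0∞} (hf : Measurable f) (τ : ℝ) :
    smear δ f τ ≤ 18 * smear δ (smear δ f) τ := by
  have hk := measurable_kern δ
  have h1 : smear δ (smear δ f) τ =
      ∫⁻ τ', (∫⁻ σ, kern δ (τ - τ' - σ) * kern δ σ) * f τ' := by
    simp only [smear]
    calc _ = ∫⁻ x, ∫⁻ τ', kern δ (τ - x) * (kern δ (x - τ') * f τ') := by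
          refine lintegral_congr fun x => ?_
          rw [lintegral_const_mul _ (by fun_prop)]
      _ = ∫⁻ τ', ∫⁻ x, kern δ (τ - x) * (kern δ (x - τ') * f τ') :=
          lintegral_lintegral_swap (by fun_prop)
      _ = _ := by
          refine lintegral_congr fun τ' => ?_
          rw [← lintegral_mul_const _ (by fun_prop), ← lintegral_add_right_eq_self _ τ']
          refine lintegral_congr fun σ => ?_
          rw [add_sub_cancel_right, mul_assoc]
          congr 2; ring
  rw [h1, smear, ← lintegral_const_mul _ (by fun_prop)]
  refine lintegral_mono fun τ' => ?_
  rw [← mul_assoc]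
  exact mul_le_mul_left (kern_le_smear δ hδ _) _

/-- Moving the product with `χ` to the test function makes it a convolution with `𝓕⁻ χ`. -/
theorem cutoff_fourier_apply (χ : 𝓢(ℝ, ℂ)) (T : 𝓢'(ℝ, ℂ)) (φ : 𝓢(ℝ, ℂ)) :
    (𝓕 (TemperedDistribution.smulLeftCLM ℂ χ T)) φ =
      (𝓕 T) (SchwartzMap.convolution (ContinuousLinearMap.mul ℂ ℂ) φ (𝓕⁻ χ)) := by
  rw [TemperedDistribution.fourier_apply, TemperedDistribution.smulLeftCLM_apply_apply,
    TemperedDistribution.fourier_apply, SchwartzMap.fourier_convolution]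
  congr 1
  ext t
  rw [SchwartzMap.smulLeftCLM_apply_apply χ.hasTemperateGrowth, SchwartzMap.pairing_apply_apply,
    FourierTransform.fourier_fourierInv_eq, ContinuousLinearMap.mul_apply', smul_eq_mul, mul_comm]

/-- Multiplication by a Schwartz function is convolution on the Fourier side.  The last hypothesis
is absolute convergence of the double integral, as required for Fubini's theorem. -/
theorem fourier_smulLeftCLM_apply {χ : 𝓢(ℝ, ℂ)} {T : 𝓢'(ℝ, ℂ)} {h : ℝ → ℂ}
    (hm : Measurable h) (hT : ∀ φ, (𝓕 T) φ = ∫ ν, φ ν * h ν) (φ : 𝓢(ℝ, ℂ))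
    (hfin : ∫⁻ ν, ‖φ ν‖ₑ * ∫⁻ ν', ‖(𝓕⁻ χ) (ν' - ν)‖ₑ * ‖h ν'‖ₑ < ⊤) :
    (𝓕 (TemperedDistribution.smulLeftCLM ℂ χ T)) φ =
      ∫ ν, φ ν * ∫ ν', (𝓕⁻ χ) (ν' - ν) * h ν' := by
  have hκ := (𝓕⁻ χ).continuous
  have hφ := φ.continuous
  have hmeas : Measurable fun p : ℝ × ℝ => φ p.1 * ((𝓕⁻ χ) (p.2 - p.1) * h p.2) := by
    have h1 : Measurable fun p : ℝ × ℝ => (𝓕⁻ χ) (p.2 - p.1) := by fun_prop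
    have h2 : Measurable fun p : ℝ × ℝ => φ p.1 := by fun_prop
    have h3 : Measurable fun p : ℝ × ℝ => h p.2 := by fun_prop
    exact h2.mul (h1.mul h3)
  have hint : Integrable (fun p : ℝ × ℝ => φ p.1 * ((𝓕⁻ χ) (p.2 - p.1) * h p.2))
      (volume.prod volume) := by
    refine ⟨hmeas.aestronglyMeasurable, ?_⟩
    rw [HasFiniteIntegral, lintegral_prod _ hmeas.enorm.aemeasurable]
    refine lt_of_eq_of_lt (lintegral_congr fun ν => ?_) hfin
    rw [← lintegral_const_mul']
    · simp only [enorm_mul]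
    · exact enorm_ne_top
  rw [cutoff_fourier_apply, hT]
  calc _ = ∫ ν', ∫ ν, φ ν * ((𝓕⁻ χ) (ν' - ν) * h ν') := by
        congr 1; ext ν'
        rw [SchwartzMap.convolution_apply, convolution_def, ← integral_mul_const]
        simp only [ContinuousLinearMap.mul_apply', mul_assoc]
    _ = ∫ ν, ∫ ν', φ ν * ((𝓕⁻ χ) (ν' - ν) * h ν') := (integral_integral_swap hint).symm
    _ = _ := by simp only [integral_const_mul]

theorem smear_fullProd (δ : ℝ) (α : ℤ → ℝ≥0∞) {w : ℤ → ℝ → ℝ≥0∞} (hw : ∀ η, Measurable (w η))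
    (ξ : ℤ) (τ : ℝ) :
    smear δ (fullProd α w ξ) τ =
      ENNReal.ofReal |(ξ : ℝ)| * ∑' η : ℤ, α (ξ - η) * smear δ (w η) τ := by
  have hk := measurable_kern δ
  have h1 : ∀ η : ℤ, Measurable fun τ' => α (ξ - η) * (kern δ (τ - τ') * w η τ') := fun η => by
    have := hw η; fun_prop
  simp only [smear, fullProd]
  calc _ = ∫⁻ τ', ENNReal.ofReal |(ξ : ℝ)| *
        ∑' η : ℤ, α (ξ - η) * (kern δ (τ - τ') * w η τ') := by
        refine lintegral_congr fun τ' => ?_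
        rw [mul_left_comm, ← ENNReal.tsum_mul_left]
        congr 2; ext η; ring
    _ = _ := by
        rw [lintegral_const_mul' _ _ ENNReal.ofReal_ne_top,
          lintegral_tsum fun η => (h1 η).aemeasurable]
        congr 2; ext η
        have := hw η
        rw [lintegral_const_mul _ (by fun_prop)]

theorem integrable_tsum {f : ℤ → ℝ → ℂ} (hf : ∀ i, AEStronglyMeasurable (f i))
    (h : ∑' i, ∫⁻ x, ‖f i x‖ₑ ≠ ⊤) : Integrable fun x => ∑' i, f i x := by
  rw [← lintegral_tsum fun i => (hf i).enorm] at h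
  have hae := ae_lt_top' (AEMeasurable.tsum fun i => (hf i).enorm) h
  refine ⟨aestronglyMeasurable_of_tendsto_ae Filter.atTop
    (f := fun (t : Finset ℤ) x => ∑ i ∈ t, f i x) (fun t => ?_) ?_, ?_⟩
  · exact Finset.aestronglyMeasurable_fun_sum t fun i _ => hf i
  · filter_upwards [hae] with x hx using (summable_of_tsum_enorm_lt_top hx).hasSum
  · exact (lintegral_mono fun x => enorm_tsum_le_tsum_enorm).trans_lt h.lt_top

/-- The space-time Fourier transform of `χ(t) ∂ₓ(u a)`, where `g` is that of `u`. -/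
noncomputable def cutoffProdHat (χ : 𝓢(ℝ, ℂ)) (a : SpaceDist) (g : ℤ → ℝ → ℂ) (ξ : ℤ) (τ : ℝ) :
    ℂ :=
  Complex.I * (ξ : ℂ) * ((((2 * Real.pi)⁻¹ : ℝ) : ℂ) *
    ∑' η : ℤ, a (ξ - η) * ∫ ν : ℝ, (𝓕⁻ χ) (ν - τ / (2 * Real.pi)) * g η (2 * Real.pi * ν))

theorem lintegral_kern_mul_le {χ : 𝓢(ℝ, ℂ)} {δ : ℝ} {C : ℝ≥0∞}
    (hχ : ∀ ν, ‖(𝓕⁻ χ) ν‖ₑ ≤ C * kern δ (2 * Real.pi * ν)) (hδ : 0 < δ)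
    {f : ℝ → ℂ} (hf : Measurable f) (τ : ℝ) :
    ∫⁻ ν : ℝ, ‖(𝓕⁻ χ) (ν - τ / (2 * Real.pi))‖ₑ * ‖f (2 * Real.pi * ν)‖ₑ ≤
      C * 18 * smear δ (smear δ fun τ => ‖f τ‖ₑ) τ := by
  have hk := measurable_kern δ
  have hpi := Real.two_pi_pos
  calc _ ≤ ∫⁻ ν : ℝ, C * (kern δ (τ - 2 * Real.pi * ν) * ‖f (2 * Real.pi * ν)‖ₑ) := by
        refine lintegral_mono fun ν => ?_
        rw [← mul_assoc]
        refine mul_le_mul_left ((hχ _).trans_eq ?_) _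
        rw [kern_sub_comm]
        congr 2
        field_simp
    _ = C * (ENNReal.ofReal (2 * Real.pi)⁻¹ * smear δ (fun τ => ‖f τ‖ₑ) τ) := by
        rw [lintegral_const_mul _ (by fun_prop),
          lintegral_comp_two_pi fun σ => kern δ (τ - σ) * ‖f σ‖ₑ]
        rfl
    _ ≤ C * (1 * (18 * smear δ (smear δ fun τ => ‖f τ‖ₑ) τ)) := by
        gcongr
        · rw [ENNReal.ofReal_le_one]
          exact inv_le_one_of_one_le₀ one_le_two_pi
        · exact smear_le_smear_smear δ hδ hf.enorm τ
    _ = _ := by ring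

/-- The Fourier transform contains a single smearing and the majorant two; this is harmless, as
`kern δ` is dominated by its convolution with itself. -/
theorem enorm_cutoffProdHat_le {χ : 𝓢(ℝ, ℂ)} {δ : ℝ} {C : ℝ≥0∞}
    (hχ : ∀ ν, ‖(𝓕⁻ χ) ν‖ₑ ≤ C * kern δ (2 * Real.pi * ν)) (hδ : 0 < δ) (a : SpaceDist)
    {g : ℤ → ℝ → ℂ} (hg : ∀ η, Measurable (g η)) (ξ : ℤ) (τ : ℝ) :
    ‖cutoffProdHat χ a g ξ τ‖ₑ ≤
      C * 18 * majorant δ (fun η => ‖a η‖ₑ) (fun η τ => ‖g η τ‖ₑ) ξ τ := by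
  rw [majorant, smear_fullProd δ _ (fun η => measurable_smear δ (hg η).enorm), cutoffProdHat,
    enorm_mul, enorm_mul, enorm_mul]
  have h1 : ‖Complex.I‖ₑ = 1 := by simp [← ofReal_norm]
  have h2 : ‖(ξ : ℂ)‖ₑ = ENNReal.ofReal |(ξ : ℝ)| := by
    rw [← ofReal_norm, Complex.norm_intCast]
  have h3 : ‖(((2 * Real.pi)⁻¹ : ℝ) : ℂ)‖ₑ ≤ 1 := by
    rw [← ofReal_norm, Complex.norm_real, Real.norm_of_nonneg (by positivity),
      ENNReal.ofReal_le_one]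
    exact inv_le_one_of_one_le₀ one_le_two_pi
  rw [h1, h2, one_mul]
  calc _ ≤ ENNReal.ofReal |(ξ : ℝ)| * (1 * ∑' η : ℤ, ‖a (ξ - η)‖ₑ *
        (C * 18 * smear δ (smear δ fun τ => ‖g η τ‖ₑ) τ)) := by
        refine mul_le_mul_right (mul_le_mul' h3 ((enorm_tsum_le_tsum_enorm).trans ?_)) _
        refine ENNReal.tsum_le_tsum fun η => ?_
        rw [enorm_mul]
        refine mul_le_mul_right ((enorm_integral_le_lintegral_enorm _).trans ?_) _
        simp only [enorm_mul]
        exact lintegral_kern_mul_le hχ hδ (hg η) τ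
    _ = _ := by
        rw [one_mul, mul_left_comm (C * 18), ← ENNReal.tsum_mul_left (a := C * 18)]
        congr 2; ext η; rw [mul_left_comm]

/-- The `L²L¹` part of the norm of `Z^s` makes pairings with Schwartz functions absolutely
convergent. -/
theorem lintegral_schwartz_mul_lt_top {s : ℝ} {F : ℤ → ℝ → ℝ≥0∞} (hF : lsq s F < ⊤) (ξ : ℤ)
    (φ : 𝓢(ℝ, ℂ)) : ∫⁻ ν, ‖φ ν‖ₑ * F ξ (2 * Real.pi * ν) < ⊤ := by
  refine (lintegral_schwartz_mul_le φ 1 (F ξ)).trans_lt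
    (ENNReal.mul_lt_top ENNReal.ofReal_lt_top ?_)
  have h1 := (ENNReal.le_tsum ξ).trans_lt hF
  have h2 := (ENNReal.pow_lt_top_iff.1 h1).resolve_right (by norm_num)
  rw [lintegral_const_mul' _ _ (ebracket_rpow_ne_top _ _)] at h2
  have h3 : ∫⁻ τ, ebracket (τ - (ξ : ℝ) ^ 3) ^ (-1 : ℝ) * F ξ τ < ⊤ :=
    ENNReal.lt_top_of_mul_ne_top_right h2.ne (by simp [ebracket_ne_zero, ebracket_ne_top])
  have hpt : ∀ τ, ebracket τ ^ (-((1 : ℕ) : ℝ)) ≤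
      2 * ebracket ((ξ : ℝ) ^ 3) * ebracket (τ - (ξ : ℝ) ^ 3) ^ (-1 : ℝ) := fun τ => by
    have hp := bracket_add_le τ (-(ξ : ℝ) ^ 3)
    have e1 : bracket (-(ξ : ℝ) ^ 3) = bracket ((ξ : ℝ) ^ 3) := bracket_neg _
    rw [e1, ← sub_eq_add_neg] at hp
    have b1 := bracket_pos τ
    have b2 := bracket_pos ((ξ : ℝ) ^ 3)
    have b3 := bracket_pos (τ - (ξ : ℝ) ^ 3)
    rw [show (2 : ℝ≥0∞) = ENNReal.ofReal 2 by simp, ebracket_rpow, ebracket_rpow, ebracket,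
      ← ENNReal.ofReal_mul (by positivity), ← ENNReal.ofReal_mul (by positivity)]
    apply ENNReal.ofReal_le_ofReal
    rw [Nat.cast_one, Real.rpow_neg_one, Real.rpow_neg_one, ← div_eq_mul_inv,
      inv_le_iff_one_le_mul₀ b1, div_mul_eq_mul_div, one_le_div b3]
    linarith
  calc _ ≤ ∫⁻ τ, 2 * ebracket ((ξ : ℝ) ^ 3) *
        (ebracket (τ - (ξ : ℝ) ^ 3) ^ (-1 : ℝ) * F ξ τ) := by
        refine lintegral_mono fun τ => ?_
        rw [← mul_assoc]
        exact mul_le_mul_left (hpt τ) _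
    _ = 2 * ebracket ((ξ : ℝ) ^ 3) *
        ∫⁻ τ, ebracket (τ - (ξ : ℝ) ^ 3) ^ (-1 : ℝ) * F ξ τ :=
        lintegral_const_mul' _ _ (ENNReal.mul_ne_top (by simp) (ebracket_ne_top _))
    _ < ⊤ := ENNReal.mul_lt_top (ENNReal.mul_lt_top (by simp) (ebracket_ne_top _).lt_top) h3

/-- The Fourier transform of the cut off derivative of a product, provided that the majorant has
finite norm. -/
theorem isSpaceTimeFourier_cutoffProdHat {s : ℝ} {χ : 𝓢(ℝ, ℂ)} {δ : ℝ} {C : ℝ≥0∞} (hC : C ≠ ⊤)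
    (hχ : ∀ ν, ‖(𝓕⁻ χ) ν‖ₑ ≤ C * kern δ (2 * Real.pi * ν)) (hδ : 0 < δ)
    {u : SpaceTimeDist} {a : SpaceDist} {g : ℤ → ℝ → ℂ} (h : IsSpaceTimeFourier u g)
    (hg : ∀ η, Measurable (g η)) (hp : HasProd u a)
    (hM : lsq s (majorant δ (fun η => ‖a η‖ₑ) fun η τ => ‖g η τ‖ₑ) < ⊤) :
    IsSpaceTimeFourier (fun ξ => TemperedDistribution.smulLeftCLM ℂ χ (dx (prod u a) ξ))
      (cutoffProdHat χ a g) := by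
  have hpi := Real.two_pi_pos
  intro ξ φ
  rcases eq_or_ne ξ 0 with rfl | hξ
  · have : dx (prod u a) 0 = 0 := by
      simp only [dx, Int.cast_zero, mul_zero]
      exact zero_smul ℂ (prod u a 0)
    simp [cutoffProdHat, this]
  set κ := 𝓕⁻ χ
  have hκc := κ.continuous
  set k : ℤ → ℝ → ℂ := fun η ν => ∫ ν' : ℝ, κ (ν' - ν) * g η (2 * Real.pi * ν')
  set N : ℤ → ℝ → ℝ≥0∞ :=
    fun η ν => ∫⁻ ν' : ℝ, ‖κ (ν' - ν)‖ₑ * ‖g η (2 * Real.pi * ν')‖ₑ with hN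
  have hNk : ∀ η ν, ‖k η ν‖ₑ ≤ N η ν := fun η ν => by
    refine (enorm_integral_le_lintegral_enorm _).trans_eq ?_
    simp only [enorm_mul]; rfl
  have hNm : ∀ η, Measurable (N η) := fun η => by
    have := hg η
    refine Measurable.lintegral_prod_right'
      (f := fun p : ℝ × ℝ => ‖κ (p.2 - p.1)‖ₑ * ‖g η (2 * Real.pi * p.2)‖ₑ) ?_
    have h1 : Measurable fun p : ℝ × ℝ => κ (p.2 - p.1) := by fun_prop
    have h2 : Measurable fun p : ℝ × ℝ => g η (2 * Real.pi * p.2) := by fun_prop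
    exact h1.enorm.mul h2.enorm
  have hkm : ∀ η, AEStronglyMeasurable (k η) := fun η => by
    have := hg η
    refine AEStronglyMeasurable.integral_prod_right'
      (f := fun p : ℝ × ℝ => κ (p.2 - p.1) * g η (2 * Real.pi * p.2)) ?_
    have h1 : Measurable fun p : ℝ × ℝ => κ (p.2 - p.1) := by fun_prop
    have h2 : Measurable fun p : ℝ × ℝ => g η (2 * Real.pi * p.2) := by fun_prop
    exact (h1.mul h2).aestronglyMeasurable
  have hφ := φ.continuous
  -- since `|ξ| ≥ 1`, the majorant controls the series and the integrals absolutely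
  have habs : ∑' η : ℤ, ‖a (ξ - η)‖ₑ * ∫⁻ ν, ‖φ ν‖ₑ * N η ν < ⊤ := by
    calc _ = ∫⁻ ν, ‖φ ν‖ₑ * ∑' η : ℤ, ‖a (ξ - η)‖ₑ * N η ν := by
          have e : ∀ η : ℤ, ‖a (ξ - η)‖ₑ * ∫⁻ ν, ‖φ ν‖ₑ * N η ν =
              ∫⁻ ν, ‖φ ν‖ₑ * (‖a (ξ - η)‖ₑ * N η ν) := fun η => by
            rw [← lintegral_const_mul' _ _ enorm_ne_top]
            refine lintegral_congr fun ν => ?_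
            ring
          simp only [e]
          rw [← lintegral_tsum fun η => by
            have := hNm η; fun_prop]
          simp only [ENNReal.tsum_mul_left]
      _ ≤ ∫⁻ ν, C * 18 * (‖φ ν‖ₑ *
          majorant δ (fun η => ‖a η‖ₑ) (fun η τ => ‖g η τ‖ₑ) ξ (2 * Real.pi * ν)) := by
          refine lintegral_mono fun ν => ?_
          rw [mul_left_comm]
          refine mul_le_mul_right ?_ _
          rw [majorant, smear_fullProd δ _ (fun η => measurable_smear δ (hg η).enorm),
            mul_left_comm, ← ENNReal.tsum_mul_left (a := C * 18)]
          have h1 : 1 ≤ ENNReal.ofReal |(ξ : ℝ)| := by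
            rw [ENNReal.one_le_ofReal, ← Int.cast_abs]
            exact_mod_cast Int.one_le_abs hξ
          refine le_trans ?_ (le_mul_of_one_le_left zero_le h1)
          refine ENNReal.tsum_le_tsum fun η => ?_
          rw [mul_left_comm (C * 18)]
          refine mul_le_mul_right ?_ _
          have := lintegral_kern_mul_le hχ hδ (hg η) (2 * Real.pi * ν)
          rwa [mul_div_cancel_left₀ _ hpi.ne'] at this
      _ < ⊤ := by
          rw [lintegral_const_mul' _ _ (by finiteness)]
          exact ENNReal.mul_lt_top (by finiteness) (lintegral_schwartz_mul_lt_top hM ξ φ)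
  have hterm : ∀ η : ℤ, a (ξ - η) *
      (𝓕 (TemperedDistribution.smulLeftCLM ℂ χ (u η))) φ =
      ∫ ν, a (ξ - η) * (φ ν * k η ν) := fun η => by
    by_cases ha : a (ξ - η) = 0
    · simp [ha]
    rw [integral_const_mul]
    congr 1
    have hgη := hg η
    refine fourier_smulLeftCLM_apply (h := fun ν => g η (2 * Real.pi * ν)) (by fun_prop)
      (fun φ => (h η φ).2) φ ?_
    exact ENNReal.lt_top_of_mul_ne_top_right ((ENNReal.le_tsum η).trans_lt habs).ne
      (by simpa using ha)
  have hmeas : ∀ η : ℤ, AEStronglyMeasurable fun ν => a (ξ - η) * (φ ν * k η ν) := fun η =>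
    aestronglyMeasurable_const.mul (hφ.aestronglyMeasurable.mul (hkm η))
  have hfin : ∑' η : ℤ, ∫⁻ ν, ‖a (ξ - η) * (φ ν * k η ν)‖ₑ ≠ ⊤ := by
    refine (lt_of_le_of_lt (ENNReal.tsum_le_tsum fun η => ?_) habs).ne
    rw [← lintegral_const_mul' _ _ enorm_ne_top]
    refine lintegral_mono fun ν => ?_
    rw [enorm_mul, enorm_mul]
    gcongr
    exact hNk η ν
  have hG : (fun ν => φ ν * cutoffProdHat χ a g ξ (2 * Real.pi * ν)) = fun ν =>
      Complex.I * (ξ : ℂ) * (((2 * Real.pi)⁻¹ : ℝ) : ℂ) *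
        ∑' η : ℤ, a (ξ - η) * (φ ν * k η ν) := by
    ext ν
    have e : ∀ η : ℤ, a (ξ - η) * (φ ν * k η ν) = φ ν * (a (ξ - η) * k η ν) := fun η => by ring
    simp only [e]
    rw [tsum_mul_left, cutoffProdHat, mul_div_cancel_left₀ _ hpi.ne']
    ring
  refine ⟨?_, ?_⟩
  · rw [hG]; exact (integrable_tsum hmeas hfin).const_mul _
  rw [hG, integral_const_mul, integral_tsum hmeas hfin]
  have hs := tsum_prodTerm_apply hp ξ (SchwartzMap.smulLeftCLM ℂ χ (𝓕 φ))
  have e2 : (𝓕 (TemperedDistribution.smulLeftCLM ℂ χ (dx (prod u a) ξ))) φ =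
      Complex.I * (ξ : ℂ) * ((((2 * Real.pi)⁻¹ : ℝ) : ℂ) *
        (∑' η : ℤ, prodTerm u a ξ η) (SchwartzMap.smulLeftCLM ℂ χ (𝓕 φ))) := rfl
  rw [e2, ← hs.tsum_eq, ← mul_assoc]
  congr 2; ext η
  rw [← hterm]
  rfl

/-! ### The estimate for distributions with zero mean -/

theorem le_mul_biInf {ι : Type*} {P : ι → Prop} {f : ι → ℝ≥0∞} {B c : ℝ≥0∞} (hB : B ≠ ⊤)
    (hf : ⨅ (i) (_ : P i), f i < ⊤) (h : ∀ i, P i → f i < ⊤ → c ≤ B * f i) :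
    c ≤ B * ⨅ (i) (_ : P i), f i := by
  set x := ⨅ (i) (_ : P i), f i
  have hne : (nhdsWithin x (Ioi x)).NeBot := nhdsGT_neBot_of_exists_gt ⟨⊤, hf⟩
  have ht : Filter.Tendsto (fun r => B * r) (nhdsWithin x (Ioi x)) (nhds (B * x)) :=
    (ENNReal.Tendsto.const_mul Filter.tendsto_id (Or.inr hB)).mono_left nhdsWithin_le_nhds
  refine ge_of_tendsto ht ?_
  filter_upwards [self_mem_nhdsWithin] with r hr
  obtain ⟨i, hi⟩ := iInf_lt_iff.1 (show x < r from hr)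
  obtain ⟨hP, hi⟩ := iInf_lt_iff.1 hi
  exact (h i hP (hi.trans_le le_top)).trans (mul_le_mul_right hi.le _)

theorem wsq_le_mul {s b : ℝ} {f m : ℤ → ℝ → ℝ≥0∞} {K : ℝ≥0∞} (hK : K ≠ ⊤)
    (h : ∀ ξ τ, f ξ τ ≤ K * m ξ τ) : wsq s b f ≤ K ^ 2 * wsq s b m := by
  unfold wsq
  rw [← ENNReal.tsum_mul_left]
  refine ENNReal.tsum_le_tsum fun ξ => ?_
  rw [← lintegral_const_mul' _ _ (by finiteness)]
  refine lintegral_mono fun τ => ?_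
  calc _ ≤ ebracket ξ ^ (2 * s) * (ebracket (τ - (ξ : ℝ) ^ 3) ^ b * (K * m ξ τ) ^ 2) := by
        gcongr; exact h ξ τ
    _ = _ := by ring

theorem lsq_le_mul {s : ℝ} {f m : ℤ → ℝ → ℝ≥0∞} {K : ℝ≥0∞} (hK : K ≠ ⊤)
    (h : ∀ ξ τ, f ξ τ ≤ K * m ξ τ) : lsq s f ≤ K ^ 2 * lsq s m := by
  unfold lsq
  rw [← ENNReal.tsum_mul_left]
  refine ENNReal.tsum_le_tsum fun ξ => ?_
  rw [← mul_pow, ← lintegral_const_mul' _ _ hK]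
  refine pow_le_pow_left' (lintegral_mono fun τ => ?_) 2
  calc _ ≤ ebracket ξ ^ s * (ebracket (τ - (ξ : ℝ) ^ 3) ^ (-1 : ℝ) * (K * m ξ τ)) := by
        gcongr; exact h ξ τ
    _ = _ := by ring

theorem hsq_lt_top {s : ℝ} {a : SpaceDist} (ha : hNorm s a < ⊤) :
    hsq s (fun ξ => ‖a ξ‖ₑ) < ⊤ := by
  rw [hNorm_eq, ENNReal.rpow_lt_top_iff_of_pos (by norm_num)] at ha
  exact ENNReal.lt_top_of_mul_ne_top_right ha.ne normConst_ne_zero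

theorem wsq_one_lt_top {s : ℝ} {g : ℤ → ℝ → ℂ} (hg : xNormHat s (1 / 2) g < ⊤) :
    wsq s 1 (fun ξ τ => ‖g ξ τ‖ₑ) < ⊤ := by
  rw [xNormHat_eq, ENNReal.rpow_lt_top_iff_of_pos (by norm_num),
    mul_one_div_cancel (by norm_num : (2 : ℝ) ≠ 0)] at hg
  exact ENNReal.lt_top_of_mul_ne_top_right hg.ne normConst_ne_zero

theorem hasProd_of_xNorm_lt_top {s : ℝ} (hs : -1 / 4 < s) {u : SpaceTimeDist} {a : SpaceDist}
    (ha : hNorm s a < ⊤) (hu : xNorm s (1 / 2) u < ⊤) : HasProd u a := by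
  obtain ⟨g, hg⟩ := iInf_lt_iff.1 hu
  obtain ⟨h, hg⟩ := iInf_lt_iff.1 hg
  obtain ⟨g', h', hm, -, hle⟩ := h.exists_measurable s (1 / 2)
  exact hasProd_of_lt_top hs h' hm (hsq_lt_top ha) (wsq_one_lt_top (hle.trans_lt hg))

/-- The bilinear estimate for distributions with zero `x`-mean.  The parameter `θ` of
`exists_majorant_le` is chosen such that its loss `δ^{-4θ}` is at most `δ^{-ε}`. -/
theorem exists_zNorm_le {s : ℝ} (hs : -1 / 4 < s) (ψ : ℝ → ℝ) (hψ : ContDiff ℝ ∞ ψ)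
    (hψc : HasCompactSupport ψ) {ε : ℝ} (hε : 0 < ε) :
    ∃ C : ℝ≥0, ∀ δ : ℝ, 0 < δ → δ ≤ 1 → ∀ a : SpaceDist, hNorm s a < ⊤ → a 0 = 0 →
      ∀ u : SpaceTimeDist, xNorm s (1 / 2) u < ⊤ → u 0 = 0 →
        zNorm s (cutoff ψ δ (dx (prod u a))) ≤
          C * ENNReal.ofReal (δ ^ (1 / 3 - ε)) * hNorm s a * xNorm s (1 / 2) u := by
  set θ := min (ε / 4) (1 / 12)
  have hθ0 : 0 < θ := lt_min (by linarith) (by norm_num)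
  have hθε : 4 * θ ≤ ε := by have := min_le_left (ε / 4) (1 / 12); linarith
  obtain ⟨C₁, hC₁, hest⟩ := exists_majorant_le hs hθ0 (min_le_right _ _)
  obtain ⟨C₂, hC₂, hker⟩ := exists_enorm_fourierInv_cutoff_le ψ hψ hψc
  set K := C₂ * 18
  have hK : K ≠ ⊤ := by finiteness
  set A := (normConst⁻¹ * (K ^ 2 * C₁)) ^ (1 / 2 : ℝ)
  have hAtop : A ≠ ⊤ := ENNReal.rpow_ne_top_of_nonneg (by norm_num)
    (ENNReal.mul_ne_top (ENNReal.inv_ne_top.2 normConst_ne_zero) (by finiteness))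
  refine ⟨(2 * A).toNNReal, fun δ hδ hδ1 a ha ha0 u hu hu0 => ?_⟩
  rw [ENNReal.coe_toNNReal (by finiteness)]
  refine le_mul_biInf (by finiteness) hu fun g h hg => ?_
  obtain ⟨g', h', hm, hg0, hle⟩ := h.exists_measurable s (1 / 2)
  have hX := wsq_one_lt_top (hle.trans_lt hg)
  have hH := hsq_lt_top ha
  obtain ⟨hw, hl⟩ := hest δ hδ hδ1 (fun η => ‖a η‖ₑ) (fun η τ => ‖g' η τ‖ₑ) (by simp [ha0])
    (by ext τ; simp [hg0 hu0]) fun η => (hm η).enorm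
  set X := wsq s 1 fun η τ => ‖g' η τ‖ₑ
  set H := hsq s fun η => ‖a η‖ₑ
  set D := ENNReal.ofReal δ ^ (2 * (1 / 3 - 4 * θ)) with hD
  have hδ0 : ENNReal.ofReal δ ≠ 0 := by simpa using hδ
  have hDtop : D ≠ ⊤ := ENNReal.rpow_ne_top_of_ne_zero hδ0 ENNReal.ofReal_ne_top
  have hlt : C₁ * D * (H * X) < ⊤ := by finiteness
  set χ := cutoffSchwartz ψ hψ hψc δ hδ
  have hF := isSpaceTimeFourier_cutoffProdHat hC₂ (hker δ hδ) hδ h' hm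
    (hasProd_of_lt_top hs h' hm hH hX) (hl.trans_lt hlt)
  have hG := enorm_cutoffProdHat_le (hker δ hδ) hδ a hm
  have hsqrt : (normConst * (K ^ 2 * (C₁ * D * (H * X)))) ^ (1 / 2 : ℝ) ≤
      A * ENNReal.ofReal (δ ^ (1 / 3 - ε)) * hNorm s a * xNormHat s (1 / 2) g' := by
    have e : normConst * (K ^ 2 * (C₁ * D * (H * X))) =
        normConst⁻¹ * (K ^ 2 * C₁) * D * (normConst * H) * (normConst * X) := by
      calc _ = 1 * normConst * (K ^ 2 * (C₁ * D * (H * X))) := by rw [one_mul]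
        _ = _ := by
          rw [← ENNReal.inv_mul_cancel normConst_ne_zero normConst_ne_top]; ring
    rw [e, ENNReal.mul_rpow_of_nonneg _ _ (by norm_num),
      ENNReal.mul_rpow_of_nonneg _ _ (by norm_num), ENNReal.mul_rpow_of_nonneg _ _ (by norm_num),
      hNorm_eq, xNormHat_eq, mul_one_div_cancel (by norm_num : (2 : ℝ) ≠ 0)]
    refine mul_le_mul_left (mul_le_mul_left (mul_le_mul_right ?_ _) _) _
    rw [hD, ← ENNReal.rpow_mul, ← ENNReal.ofReal_rpow_of_pos hδ]
    refine ENNReal.rpow_le_rpow_of_exponent_ge (ENNReal.ofReal_le_one.2 hδ1) ?_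
    linarith
  calc zNorm s (cutoff ψ δ (dx (prod u a)))
      ≤ xNormHat s (-1 / 2) (cutoffProdHat χ a g') + l2l1NormHat s (cutoffProdHat χ a g') :=
        iInf₂_le _ hF
    _ ≤ (normConst * (K ^ 2 * (C₁ * D * (H * X)))) ^ (1 / 2 : ℝ) +
        (normConst * (K ^ 2 * (C₁ * D * (H * X)))) ^ (1 / 2 : ℝ) := by
        rw [xNormHat_eq, l2l1NormHat_eq, show 2 * (-1 / 2 : ℝ) = -1 by norm_num]
        refine add_le_add (ENNReal.rpow_le_rpow (mul_le_mul_right ?_ _) (by norm_num))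
          (ENNReal.rpow_le_rpow (mul_le_mul_right ?_ _) (by norm_num))
        · exact (wsq_le_mul hK hG).trans (mul_le_mul_right hw _)
        · exact (lsq_le_mul hK hG).trans (mul_le_mul_right hl _)
    _ ≤ 2 * (A * ENNReal.ofReal (δ ^ (1 / 3 - ε)) * hNorm s a * xNormHat s (1 / 2) g) := by
        rw [← two_mul]
        refine mul_le_mul_right (hsqrt.trans (mul_le_mul_right hle _)) _
    _ = _ := by ring

/-! ### Dependence on the restriction only -/

theorem lintegral_enorm_sq_schwartz (φ : 𝓢(ℝ, ℂ)) :
    ∫⁻ t, ‖φ t‖ₑ ^ 2 = ENNReal.ofReal (∫ t, ‖φ t‖ ^ 2) := by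
  rw [ofReal_integral_eq_lintegral_ofReal
    (by simpa using (φ.memLp 2 volume).integrable_norm_pow (by norm_num))
    (ae_of_all _ fun t => by positivity)]
  refine lintegral_congr fun t => ?_
  rw [← ofReal_norm, ENNReal.ofReal_pow (norm_nonneg _)]

/-- Plancherel's theorem. -/
theorem lintegral_enorm_sq_fourierInv (φ : 𝓢(ℝ, ℂ)) :
    ∫⁻ ν, ‖(𝓕⁻ φ) ν‖ₑ ^ 2 = ∫⁻ t, ‖φ t‖ₑ ^ 2 := by
  rw [lintegral_enorm_sq_schwartz, lintegral_enorm_sq_schwartz,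
    ← SchwartzMap.integral_norm_sq_fourier (𝓕⁻ φ), FourierTransform.fourier_fourierInv_eq]

/-- The Fourier coefficients of elements of `X_{s,1/2}` are square integrable in time. -/
theorem exists_enorm_apply_sq_le {s : ℝ} {u : SpaceTimeDist} (hu : xNorm s (1 / 2) u < ⊤) (η : ℤ) :
    ∃ M : ℝ≥0∞, M ≠ ⊤ ∧ ∀ φ : 𝓢(ℝ, ℂ), ‖u η φ‖ₑ ^ 2 ≤ M * ∫⁻ t, ‖φ t‖ₑ ^ 2 := by
  obtain ⟨g₀, hg₀⟩ := iInf_lt_iff.1 hu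
  obtain ⟨h₀, hg₀⟩ := iInf_lt_iff.1 hg₀
  obtain ⟨g, h, hm, -, hle⟩ := h₀.exists_measurable s (1 / 2)
  have hX := wsq_one_lt_top (hle.trans_lt hg₀)
  have hgη := hm η
  have h1 : ∫⁻ τ, ‖g η τ‖ₑ ^ 2 < ⊤ := by
    have h2 := (ENNReal.le_tsum η).trans_lt hX
    rw [lintegral_const_mul' _ _ (ebracket_rpow_ne_top _ _)] at h2
    have h3 : ∫⁻ τ, ebracket (τ - (η : ℝ) ^ 3) ^ (1 : ℝ) * ‖g η τ‖ₑ ^ 2 < ⊤ :=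
      ENNReal.lt_top_of_mul_ne_top_right h2.ne (by simp [ebracket_ne_zero, ebracket_ne_top])
    refine lt_of_le_of_lt (lintegral_mono fun τ => ?_) h3
    refine le_mul_of_one_le_left zero_le ?_
    rw [ENNReal.rpow_one]
    exact one_le_ebracket _
  refine ⟨∫⁻ ν, ‖g η (2 * Real.pi * ν)‖ₑ ^ 2, ?_, fun φ => ?_⟩
  · rw [lintegral_comp_two_pi fun τ => ‖g η τ‖ₑ ^ 2]
    finiteness
  have e : u η φ = (𝓕 (u η)) (𝓕⁻ φ) := by
    rw [TemperedDistribution.fourier_apply, FourierTransform.fourier_fourierInv_eq]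
  rw [e, (h η _).2, ← lintegral_enorm_sq_fourierInv φ]
  have hc := (𝓕⁻ φ).continuous
  refine le_trans (pow_le_pow_left' (enorm_integral_le_lintegral_enorm _) 2) ?_
  refine sq_lintegral_le (by fun_prop) (by fun_prop) fun ν => ?_
  rw [enorm_mul, mul_pow]
  exact (mul_comm _ _).le

theorem tsupport_cutoffSchwartz_subset {ψ : ℝ → ℝ} (hψ : ContDiff ℝ ∞ ψ) (hc : HasCompactSupport ψ)
    (hsupp : tsupport ψ ⊆ Icc (-1) 1) (δ : ℝ) (hδ : 0 < δ) :
    tsupport (cutoffSchwartz ψ hψ hc δ hδ) ⊆ Icc (-δ) δ := by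
  refine closure_minimal (fun t ht => ?_) isClosed_Icc
  have h1 : ψ (t / δ) ≠ 0 := fun h0 => ht (by rw [cutoffSchwartz_apply, h0, Complex.ofReal_zero])
  have h2 := hsupp (subset_tsupport ψ h1)
  rw [mem_Icc, le_div_iff₀ hδ, div_le_iff₀ hδ] at h2
  exact ⟨by linarith [h2.1], by linarith [h2.2]⟩

/-- The products `ψ(t/δ) φ` depend on `δ` continuously in `L²`. -/
theorem tendsto_lintegral_cutoff_sub {ψ : ℝ → ℝ} (hψ : ContDiff ℝ ∞ ψ) (hc : HasCompactSupport ψ)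
    {δ : ℝ} (hδ : 0 < δ) {d : ℕ → ℝ} (hd : ∀ n, 0 < d n)
    (hlim : Filter.Tendsto d Filter.atTop (nhds δ)) (φ : 𝓢(ℝ, ℂ)) :
    Filter.Tendsto (fun n => ∫⁻ t,
      ‖(SchwartzMap.smulLeftCLM ℂ (cutoffSchwartz ψ hψ hc (d n) (hd n)) φ
      - SchwartzMap.smulLeftCLM ℂ (cutoffSchwartz ψ hψ hc δ hδ) φ) t‖ₑ ^ 2)
      Filter.atTop (nhds 0) := by
  obtain ⟨B, hB⟩ := hc.exists_bound_of_continuous hψ.continuous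
  have hpt : ∀ n t, (SchwartzMap.smulLeftCLM ℂ (cutoffSchwartz ψ hψ hc (d n) (hd n)) φ
      - SchwartzMap.smulLeftCLM ℂ (cutoffSchwartz ψ hψ hc δ hδ) φ) t =
      ((ψ (t / d n) - ψ (t / δ) : ℝ) : ℂ) * φ t := fun n t => by
    rw [sub_apply,
      SchwartzMap.smulLeftCLM_apply_apply (SchwartzMap.hasTemperateGrowth _),
      SchwartzMap.smulLeftCLM_apply_apply (SchwartzMap.hasTemperateGrowth _),
      cutoffSchwartz_apply, cutoffSchwartz_apply, smul_eq_mul, smul_eq_mul]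
    push_cast; ring
  have h0 : ∫⁻ _ : ℝ, (0 : ℝ≥0∞) = 0 := lintegral_zero
  simp only [hpt]
  rw [← h0]
  have hφ := φ.continuous
  have hψc := hψ.continuous
  refine tendsto_lintegral_of_dominated_convergence
    (fun t => ENNReal.ofReal (B + B) ^ 2 * ‖φ t‖ₑ ^ 2) (fun n => ?_) (fun n => ?_) ?_ ?_
  · have h1 : Continuous fun t => ((ψ (t / d n) - ψ (t / δ) : ℝ) : ℂ) * φ t := by fun_prop
    exact h1.measurable.enorm.pow_const 2
  · refine ae_of_all _ fun t => ?_
    beta_reduce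
    rw [enorm_mul, mul_pow]
    refine mul_le_mul_left (pow_le_pow_left' ?_ 2) _
    rw [← ofReal_norm, Complex.norm_real]
    exact ENNReal.ofReal_le_ofReal ((norm_sub_le _ _).trans (add_le_add (hB _) (hB _)))
  · rw [lintegral_const_mul' _ _ (by finiteness), lintegral_enorm_sq_schwartz]
    finiteness
  · refine ae_of_all _ fun t => ?_
    have h1 : Filter.Tendsto (fun n => ((ψ (t / d n) - ψ (t / δ) : ℝ) : ℂ) * φ t) Filter.atTop
        (nhds (((ψ (t / δ) - ψ (t / δ) : ℝ) : ℂ) * φ t)) := by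
      have h2 : Filter.Tendsto (fun n => ψ (t / d n)) Filter.atTop (nhds (ψ (t / δ))) :=
        (hψc.tendsto _).comp (tendsto_const_nhds.div hlim hδ.ne')
      exact ((Complex.continuous_ofReal.tendsto _).comp (h2.sub_const _)).mul_const _
    have h3 := ((ENNReal.continuous_pow 2).tendsto _).comp h1.enorm
    simpa [Function.comp_def] using h3

/-- If the support of the cutoff is contained in an interval, then the cut off distributions depend
only on the restrictions to its interior, since their Fourier coefficients are square integrable:
the boundary points do not matter. -/
theorem cutoff_apply_eq {s : ℝ} {ψ : ℝ → ℝ} (hψ : ContDiff ℝ ∞ ψ) (hc : HasCompactSupport ψ)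
    (hsupp : tsupport ψ ⊆ Icc (-1) 1) {δ : ℝ} (hδ : 0 < δ) {u v w : SpaceTimeDist}
    (hv : xNorm s (1 / 2) v < ⊤) (hw : xNorm s (1 / 2) w < ⊤)
    (huv : AgreeOn (Icc (-δ) δ) u v) (huw : AgreeOn (Icc (-δ) δ) u w) (η : ℤ) (φ : 𝓢(ℝ, ℂ)) :
    v η (SchwartzMap.smulLeftCLM ℂ (cutoffSchwartz ψ hψ hc δ hδ) φ) =
      w η (SchwartzMap.smulLeftCLM ℂ (cutoffSchwartz ψ hψ hc δ hδ) φ) := by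
  -- approximation by cutoffs that are supported in the interior
  set d : ℕ → ℝ := fun n => δ * (1 - 1 / (n + 2)) with hd
  have hn : ∀ n : ℕ, 1 / ((n : ℝ) + 2) ≤ 1 / 2 := fun n => by
    gcongr; linarith [n.cast_nonneg (α := ℝ)]
  have hn0 : ∀ n : ℕ, 0 < 1 / ((n : ℝ) + 2) := fun n => by positivity
  have hd0 : ∀ n, 0 < d n := fun n => mul_pos hδ (by linarith [hn n])
  have hdδ : ∀ n, d n < δ := fun n => mul_lt_of_lt_one_right hδ (by linarith [hn0 n])
  have hlim : Filter.Tendsto d Filter.atTop (nhds δ) := by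
    have h1 : Filter.Tendsto (fun n : ℕ => 1 / ((n : ℝ) + 2)) Filter.atTop (nhds 0) := by
      have := (Filter.tendsto_add_atTop_iff_nat 2).2
        (tendsto_one_div_atTop_nhds_zero_nat (𝕜 := ℝ))
      simpa using this
    simpa [hd] using (h1.const_sub 1).const_mul δ
  set χ : ℕ → 𝓢(ℝ, ℂ) := fun n =>
    SchwartzMap.smulLeftCLM ℂ (cutoffSchwartz ψ hψ hc (d n) (hd0 n)) φ with hχ
  set χ' := SchwartzMap.smulLeftCLM ℂ (cutoffSchwartz ψ hψ hc δ hδ) φ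
  have hconv : ∀ z : SpaceTimeDist, xNorm s (1 / 2) z < ⊤ →
      Filter.Tendsto (fun n => z η (χ n)) Filter.atTop (nhds (z η χ')) := fun z hz => by
    obtain ⟨M, hM, h⟩ := exists_enorm_apply_sq_le hz η
    have h1 := ENNReal.Tendsto.const_mul (tendsto_lintegral_cutoff_sub hψ hc hδ hd0 hlim φ)
      (Or.inr hM)
    rw [mul_zero] at h1
    have h2 : Filter.Tendsto (fun n => ‖z η (χ n - χ')‖ₑ ^ 2) Filter.atTop (nhds 0) :=
      tendsto_of_tendsto_of_tendsto_of_le_of_le tendsto_const_nhds h1 (fun _ => zero_le)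
        fun n => h _
    have h3 := (ENNReal.continuous_rpow_const (y := 1 / 2)).tendsto 0 |>.comp h2
    rw [tendsto_iff_edist_tendsto_0]
    rw [ENNReal.zero_rpow_of_pos (by norm_num)] at h3
    refine h3.congr fun n => ?_
    rw [Function.comp_apply, ← ENNReal.rpow_natCast, ← ENNReal.rpow_mul, map_sub,
      edist_eq_enorm_sub]
    norm_num
  have hin : ∀ n, tsupport (χ n) ⊆ interior (Icc (-δ) δ) := fun n => by
    refine (SchwartzMap.tsupport_smulLeftCLM_subset _ _).trans (inter_subset_right.trans ?_)
    refine (tsupport_cutoffSchwartz_subset hψ hc hsupp _ (hd0 n)).trans ?_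
    rw [interior_Icc]
    exact Icc_subset_Ioo (by linarith [hdδ n]) (hdδ n)
  have he : ∀ n, v η (χ n) = w η (χ n) := fun n => by
    rw [← huv η _ (hin n), ← huw η _ (hin n)]
  exact tendsto_nhds_unique (hconv v hv) ((hconv w hw).congr fun n => (he n).symm)

theorem cutoff_dx_prod_eq {s : ℝ} (hs : -1 / 4 < s) {ψ : ℝ → ℝ} (hψ : ContDiff ℝ ∞ ψ)
    (hc : HasCompactSupport ψ) (hsupp : tsupport ψ ⊆ Icc (-1) 1) {δ : ℝ} (hδ : 0 < δ)
    {u v w : SpaceTimeDist} {a : SpaceDist} (ha : hNorm s a < ⊤)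
    (hv : xNorm s (1 / 2) v < ⊤) (hw : xNorm s (1 / 2) w < ⊤)
    (huv : AgreeOn (Icc (-δ) δ) u v) (huw : AgreeOn (Icc (-δ) δ) u w) :
    cutoff ψ δ (dx (prod v a)) = cutoff ψ δ (dx (prod w a)) := by
  have e : ∀ (z : SpaceTimeDist) (ξ : ℤ) (φ : 𝓢(ℝ, ℂ)), cutoff ψ δ (dx (prod z a)) ξ φ =
      Complex.I * (ξ : ℂ) * ((((2 * Real.pi)⁻¹ : ℝ) : ℂ) * (∑' η : ℤ, prodTerm z a ξ η)
        (SchwartzMap.smulLeftCLM ℂ (cutoffSchwartz ψ hψ hc δ hδ) φ)) := fun z ξ φ => rfl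
  funext ξ
  ext φ
  rw [e, e, ← (tsum_prodTerm_apply (hasProd_of_xNorm_lt_top hs ha hv) ξ _).tsum_eq,
    ← (tsum_prodTerm_apply (hasProd_of_xNorm_lt_top hs ha hw) ξ _).tsum_eq]
  congr 3; ext η
  rw [cutoff_apply_eq hψ hc hsupp hδ hv hw huv huw]

/-- Removing the `x`-mean does not increase the norms. -/
theorem xNorm_update_zero_le (s b : ℝ) (u : SpaceTimeDist) :
    xNorm s b (Function.update u 0 0) ≤ xNorm s b u := by
  refine le_iInf₂ fun g h => ?_
  refine (iInf₂_le (Function.update g 0 0) fun ξ φ => ?_).trans ?_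
  · rcases eq_or_ne ξ 0 with rfl | hξ
    · simp
    · simpa [hξ] using h ξ φ
  · rw [xNormHat_eq, xNormHat_eq]
    refine ENNReal.rpow_le_rpow (mul_le_mul_right ?_ _) (by norm_num)
    have := wsq_le_mul (s := s) (b := 2 * b)
      (f := fun ξ τ => ‖(Function.update g 0 0 : ℤ → ℝ → ℂ) ξ τ‖ₑ)
      (m := fun ξ τ => ‖g ξ τ‖ₑ) ENNReal.one_ne_top fun ξ τ => by
        rcases eq_or_ne ξ 0 with rfl | hξ <;> simp [*]
    simpa using this

theorem AgreeOn.update_zero {Ω : Set ℝ} {u v : SpaceTimeDist} (h : AgreeOn Ω u v)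
    (hu : MeanZeroOn Ω u) : AgreeOn Ω u (Function.update v 0 0) := by
  intro ξ φ hφ
  rcases eq_or_ne ξ 0 with rfl | hξ
  · simpa using hu φ hφ
  · simpa [hξ] using h ξ φ hφ

end PeriodicKdV

theorem lemma2p7 (s : ℝ) (hs : -1 / 4 < s)
    (ψ : ℝ → ℝ) (hψ : ContDiff ℝ ∞ ψ) (hψc : HasCompactSupport ψ) (hψe : ∀ t, ψ (-t) = ψ t)
    (ε : ℝ) (hε : 0 < ε) :
    ∃ C : ℝ≥0, ∀ δ : ℝ, 0 < δ → δ ≤ 1 →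
      ∀ u : PeriodicKdV.SpaceTimeDist,
        PeriodicKdV.xNormOn (Icc (-δ) δ) s (1 / 2) u < ⊤ →
        PeriodicKdV.MeanZeroOn (Icc (-δ) δ) u →
      ∀ a : PeriodicKdV.SpaceDist, PeriodicKdV.hNorm s a < ⊤ → a 0 = 0 →
      ∀ U : PeriodicKdV.SpaceTimeDist,
        PeriodicKdV.AgreeOn (Icc (-δ) δ) u U → PeriodicKdV.xNorm s (1 / 2) U < ⊤ →
        PeriodicKdV.HasProd U a ∧
        (U 0 = 0 →
          PeriodicKdV.zNorm s
              (PeriodicKdV.cutoff ψ δ (PeriodicKdV.dx (PeriodicKdV.prod U a))) ≤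
            C * ENNReal.ofReal (δ ^ (1 / 3 - ε)) * PeriodicKdV.xNorm s (1 / 2) U *
              PeriodicKdV.hNorm s a) ∧
        (tsupport ψ ⊆ Icc (-1) 1 →
          PeriodicKdV.zNorm s
              (PeriodicKdV.cutoff ψ δ (PeriodicKdV.dx (PeriodicKdV.prod U a))) ≤
            C * ENNReal.ofReal (δ ^ (1 / 3 - ε)) *
              PeriodicKdV.xNormOn (Icc (-δ) δ) s (1 / 2) u * PeriodicKdV.hNorm s a) := by
  obtain ⟨C, hC⟩ := PeriodicKdV.exists_zNorm_le hs ψ hψ hψc hε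
  refine ⟨C, fun δ hδ hδ1 u hu hu0 a ha ha0 U hU hUX =>
    ⟨PeriodicKdV.hasProd_of_xNorm_lt_top hs ha hUX, fun hU0 => ?_, fun hsupp => ?_⟩⟩
  · rw [mul_right_comm]
    exact hC δ hδ hδ1 a ha ha0 U hUX hU0
  · rw [mul_right_comm]
    refine PeriodicKdV.le_mul_biInf (by finiteness) hu fun V hV hVX => ?_
    have hWX := (PeriodicKdV.xNorm_update_zero_le s (1 / 2) V).trans_lt hVX
    rw [PeriodicKdV.cutoff_dx_prod_eq hs hψ hψc hsupp hδ ha hUX hWX hU (hV.update_zero hu0)]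
    exact (hC δ hδ hδ1 a ha ha0 _ hWX (Function.update_self ..)).trans
      (mul_le_mul_right (PeriodicKdV.xNorm_update_zero_le s (1 / 2) V) _)
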